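/- Let $q\in\mathbb C$ with $0<|q|<1$. For $n\in\mathbb Z$ put $(x;q)_n=\prod_{i=0}^{n-1}(1-xq^i)$ if $n\ge 0$, $(x;q)_n=1/\prod_{j=n}^{-1}(1-xq^j)$ if $n<0$, and $(x;q)_\infty=\prod_{k\ge0}(1-xq^k)$; write $(x_1,\dots,x_r;q)_n=(x_1;q)_n\cdots(x_r;q)_n$ for $n\in\mathbb Z\cup\{\infty\}$. Let $${}_{r+1}\phi_r\!\left[{a_0,\dots,a_r\atop b_1,\dots,b_r};q,z\right]=\sum_{k=0}^{\infty}\frac{(a_0,\dots,a_r;q)_k}{(q,b_1,\dots,b_r;q)_k}z^k,\qquad {}_r\psi_r\!\left[{a_1,\dots,a_r\atop b_1,\dots,b_r};q,z\right]=\sum_{k=-\infty}^{\infty}\frac{(a_1,\dots,a_r;q)_k}{(b_1,\dots,b_r;q)_k}z^k .$$ Let $a,b,c,d,e,f,g$ be nonzero complex numbers with $$\max\left\{\left|\frac{q^2a^3}{bcdefg}\right|,\left|\frac{qa}{bc}\right|\right\}<1,$$ let $\sqrt a$, $\sqrt{qaf/deg}$, $\sqrt{qag/def}$ denote any choices of the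 square roots, and suppose that no denominator (in a term of a series or in an infinite product) in the formula below vanishes. Put $$S(f,g)=\frac{(q,\,qa,\,q/a,\,qa/bc,\,qa/bf,\,qa/cf,\,qa/df,\,qa/ef,\,qf/d,\,qf/e,\,g,\,g/a,\,q^2a^2/bdeg,\,q^2a^2/cdeg;q)_\infty}{(q/b,\,q/c,\,q/d,\,q/e,\,q/f,\,qa/b,\,qa/c,\,qa/d,\,qa/e,\,qa/f,\,g/f,\,fg/a,\,q^2af/deg,\,q^2a^3/bcdefg;q)_\infty}$$ $$\times\ {}_8\phi_7\!\left[{\lambda,\ q\sqrt\lambda,\ -q\sqrt\lambda,\ qa/de,\ qa/dg,\ qa/eg,\ bf/a,\ cf/a\atop \sqrt\lambda,\ -\sqrt\lambda,\ qf/g,\ qf/e,\ qf/d,\ q^2a^2/bdeg,\ q^2a^2/cdeg};q,\frac{qa}{bc}\right],\qquad \lambda=\frac{qaf}{deg},$$ and let $S(g,f)$ be the same expression with $f$ and $g$ interchanged. Then the series below and the two ${}_8\phi_7$-series converge absolutely, and $${}_8\psi_8\!\left[{q\sqrt a,\ -q\sqrt a,\ b,\ c,\ d,\ e,\ f,\ g\atop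 \sqrt a,\ -\sqrt a,\ qa/b,\ qa/c,\ qa/d,\ qa/e,\ qa/f,\ qa/g};q,\frac{q^2a^3}{bcdefg}\right]=S(f,g)+S(g,f).$$ Moreover, if $g=aq/e$, the two sides of this identity are the two sides of Bailey's ${}_6\psi_6$ identity with parameters $b,c,d,f$: the left side equals $${}_6\psi_6\!\left[{q\sqrt a,\ -q\sqrt a,\ b,\ c,\ d,\ f\atop \sqrt a,\ -\sqrt a,\ qa/b,\ qa/c,\ qa/d,\ qa/f};q,\frac{qa^2}{bcdf}\right],$$ and the right side equals $$\frac{(q,\,qa,\,q/a,\,qa/bc,\,qa/bd,\,qa/bf,\,qa/cd,\,qa/cf,\,qa/df;q)_\infty}{(q/b,\,q/c,\,q/d,\,q/f,\,qa/b,\,qa/c,\,qa/d,\,qa/f,\,qa^2/bcdf;q)_\infty}.$$ -/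

import Mathlib

/-- The `q`-shifted factorial `(x;q)_n` for `n : ℤ`:
`∏_{i=0}^{n-1} (1 - x q^i)` for `n ≥ 0`, and `1 / ∏_{j=n}^{-1} (1 - x q^j)` for `n < 0`
(for `n = -(m+1)` the index `j` of the product is `-(i+1)` with `0 ≤ i ≤ m`). -/
noncomputable def qPoch (q x : ℂ) : ℤ → ℂ
  | Int.ofNat n => ∏ i ∈ Finset.range n, (1 - x * q ^ i)
  | Int.negSucc m => (∏ i ∈ Finset.range (m + 1), (1 - x * q ^ (-((i : ℤ) + 1))))⁻¹

/-- `(x;q)_∞ = ∏_{k ≥ 0} (1 - x q^k)`. -/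
noncomputable def qPochInf (q x : ℂ) : ℂ := ∏' k : ℕ, (1 - x * q ^ k)

/-- `(x₁, …, x_r;q)_n`. -/
noncomputable def qPochList (q : ℂ) (xs : List ℂ) (n : ℤ) : ℂ :=
  (xs.map fun x => qPoch q x n).prod

/-- `(x₁, …, x_r;q)_∞`. -/
noncomputable def qPochInfList (q : ℂ) (xs : List ℂ) : ℂ :=
  (xs.map fun x => qPochInf q x).prod

/-- The `k`-th term of the unilateral series with upper parameters `as = [a₀, …, a_r]`,
lower parameters `bs = [b₁, …, b_s]`, base `q` and argument `z`. The exponent below is `s - r`. -/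
noncomputable def phiTerm (as bs : List ℂ) (q z : ℂ) (k : ℕ) : ℂ :=
  qPochList q as k / qPochList q (q :: bs) k *
    ((-1) ^ k * q ^ k.choose 2) ^ ((bs.length : ℤ) + 1 - as.length) * z ^ k

/-- The unilateral basic hypergeometric series `φ`. -/
noncomputable def phi (as bs : List ℂ) (q z : ℂ) : ℂ := ∑' k : ℕ, phiTerm as bs q z k

/-- The `k`-th term of the bilateral series with upper parameters `as = [a₁, …, a_r]`,
lower parameters `bs = [b₁, …, b_s]`, base `q` and argument `z`; here
`k.choose 2 = k (k - 1) / 2`, an integer for each `k : ℤ`. -/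
noncomputable def psiTerm (as bs : List ℂ) (q z : ℂ) (k : ℤ) : ℂ :=
  qPochList q as k / qPochList q bs k *
    ((-1) ^ k * q ^ (k * (k - 1) / 2)) ^ ((bs.length : ℤ) - as.length) * z ^ k

/-- The bilateral basic hypergeometric series `ψ`. -/
noncomputable def psi (as bs : List ℂ) (q z : ℂ) : ℂ := ∑' k : ℤ, psiTerm as bs q z k

/-- No factor of `(x;q)_∞` vanishes. -/
def QNonzero (q x : ℂ) : Prop := ∀ n : ℕ, 1 - x * q ^ n ≠ 0

/-- No term of a unilateral series with these lower parameters has a zero denominator. -/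
def PhiDefined (bs : List ℂ) (q : ℂ) : Prop := ∀ x ∈ bs, QNonzero q x

/-- No term of a bilateral series with these parameters has a zero denominator:
`(x;q)_k ≠ 0` for lower `x` and `k ≥ 0`, and `∏_{j=k}^{-1} (1 - x q^j) ≠ 0` for upper `x` and
`k < 0`; the factor `1 - x q^{-n-1}` vanishes exactly when `1 - (q / x) q^n` does. -/
def PsiDefined (as bs : List ℂ) (q : ℂ) : Prop :=
  (∀ x ∈ as, QNonzero q (q / x)) ∧ ∀ x ∈ bs, QNonzero q x

/-- Numerator parameters of the infinite product. -/
noncomputable def extNum (q a b c d e f g : ℂ) : List ℂ :=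
  [q, q * a, q / a, q * a / (b * c), q * a / (b * f), q * a / (c * f), q * a / (d * f),
    q * a / (e * f), q * f / d, q * f / e, g, g / a,
    q ^ 2 * a ^ 2 / (b * d * e * g), q ^ 2 * a ^ 2 / (c * d * e * g)]

/-- Denominator parameters of the infinite product. -/
noncomputable def extDen (q a b c d e f g : ℂ) : List ℂ :=
  [q / b, q / c, q / d, q / e, q / f, q * a / b, q * a / c, q * a / d, q * a / e, q * a / f,
    g / f, f * g / a, q ^ 2 * a * f / (d * e * g), q ^ 2 * a ^ 3 / (b * c * d * e * f * g)]

/-- Upper parameters of the `₈φ₇`, where `t` is a square root of `q a f / (d e g)`. -/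
noncomputable def extUpper (q a b c d e f g t : ℂ) : List ℂ :=
  [q * a * f / (d * e * g), q * t, -(q * t), q * a / (d * e), q * a / (d * g), q * a / (e * g),
    b * f / a, c * f / a]

/-- Lower parameters of the `₈φ₇`, where `t` is a square root of `q a f / (d e g)`. -/
noncomputable def extLower (q a b c d e f g t : ℂ) : List ℂ :=
  [t, -t, q * f / g, q * f / e, q * f / d,
    q ^ 2 * a ^ 2 / (b * d * e * g), q ^ 2 * a ^ 2 / (c * d * e * g)]

/-- Infinite product times `₈φ₇`: the expression to which its `idem(f;g)` is added. -/
noncomputable def extSummand (q a b c d e f g t : ℂ) : ℂ :=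
  qPochInfList q (extNum q a b c d e f g) / qPochInfList q (extDen q a b c d e f g) *
    phi (extUpper q a b c d e f g t) (extLower q a b c d e f g t) q (q * a / (b * c))

/-! For y = 1/b the function `biTheta q a y k` is (q/b, qa/b;q)_∞ (b;q)_k / (qa/b;q)_k · b^(-k). It
is entire in y, so once these products are cleared each bilateral series becomes a sum over k of (1
- a q^(2k)) w^k times such factors, defined even at y = 0.

The ₈ψ₈ is reduced to Bailey's ₆ψ₆ sum by means of the nonterminating Jackson sum `jacksonSum_eq`.
For fixed k, take the latter with r = g/f and parameters qa/dg, qa/eg, f q^k, f q^(-k)/a. It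
evaluates to a product over the six pairs of parameters. Four pairs rebuild the factors of d and e
in the kth term of the ₈ψ₈; the other two give (q²a²/defg;q)_∞ and (fg/a;q)_∞, free of k. So a
constant times the kth term is a difference of two series over n, exchanged by f ↔ g. In the first
of these the factor of f absorbs finite products and becomes the factor of f q^n, while the factor
of g collapses by theta quasi-periodicity. What remains is, up to a factor depending on n only, the
kth term of a ₆ψ₆ with parameters b, c, f q^n, deg/(a q^(n+1)). The double series converges
absolutely (`summable_expansion`; here |qa/bc| < 1 enters), so one may sum over k first by
`tsum_wellPoisedSix`, and the sum left over n is the ₈φ₇.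

Both summation theorems are proved in the same way. Multiplying one parameter by q (a reciprocal y
in the ₆ψ₆, a B in Jackson's sum) changes the sum by explicit factors, because a combination of
terms telescopes. Iteration sends the parameters to 0, and the remaining constant is found from a
choice of parameters for which a single term survives. In Jackson's case the telescoping leaves a
boundary term, and the combination in `jacksonSum` is the one in which the boundary terms of the two
complementary series cancel.

The factor (q²a²/defg;q)_∞ appears on both sides and may vanish. In that case f, g are replaced by
ft, gt with t ↓ 1, which preserves f/g, and the identity follows by continuity.

If g = aq/e, the factors of e and g cancel in the bilateral series, which is then the ₆ψ₆; the right
side is evaluated through the identity already proved. -/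

section WellPoised

open Filter Topology Finset

/-! ### Finite and infinite q-shifted factorials: recurrences, bounds, continuity. -/

section Pochhammer

variable {q : ℂ}

/-- The finite `q`-shifted factorial `(x;q)_n` for `n : ℕ`. -/
noncomputable def qPochNat (q x : ℂ) (n : ℕ) : ℂ := ∏ i ∈ range n, (1 - x * q ^ i)

@[simp] lemma qPochNat_zero (x : ℂ) : qPochNat q x 0 = 1 := by simp [qPochNat]

lemma qPochNat_succ (x : ℂ) (n : ℕ) :
    qPochNat q x (n + 1) = qPochNat q x n * (1 - x * q ^ n) := by
  simp [qPochNat, prod_range_succ]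

lemma qPochNat_succ' (x : ℂ) (n : ℕ) :
    qPochNat q x (n + 1) = (1 - x) * qPochNat q (x * q) n := by
  simp only [qPochNat, prod_range_succ', pow_zero, mul_one]
  rw [mul_comm]
  congr 1
  exact prod_congr rfl fun i _ => by ring

lemma summable_norm_mul_pow (hq : ‖q‖ < 1) (x : ℂ) : Summable fun k : ℕ => ‖-(x * q ^ k)‖ := by
  simp only [norm_neg, norm_mul, norm_pow]
  exact (summable_geometric_of_lt_one (norm_nonneg _) hq).mul_left _

lemma multipliable_qPochInf (hq : ‖q‖ < 1) (x : ℂ) :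
    Multipliable fun k : ℕ => (1 - x * q ^ k) := by
  simpa [sub_eq_add_neg] using multipliable_one_add_of_summable (summable_norm_mul_pow hq x)

lemma qPochInf_eq_nat (hq : ‖q‖ < 1) (x : ℂ) (n : ℕ) :
    qPochInf q x = qPochNat q x n * qPochInf q (x * q ^ n) := by
  have h : (fun k : ℕ => (1 - x * q ^ n * q ^ k)) = fun k => 1 - x * q ^ (k + n) := by
    ext k; rw [pow_add]; ring
  have := (h ▸ multipliable_qPochInf hq (x * q ^ n)).prod_mul_tprod_nat_mul'
    (f := fun k : ℕ => (1 - x * q ^ k))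
  rw [qPochInf, ← this, qPochNat, qPochInf, h]

lemma qPochInf_eq (hq : ‖q‖ < 1) (x : ℂ) : qPochInf q x = (1 - x) * qPochInf q (x * q) := by
  simpa [qPochNat] using qPochInf_eq_nat hq x 1

@[simp] lemma qPochInf_zero : qPochInf q 0 = 1 := by simp [qPochInf]

lemma qPochInf_one (hq : ‖q‖ < 1) : qPochInf q 1 = 0 := by rw [qPochInf_eq hq]; simp

lemma qPochInf_ne_zero (hq : ‖q‖ < 1) {x : ℂ} (hx : QNonzero q x) : qPochInf q x ≠ 0 := by
  have := tprod_one_add_ne_zero_of_summable (f := fun k : ℕ => -(x * q ^ k))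
    (fun i => by simpa [sub_eq_add_neg] using hx i) (summable_norm_mul_pow hq x)
  simpa [qPochInf, sub_eq_add_neg] using this

lemma qPochNat_ne_zero {x : ℂ} (hx : QNonzero q x) (n : ℕ) : qPochNat q x n ≠ 0 :=
  prod_ne_zero_iff.2 fun i _ => hx i

lemma QNonzero.mul_pow {x : ℂ} (hx : QNonzero q x) (n : ℕ) : QNonzero q (x * q ^ n) := fun k => by
  have := hx (n + k)
  rwa [pow_add, ← mul_assoc] at this

lemma QNonzero.mul_q {x : ℂ} (hx : QNonzero q x) : QNonzero q (x * q) := by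
  simpa using hx.mul_pow 1

lemma qNonzero_zero : QNonzero q 0 := fun n => by simp

lemma qNonzero_q (hq : ‖q‖ < 1) : QNonzero q q := fun n h => by
  have h1 : q ^ (n + 1) = 1 := by rw [pow_succ']; linear_combination -h
  have h2 : ‖q‖ ^ (n + 1) < 1 := pow_lt_one₀ (norm_nonneg _) hq (by simp)
  rw [← norm_pow, h1] at h2
  simp at h2

/-- A bound for all products `∏ (1 + R ‖q‖ ^ i)`. -/
noncomputable def qBound (q : ℂ) (R : ℝ) : ℝ := Real.exp (R * (1 - ‖q‖)⁻¹)

lemma qBound_pos (R : ℝ) : 0 < qBound q R := Real.exp_pos _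

lemma prod_one_add_le_qBound (hq : ‖q‖ < 1) {R : ℝ} (hR : 0 ≤ R) (n : ℕ) :
    ∏ i ∈ range n, (1 + R * ‖q‖ ^ i) ≤ qBound q R := by
  calc ∏ i ∈ range n, (1 + R * ‖q‖ ^ i) ≤ ∏ i ∈ range n, Real.exp (R * ‖q‖ ^ i) := by
        refine prod_le_prod (fun i _ => by positivity) fun i _ => ?_
        rw [add_comm]; exact Real.add_one_le_exp _
    _ = Real.exp (R * ∑ i ∈ range n, ‖q‖ ^ i) := by rw [← Real.exp_sum, mul_sum]
    _ ≤ _ := by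
        refine Real.exp_le_exp.2 (mul_le_mul_of_nonneg_left ?_ hR)
        rw [← tsum_geometric_of_lt_one (norm_nonneg _) hq]
        exact (summable_geometric_of_lt_one (norm_nonneg _) hq).sum_le_tsum _
          (fun i _ => by positivity)

lemma norm_qPochNat_le (hq : ‖q‖ < 1) {R : ℝ} {x : ℂ} (hx : ‖x‖ ≤ R) (n : ℕ) :
    ‖qPochNat q x n‖ ≤ qBound q R := by
  have hR : 0 ≤ R := (norm_nonneg _).trans hx
  refine le_trans ?_ (prod_one_add_le_qBound hq hR n)
  rw [qPochNat, norm_prod]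
  refine prod_le_prod (fun i _ => norm_nonneg _) fun i _ => (norm_sub_le _ _).trans ?_
  rw [norm_one, norm_mul, norm_pow]
  gcongr

lemma tendsto_qPochNat (hq : ‖q‖ < 1) (x : ℂ) :
    Tendsto (qPochNat q x) atTop (𝓝 (qPochInf q x)) :=
  (multipliable_qPochInf hq x).hasProd.tendsto_prod_nat

lemma norm_qPochInf_le (hq : ‖q‖ < 1) {R : ℝ} {x : ℂ} (hx : ‖x‖ ≤ R) :
    ‖qPochInf q x‖ ≤ qBound q R :=
  le_of_tendsto (tendsto_qPochNat hq x).norm (Eventually.of_forall fun n => norm_qPochNat_le hq hx n)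

lemma continuous_qPochNat (n : ℕ) : Continuous fun x => qPochNat q x n := by
  unfold qPochNat; fun_prop

lemma continuous_qPochInf (hq : ‖q‖ < 1) : Continuous (qPochInf q) := by
  rw [continuous_iff_continuousAt]
  intro x
  have := tendsto_tprod_one_add_of_dominated_convergence (𝓕 := 𝓝 x)
    (f := fun y (k : ℕ) => -(y * q ^ k)) (g := fun k => -(x * q ^ k))
    (bound := fun k => (‖x‖ + 1) * ‖q‖ ^ k)
    ((summable_geometric_of_lt_one (norm_nonneg _) hq).mul_left _)
    (fun k => by
      have : Continuous fun y : ℂ => -(y * q ^ k) := by fun_prop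
      exact this.tendsto x) (by
      filter_upwards [Metric.ball_mem_nhds x one_pos] with y hy k
      rw [norm_neg, norm_mul, norm_pow]
      gcongr
      have := norm_sub_norm_le y x
      rw [mem_ball_iff_norm] at hy
      linarith)
  simp only [← sub_eq_add_neg] at this
  exact this

lemma tendsto_mul_pow_zero (hq : ‖q‖ < 1) (x : ℂ) :
    Tendsto (fun n : ℕ => x * q ^ n) atTop (𝓝 0) := by
  simpa using (tendsto_pow_atTop_nhds_zero_of_norm_lt_one hq).const_mul x

lemma tendsto_qPochInf_mul_pow (hq : ‖q‖ < 1) (x : ℂ) :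
    Tendsto (fun n : ℕ => qPochInf q (x * q ^ n)) atTop (𝓝 1) := by
  simpa [Function.comp_def] using
    ((continuous_qPochInf hq).tendsto 0).comp (tendsto_mul_pow_zero hq x)

/-- The values tend to 1, so the inverses stay bounded. Vanishing values do no harm since `0⁻¹ = 0`,
so no nonvanishing hypothesis is needed. -/
lemma exists_norm_inv_qPochInf_le (hq : ‖q‖ < 1) {x : ℂ} :
    ∃ C > 0, ∀ n : ℕ, ‖(qPochInf q (x * q ^ n))⁻¹‖ ≤ C := by
  have h := ((tendsto_qPochInf_mul_pow hq x).inv₀ one_ne_zero).norm.bddAbove_range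
  obtain ⟨C, hC⟩ := h
  exact ⟨max C 1, by positivity, fun n => (hC ⟨n, rfl⟩).trans (le_max_left _ _)⟩

lemma int_rec_unique {F G c : ℤ → ℂ} (hc : ∀ k, c k ≠ 0) (h0 : F 0 = G 0)
    (hF : ∀ k, F (k + 1) = c k * F k) (hG : ∀ k, G (k + 1) = c k * G k) (k : ℤ) : F k = G k := by
  induction k using Int.induction_on with
  | zero => exact h0
  | succ i hi => rw [hF, hG, hi]
  | pred i hi =>
    have h1 := hF (-i - 1)
    have h2 := hG (-i - 1)
    rw [sub_add_cancel] at h1 h2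
    rw [h1, h2] at hi
    exact mul_left_cancel₀ (hc _) hi

/-! ### Theta products and the entire factors of the bilateral series. -/

/-- The integer `k (k - 1) / 2`. -/
def tri (k : ℤ) : ℤ := k * (k - 1) / 2

lemma tri_succ (k : ℤ) : tri (k + 1) = tri k + k := by
  unfold tri
  rw [← Int.add_mul_ediv_right _ _ two_ne_zero]
  congr 1; ring

lemma two_mul_tri (k : ℤ) : 2 * tri k = k * (k - 1) := by
  unfold tri
  have h : 2 ∣ k * (k - 1) := by
    rcases Int.even_or_odd k with h | h
    · exact h.two_dvd.mul_right _
    · exact (h.sub_odd odd_one).two_dvd.mul_left _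
  exact Int.mul_ediv_cancel' h

lemma tri_neg (k : ℤ) : tri (-k) = tri k + k := by
  have h1 := two_mul_tri (-k)
  have h2 := two_mul_tri k
  have : 2 * tri (-k) = 2 * (tri k + k) := by rw [h1, mul_add, h2]; ring
  linarith

@[simp] lemma tri_zero : tri 0 = 0 := rfl

/-- The theta product `(x, q/x; q)_∞`. -/
noncomputable def jtheta (q x : ℂ) : ℂ := qPochInf q x * qPochInf q (q / x)

lemma jtheta_mul_q (hq : ‖q‖ < 1) {x : ℂ} (hq0 : q ≠ 0) (hx : x ≠ 0) :
    jtheta q (x * q) = -x⁻¹ * jtheta q x := by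
  unfold jtheta
  rw [qPochInf_eq hq x, show q / (x * q) = x⁻¹ by field_simp, qPochInf_eq hq x⁻¹,
    show x⁻¹ * q = q / x by ring]
  field_simp
  ring

lemma jtheta_mul_zpow (hq : ‖q‖ < 1) {x : ℂ} (hq0 : q ≠ 0) (hx : x ≠ 0) (k : ℤ) :
    jtheta q (x * q ^ k) = (-1) ^ k * q ^ (-tri k) * x ^ (-k) * jtheta q x := by
  refine int_rec_unique (F := fun k => jtheta q (x * q ^ k))
    (G := fun k => (-1) ^ k * q ^ (-tri k) * x ^ (-k) * jtheta q x)
    (c := fun k => -(x * q ^ k)⁻¹) (fun k => ?_) (by simp) (fun k => ?_) (fun k => ?_) k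
  · have := zpow_ne_zero k hq0
    simp [*]
  · rw [zpow_add_one₀ hq0, ← mul_assoc, jtheta_mul_q hq hq0 (mul_ne_zero hx (zpow_ne_zero k hq0))]
  · simp only [tri_succ, neg_add, zpow_add₀ hq0, zpow_add₀ hx, zpow_neg, zpow_one,
      zpow_add_one₀ (show (-1 : ℂ) ≠ 0 by simp)]
    field_simp

/-- The product `(q/b, qa/b; q)_∞ (b; q)_k / (qa/b; q)_k b ^ (-k)` as an entire function of
`y = 1 / b`. -/
noncomputable def biTheta (q a y : ℂ) (k : ℤ) : ℂ :=
  (-1) ^ k * q ^ tri k * (qPochInf q (a * y * q ^ (k + 1)) * qPochInf q (y * q ^ (1 - k)))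

/-- This is the recurrence of (b;q)_k / (qa/b;q)_k · b^(-k) with y = 1/b, denominators cleared. It
serves both for telescoping and for identifying the series terms. -/
lemma biTheta_succ (hq : ‖q‖ < 1) (hq0 : q ≠ 0) (a y : ℂ) (k : ℤ) :
    (1 - a * y * q ^ (k + 1)) * biTheta q a y (k + 1) = (y - q ^ k) * biTheta q a y k := by
  unfold biTheta
  rw [qPochInf_eq hq (a * y * q ^ (k + 1)), tri_succ, show 1 - (k + 1) = -k by ring,
    qPochInf_eq hq (y * q ^ (-k)), mul_assoc (a * y), mul_assoc y (q ^ (-k)),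
    ← zpow_add_one₀ hq0, ← zpow_add_one₀ hq0, show -k + 1 = 1 - k by ring,
    zpow_add_one₀ (show (-1 : ℂ) ≠ 0 by simp), zpow_add₀ hq0 (tri k), zpow_neg]
  have := zpow_ne_zero k hq0
  field_simp
  ring

lemma biTheta_q_mul (hq : ‖q‖ < 1) (a y : ℂ) (k : ℤ) :
    biTheta q a y k =
      (1 - a * y * q ^ (k + 1)) * (1 - y * q ^ (1 - k)) * biTheta q a (y * q) k := by
  unfold biTheta
  rw [qPochInf_eq hq (a * y * q ^ (k + 1)), qPochInf_eq hq (y * q ^ (1 - k)),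
    show a * y * q ^ (k + 1) * q = a * (y * q) * q ^ (k + 1) by ring,
    show y * q ^ (1 - k) * q = y * q * q ^ (1 - k) by ring]
  ring

/-- For k ≥ 0 the small power of q and the large product (y q^(1-k);q)_∞ compensate each other; in
this form the geometric growth in k is visible. -/
lemma biTheta_natCast (hq : ‖q‖ < 1) (hq0 : q ≠ 0) (a y : ℂ) (k : ℕ) :
    biTheta q a y k =
      qPochInf q (a * y * q ^ (k + 1)) * qPochInf q (y * q) * ∏ i ∈ range k, (y - q ^ i) := by
  suffices h : (-1) ^ k * q ^ tri k * qPochInf q (y * q ^ (1 - (k : ℤ))) =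
      qPochInf q (y * q) * ∏ i ∈ range k, (y - q ^ i) by
    unfold biTheta
    rw [mul_assoc (qPochInf q (a * y * q ^ (k + 1))), ← h]
    norm_cast
    ring
  induction k with
  | zero => simp
  | succ k ih =>
    rw [prod_range_succ, ← mul_assoc, ← ih]
    push_cast
    rw [tri_succ, show (1 : ℤ) - (k + 1) = -k by ring, qPochInf_eq hq (y * q ^ (-(k : ℤ))),
      mul_assoc y (q ^ (-(k : ℤ))), ← zpow_add_one₀ hq0, show -(k : ℤ) + 1 = 1 - k by ring,
      zpow_add₀ hq0, zpow_neg, zpow_natCast]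
    have := pow_ne_zero k hq0
    field_simp
    ring

/-- Reflection k → -k swaps the two infinite products, so every estimate for k ≥ 0 also gives one
for k < 0. -/
lemma biTheta_neg (hq0 : q ≠ 0) {a : ℂ} (ha : a ≠ 0) (y : ℂ) (k : ℤ) :
    biTheta q a y (-k) = q ^ k * biTheta q a⁻¹ (a * y) k := by
  unfold biTheta
  rw [tri_neg, zpow_add₀ hq0, zpow_neg, ← inv_zpow, inv_neg, inv_one, inv_mul_cancel_left₀ ha,
    show -k + 1 = 1 - k by ring, show 1 - -k = k + 1 by ring]
  ring

lemma norm_biTheta_natCast_le (hq : ‖q‖ < 1) (hq0 : q ≠ 0) (a : ℂ) {R : ℝ} (hR : 0 < R) :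
    ∃ C > 0, ∀ y : ℂ, ‖y‖ ≤ R → ∀ k : ℕ, ‖biTheta q a y k‖ ≤ C * R ^ k := by
  refine ⟨qBound q (‖a‖ * R) * qBound q R * qBound q R⁻¹, by
    have := @qBound_pos q; positivity [this (‖a‖ * R), this R, this R⁻¹], fun y hy k => ?_⟩
  rw [biTheta_natCast hq hq0, norm_mul, norm_mul, mul_assoc]
  have hk : ∀ k : ℕ, ‖q ^ k‖ ≤ 1 := fun k => by
    rw [norm_pow]; exact pow_le_one₀ (norm_nonneg _) hq.le
  have h1 : ‖qPochInf q (a * y * q ^ (k + 1))‖ ≤ qBound q (‖a‖ * R) := norm_qPochInf_le hq (by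
    rw [norm_mul, norm_mul]
    calc ‖a‖ * ‖y‖ * ‖q ^ (k + 1)‖ ≤ ‖a‖ * R * 1 := by gcongr; exact hk _
      _ = _ := mul_one _)
  have h2 : ‖qPochInf q (y * q)‖ ≤ qBound q R := norm_qPochInf_le hq (by
    rw [norm_mul]
    calc ‖y‖ * ‖q‖ ≤ R * 1 := by gcongr
      _ = _ := mul_one _)
  have h3 : ‖∏ i ∈ range k, (y - q ^ i)‖ ≤ qBound q R⁻¹ * R ^ k := by
    rw [norm_prod]
    calc ∏ i ∈ range k, ‖y - q ^ i‖ ≤ ∏ i ∈ range k, ((1 + R⁻¹ * ‖q‖ ^ i) * R) := by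
          refine prod_le_prod (fun i _ => norm_nonneg _) fun i _ => (norm_sub_le _ _).trans ?_
          rw [norm_pow, add_mul, mul_right_comm, inv_mul_cancel₀ hR.ne']
          linarith
      _ = (∏ i ∈ range k, (1 + R⁻¹ * ‖q‖ ^ i)) * R ^ k := by rw [prod_mul_distrib]; simp
      _ ≤ _ := by
          gcongr
          exact prod_one_add_le_qBound hq (by positivity) k
  calc _ ≤ qBound q (‖a‖ * R) * (qBound q R * (qBound q R⁻¹ * R ^ k)) := by
        gcongr
        · exact (qBound_pos _).le
        · exact (qBound_pos _).le
    _ = _ := by ring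

lemma continuous_biTheta (hq : ‖q‖ < 1) (a : ℂ) (k : ℤ) :
    Continuous fun y => biTheta q a y k := by
  have := continuous_qPochInf hq
  unfold biTheta
  fun_prop

end Pochhammer

/-! ### Bailey's ₆ψ₆ sum. -/

section BilateralSix

variable {q : ℂ}

lemma summable_pow_natAbs {ρ : ℝ} (h0 : 0 ≤ ρ) (h1 : ρ < 1) :
    Summable fun k : ℤ => ρ ^ k.natAbs := by
  refine Summable.of_nat_of_neg ?_ ?_ <;>
    simpa using summable_geometric_of_lt_one h0 h1

lemma norm_prod_biTheta_natCast_le (hq : ‖q‖ < 1) (hq0 : q ≠ 0) (a : ℂ) {r : ℕ} {R : Fin r → ℝ}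
    (hR : ∀ i, 0 < R i) :
    ∃ C > 0, ∀ y : Fin r → ℂ, (∀ i, ‖y i‖ ≤ R i) → ∀ k : ℕ,
      ‖∏ i, biTheta q a (y i) k‖ ≤ C * (∏ i, R i) ^ k := by
  choose C hC hy using fun i => norm_biTheta_natCast_le hq hq0 a (hR i)
  refine ⟨∏ i, C i, prod_pos fun i _ => hC i, fun y h k => ?_⟩
  rw [norm_prod, ← prod_pow, ← prod_mul_distrib]
  exact prod_le_prod (fun i _ => norm_nonneg _) fun i _ => hy i _ (h i) k

/-- The two hypotheses bound the geometric ratios of the majorant for k → ∞ and for k → -∞; the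
factor (‖q‖‖a‖)^r comes from the reflection `biTheta_neg`. -/
lemma norm_zpow_mul_prod_biTheta_le (hq : ‖q‖ < 1) (hq0 : q ≠ 0) {a w : ℂ} (ha : a ≠ 0)
    {r : ℕ} {R : Fin r → ℝ} (hR : ∀ i, 0 < R i) {ρ : ℝ}
    (h1 : ‖w‖ * ∏ i, R i ≤ ρ) (h2 : ‖w‖⁻¹ * (‖q‖ * ‖a‖) ^ r * ∏ i, R i ≤ ρ) :
    ∃ C > 0, ∀ y : Fin r → ℂ, (∀ i, ‖y i‖ ≤ R i) → ∀ k : ℤ,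
      ‖w ^ k * ∏ i, biTheta q a (y i) k‖ ≤ C * ρ ^ k.natAbs := by
  obtain ⟨C₁, hC₁, hy₁⟩ := norm_prod_biTheta_natCast_le hq hq0 a hR
  obtain ⟨C₂, hC₂, hy₂⟩ := norm_prod_biTheta_natCast_le hq hq0 a⁻¹ (R := fun i => ‖a‖ * R i)
    (fun i => mul_pos (norm_pos_iff.2 ha) (hR i))
  have hP : 0 < ∏ i, R i := prod_pos fun i _ => hR i
  refine ⟨C₁ + C₂, by positivity, fun y hy k => ?_⟩
  have hρ : 0 ≤ ρ := le_trans (by positivity) h1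
  obtain ⟨n, rfl | rfl⟩ := k.eq_nat_or_neg
  · rw [norm_mul, zpow_natCast, norm_pow, Int.natAbs_natCast]
    calc _ ≤ ‖w‖ ^ n * (C₁ * (∏ i, R i) ^ n) := by gcongr; exact hy₁ y hy n
      _ = C₁ * (‖w‖ * ∏ i, R i) ^ n := by rw [mul_pow]; ring
      _ ≤ (C₁ + C₂) * ρ ^ n := by gcongr; linarith
  · have h3 := hy₂ (fun i => a * y i) (fun i => by rw [norm_mul]; gcongr; exact hy i) n
    rw [norm_mul, Int.natAbs_neg, Int.natAbs_natCast]
    simp only [biTheta_neg hq0 ha, prod_mul_distrib, prod_const, card_univ, Fintype.card_fin,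
      norm_mul, norm_pow, zpow_neg, norm_inv, zpow_natCast] at h3 ⊢
    calc _ ≤ (‖w‖ ^ n)⁻¹ * ((‖q‖ ^ n) ^ r * (C₂ * (‖a‖ ^ r * ∏ i, R i) ^ n)) := by gcongr
      _ = C₂ * (‖w‖⁻¹ * (‖q‖ * ‖a‖) ^ r * ∏ i, R i) ^ n := by
        rw [mul_pow ‖q‖, mul_pow, mul_pow, mul_pow, mul_pow, inv_pow, ← pow_mul, ← pow_mul,
          mul_comm n r]
        ring
      _ ≤ (C₁ + C₂) * ρ ^ n := by gcongr; linarith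

/-- Enlarging all moduli slightly keeps the strict inequality and makes the radii positive even
where y vanishes, as the majorants require. -/
lemma exists_radii {r : ℕ} (y : Fin r → ℂ) {c : ℝ} (h : c * ∏ i, ‖y i‖ < 1) :
    ∃ R : Fin r → ℝ, (∀ i, 0 < R i) ∧ (∀ i, ‖y i‖ < R i) ∧ c * ∏ i, R i < 1 := by
  have hcont : Continuous fun ε : ℝ => c * ∏ i, (‖y i‖ + ε) := by fun_prop
  have h1 : ∀ᶠ ε in 𝓝[>] (0 : ℝ), c * ∏ i, (‖y i‖ + ε) < 1 :=
    ((hcont.tendsto 0).eventually_lt_const (by simpa using h)).filter_mono nhdsWithin_le_nhds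
  obtain ⟨ε, h1, h2⟩ := (h1.and self_mem_nhdsWithin).exists
  have h2 : 0 < ε := h2
  exact ⟨fun i => ‖y i‖ + ε, fun i => by positivity, fun i => by linarith, h1⟩

/-- The general term of the bilateral series `₆ψ₆`, normalised to be entire in the reciprocals
of the upper parameters. -/
noncomputable def wellPoisedSix (q a y₁ y₂ y₃ y₄ : ℂ) (k : ℤ) : ℂ :=
  (1 - a * q ^ (2 * k)) * (q * a ^ 2) ^ k *
    (biTheta q a y₁ k * biTheta q a y₂ k * biTheta q a y₃ k * biTheta q a y₄ k)

/-- Split 1 - a q^(2k) into its two terms. With w = q a² the ratio for k → ∞ is ρ, with w = q³ a²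
the ratio for k → -∞ is ρ, and the two remaining ratios are smaller by ‖q‖². The bound is uniform on
a polydisc, which permits the limit y₁ → 0. -/
lemma norm_wellPoisedSix_le (hq : ‖q‖ < 1) (hq0 : q ≠ 0) {a : ℂ} (ha : a ≠ 0)
    {R : Fin 4 → ℝ} (hR : ∀ i, 0 < R i) (h : ‖q * a ^ 2‖ * ∏ i, R i < 1) :
    ∃ bound : ℤ → ℝ, Summable bound ∧ ∀ y : Fin 4 → ℂ, (∀ i, ‖y i‖ ≤ R i) → ∀ k : ℤ,
      ‖wellPoisedSix q a (y 0) (y 1) (y 2) (y 3) k‖ ≤ bound k := by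
  set ρ := ‖q * a ^ 2‖ * ∏ i, R i with hρ
  have hP : 0 < ∏ i, R i := prod_pos fun i _ => hR i
  have hq' : 0 < ‖q‖ := norm_pos_iff.2 hq0
  have ha' : 0 < ‖a‖ := norm_pos_iff.2 ha
  have hsq : ‖q‖ ^ 2 ≤ 1 := pow_le_one₀ hq'.le hq.le
  obtain ⟨C₁, hC₁, H₁⟩ := norm_zpow_mul_prod_biTheta_le hq hq0 (w := q * a ^ 2) ha hR (ρ := ρ)
    le_rfl (by
      rw [hρ]; gcongr
      simp only [norm_mul, norm_pow]
      calc _ = ‖q‖ ^ 2 * (‖q‖ * ‖a‖ ^ 2) := by field_simp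
        _ ≤ 1 * (‖q‖ * ‖a‖ ^ 2) := by gcongr
        _ = _ := one_mul _)
  obtain ⟨C₂, hC₂, H₂⟩ := norm_zpow_mul_prod_biTheta_le hq hq0 (w := q * a ^ 2 * q ^ 2) ha hR
    (ρ := ρ) (by
      rw [hρ, norm_mul _ (q ^ 2), norm_pow]; gcongr
      calc _ ≤ ‖q * a ^ 2‖ * 1 := by gcongr
        _ = _ := mul_one _) (by
      rw [hρ]; gcongr
      simp only [norm_mul, norm_pow]
      exact le_of_eq (by field_simp))
  refine ⟨fun k => (C₁ + ‖a‖ * C₂) * ρ ^ k.natAbs,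
    (summable_pow_natAbs (by positivity) h).mul_left _, fun y hy k => ?_⟩
  have h1 := H₁ y hy k
  have h2 := H₂ y hy k
  have h3 : wellPoisedSix q a (y 0) (y 1) (y 2) (y 3) k =
      (q * a ^ 2) ^ k * ∏ i, biTheta q a (y i) k -
        a * ((q * a ^ 2 * q ^ 2) ^ k * ∏ i, biTheta q a (y i) k) := by
    rw [wellPoisedSix, Fin.prod_univ_four, mul_zpow (q * a ^ 2), zpow_mul, zpow_ofNat]
    ring
  rw [h3]
  refine (norm_sub_le _ _).trans ?_
  rw [norm_mul a]
  calc _ ≤ C₁ * ρ ^ k.natAbs + ‖a‖ * (C₂ * ρ ^ k.natAbs) := by gcongr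
    _ = _ := by ring

lemma summable_wellPoisedSix (hq : ‖q‖ < 1) (hq0 : q ≠ 0) {a y₁ y₂ y₃ y₄ : ℂ} (ha : a ≠ 0)
    (hz : ‖q * a ^ 2 * (y₁ * y₂ * y₃ * y₄)‖ < 1) :
    Summable (wellPoisedSix q a y₁ y₂ y₃ y₄) := by
  obtain ⟨R, hR, hy, hR1⟩ := exists_radii ![y₁, y₂, y₃, y₄] (c := ‖q * a ^ 2‖) (by
    simpa [Fin.prod_univ_four, mul_assoc] using hz)
  obtain ⟨bound, hb, H⟩ := norm_wellPoisedSix_le hq hq0 ha hR hR1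
  exact hb.of_norm_bounded fun k => H ![y₁, y₂, y₃, y₄] (fun i => (hy i).le) k

lemma biTheta_div_q (hq : ‖q‖ < 1) (hq0 : q ≠ 0) (a y : ℂ) (k : ℤ) :
    biTheta q (a / q) y k = (1 - a * y * q ^ k) * biTheta q a y k := by
  unfold biTheta
  rw [show a / q * y * q ^ (k + 1) = a * y * q ^ k by rw [zpow_add_one₀ hq0]; field_simp,
    qPochInf_eq hq (a * y * q ^ k), mul_assoc (a * y), ← zpow_add_one₀ hq0]
  ring

/-- With a/q in place of a, both H k and H (k + 1) are elementary multiples of one product of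
`biTheta q a` values at k, with y₁ q as first argument. Dividing by it leaves a polynomial identity
in q^k. -/
lemma wellPoisedSix_telescope (hq : ‖q‖ < 1) (hq0 : q ≠ 0) {a : ℂ} (ha : a ≠ 0)
    (y₁ y₂ y₃ y₄ : ℂ) (k : ℤ) (H : ℤ → ℂ)
    (hH : H = fun k => q * y₁ * ((a ^ 2) ^ k * (biTheta q (a / q) (y₁ * q) k *
      biTheta q (a / q) y₂ k * biTheta q (a / q) y₃ k * biTheta q (a / q) y₄ k))) :
    (1 - q * a ^ 2 * (y₁ * y₂ * y₃ * y₄)) * wellPoisedSix q a y₁ y₂ y₃ y₄ k -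
      (1 - q * a * y₁ * y₂) * (1 - q * a * y₁ * y₃) * (1 - q * a * y₁ * y₄) *
        wellPoisedSix q a (y₁ * q) y₂ y₃ y₄ k = H (k + 1) - H k := by
  have hs : ∀ y, biTheta q (a / q) y (k + 1) = (y - q ^ k) * biTheta q a y k := fun y => by
    rw [biTheta_div_q hq hq0, biTheta_succ hq hq0]
  simp only [hH, hs]
  simp only [wellPoisedSix, biTheta_div_q hq hq0, biTheta_q_mul hq a y₁]
  have ha2 : a ^ 2 ≠ 0 := pow_ne_zero 2 ha
  have hX := zpow_ne_zero k hq0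
  rw [zpow_add_one₀ hq0, zpow_sub₀ hq0, zpow_one, mul_comm 2 k, zpow_mul, zpow_ofNat, mul_zpow q,
    zpow_add_one₀ ha2]
  field_simp
  ring

lemma tsum_wellPoisedSix_succ (hq : ‖q‖ < 1) (hq0 : q ≠ 0) {a y₁ y₂ y₃ y₄ : ℂ} (ha : a ≠ 0)
    (hz : ‖q * a ^ 2 * (y₁ * y₂ * y₃ * y₄)‖ < 1) :
    (1 - q * a ^ 2 * (y₁ * y₂ * y₃ * y₄)) * ∑' k, wellPoisedSix q a y₁ y₂ y₃ y₄ k =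
      (1 - q * a * y₁ * y₂) * (1 - q * a * y₁ * y₃) * (1 - q * a * y₁ * y₄) *
        ∑' k, wellPoisedSix q a (y₁ * q) y₂ y₃ y₄ k := by
  have hz' : ‖q * a ^ 2 * (y₁ * q * y₂ * y₃ * y₄)‖ < 1 := by
    rw [show q * a ^ 2 * (y₁ * q * y₂ * y₃ * y₄) = q * a ^ 2 * (y₁ * y₂ * y₃ * y₄) * q by ring,
      norm_mul]
    calc _ ≤ ‖q * a ^ 2 * (y₁ * y₂ * y₃ * y₄)‖ * 1 := by gcongr
      _ < 1 := by rwa [mul_one]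
  obtain ⟨H, hH⟩ : ∃ H : ℤ → ℂ, H = fun k => q * y₁ * ((a ^ 2) ^ k * (biTheta q (a / q) (y₁ * q) k *
      biTheta q (a / q) y₂ k * biTheta q (a / q) y₃ k * biTheta q (a / q) y₄ k)) := ⟨_, rfl⟩
  have hq' : 0 < ‖q‖ := norm_pos_iff.2 hq0
  have ha' : 0 < ‖a‖ := norm_pos_iff.2 ha
  have hHs : Summable H := by
    obtain ⟨R, hR, hy, hR1⟩ := exists_radii ![y₁ * q, y₂, y₃, y₄] (c := ‖a ^ 2‖) (by
      refine lt_of_eq_of_lt ?_ hz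
      simp [Fin.prod_univ_four]; ring)
    -- For a/q and w = a² the ratios in the two directions coincide.
    obtain ⟨C, hC, hb⟩ := norm_zpow_mul_prod_biTheta_le hq hq0 (a := a / q) (w := a ^ 2)
      (div_ne_zero ha hq0) hR (ρ := ‖a ^ 2‖ * ∏ i, R i) le_rfl (by
        refine le_of_eq ?_
        simp only [norm_pow, norm_div]
        field_simp)
    have hP : 0 < ∏ i, R i := prod_pos fun i _ => hR i
    have := ((summable_pow_natAbs (by positivity) hR1).mul_left C).of_norm_bounded
      (hb ![y₁ * q, y₂, y₃, y₄] (fun i => (hy i).le))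
    rw [hH]
    simpa [Fin.prod_univ_four] using this.mul_left (q * y₁)
  have hHs' : Summable fun k => H (k + 1) := (Equiv.addRight (1 : ℤ)).summable_iff.2 hHs
  have hH0 : ∑' k, (H (k + 1) - H k) = 0 := by
    rw [hHs'.tsum_sub hHs, sub_eq_zero]
    exact (Equiv.addRight (1 : ℤ)).tsum_eq H
  rw [← sub_eq_zero, ← hH0, ← tsum_mul_left, ← tsum_mul_left,
    ← ((summable_wellPoisedSix hq hq0 ha hz).mul_left _).tsum_sub
      ((summable_wellPoisedSix hq hq0 ha hz').mul_left _)]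
  exact tsum_congr fun k => wellPoisedSix_telescope hq hq0 ha y₁ y₂ y₃ y₄ k H hH

lemma norm_mul_pow_le (hq : ‖q‖ < 1) (x : ℂ) (n : ℕ) : ‖x * q ^ n‖ ≤ ‖x‖ := by
  rw [norm_mul, norm_pow]
  exact mul_le_of_le_one_right (norm_nonneg _) (pow_le_one₀ (norm_nonneg _) hq.le)

lemma tsum_wellPoisedSix_iterate (hq : ‖q‖ < 1) (hq0 : q ≠ 0) {a y₁ y₂ y₃ y₄ : ℂ} (ha : a ≠ 0)
    (hz : ‖q * a ^ 2 * (y₁ * y₂ * y₃ * y₄)‖ < 1) (n : ℕ) :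
    qPochNat q (q * a ^ 2 * (y₁ * y₂ * y₃ * y₄)) n * ∑' k, wellPoisedSix q a y₁ y₂ y₃ y₄ k =
      qPochNat q (q * a * y₁ * y₂) n * qPochNat q (q * a * y₁ * y₃) n *
        qPochNat q (q * a * y₁ * y₄) n * ∑' k, wellPoisedSix q a (y₁ * q ^ n) y₂ y₃ y₄ k := by
  induction n with
  | zero => simp
  | succ n ih =>
    have h := tsum_wellPoisedSix_succ hq hq0 (y₁ := y₁ * q ^ n) (y₂ := y₂) (y₃ := y₃) (y₄ := y₄) ha
      (by
        rw [show q * a ^ 2 * (y₁ * q ^ n * y₂ * y₃ * y₄) =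
          q * a ^ 2 * (y₁ * y₂ * y₃ * y₄) * q ^ n by ring]
        exact (norm_mul_pow_le hq _ n).trans_lt hz)
    rw [mul_assoc y₁ (q ^ n) q, ← pow_succ] at h
    simp only [qPochNat_succ]
    linear_combination (1 - q * a ^ 2 * (y₁ * y₂ * y₃ * y₄) * q ^ n) * ih +
      qPochNat q (q * a * y₁ * y₂) n * qPochNat q (q * a * y₁ * y₃) n *
        qPochNat q (q * a * y₁ * y₄) n * h

lemma tsum_wellPoisedSix_eq_zero_left (hq : ‖q‖ < 1) (hq0 : q ≠ 0) {a y₁ y₂ y₃ y₄ : ℂ} (ha : a ≠ 0)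
    (hz : ‖q * a ^ 2 * (y₁ * y₂ * y₃ * y₄)‖ < 1) :
    qPochInf q (q * a ^ 2 * (y₁ * y₂ * y₃ * y₄)) * ∑' k, wellPoisedSix q a y₁ y₂ y₃ y₄ k =
      qPochInf q (q * a * y₁ * y₂) * qPochInf q (q * a * y₁ * y₃) *
        qPochInf q (q * a * y₁ * y₄) * ∑' k, wellPoisedSix q a 0 y₂ y₃ y₄ k := by
  have hlim : Tendsto (fun n : ℕ => ∑' k, wellPoisedSix q a (y₁ * q ^ n) y₂ y₃ y₄ k) atTop
      (𝓝 (∑' k, wellPoisedSix q a 0 y₂ y₃ y₄ k)) := by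
    obtain ⟨R, hR, hy, hR1⟩ := exists_radii ![y₁, y₂, y₃, y₄] (c := ‖q * a ^ 2‖) (by
      simpa [Fin.prod_univ_four, mul_assoc] using hz)
    obtain ⟨bound, hb, H⟩ := norm_wellPoisedSix_le hq hq0 ha hR hR1
    refine tendsto_tsum_of_dominated_convergence hb (fun k => ?_) (Eventually.of_forall fun n k =>
      H ![y₁ * q ^ n, y₂, y₃, y₄] (fun i => ?_) k)
    · have : Continuous fun y => wellPoisedSix q a y y₂ y₃ y₄ k := by
        have := continuous_biTheta hq a k
        unfold wellPoisedSix
        fun_prop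
      exact (this.tendsto 0).comp (tendsto_mul_pow_zero hq y₁)
    · have := hy i
      fin_cases i
      · exact (norm_mul_pow_le hq _ _).trans this.le
      all_goals exact this.le
  have h1 := (tendsto_qPochNat hq (q * a ^ 2 * (y₁ * y₂ * y₃ * y₄))).mul_const
    (∑' k, wellPoisedSix q a y₁ y₂ y₃ y₄ k)
  have h2 := (((tendsto_qPochNat hq (q * a * y₁ * y₂)).mul
    (tendsto_qPochNat hq (q * a * y₁ * y₃))).mul (tendsto_qPochNat hq (q * a * y₁ * y₄))).mul hlim
  refine tendsto_nhds_unique h1 (h2.congr fun n => ?_)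
  rw [tsum_wellPoisedSix_iterate hq hq0 ha hz]

/-- By cyclic symmetry each parameter in turn can be sent to 0; it contributes its products with the
parameters still present, so each pair occurs once. -/
lemma tsum_wellPoisedSix_zero (hq : ‖q‖ < 1) (hq0 : q ≠ 0) {a y₁ y₂ y₃ y₄ : ℂ} (ha : a ≠ 0)
    (hz : ‖q * a ^ 2 * (y₁ * y₂ * y₃ * y₄)‖ < 1) :
    qPochInf q (q * a ^ 2 * (y₁ * y₂ * y₃ * y₄)) * ∑' k, wellPoisedSix q a y₁ y₂ y₃ y₄ k =
      qPochInf q (q * a * y₁ * y₂) * qPochInf q (q * a * y₁ * y₃) *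
        qPochInf q (q * a * y₁ * y₄) * (qPochInf q (q * a * y₂ * y₃) *
        qPochInf q (q * a * y₂ * y₄) * qPochInf q (q * a * y₃ * y₄)) *
        ∑' k, wellPoisedSix q a 0 0 0 0 k := by
  have hrot : ∀ x₁ x₂ x₃ x₄ k, wellPoisedSix q a x₁ x₂ x₃ x₄ k = wellPoisedSix q a x₂ x₃ x₄ x₁ k :=
    fun x₁ x₂ x₃ x₄ k => by unfold wellPoisedSix; ring
  have h1 := tsum_wellPoisedSix_eq_zero_left hq hq0 ha hz
  have h2 := tsum_wellPoisedSix_eq_zero_left hq hq0 ha (y₁ := y₂) (y₂ := y₃) (y₃ := y₄) (y₄ := 0)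
    (by simp)
  have h3 := tsum_wellPoisedSix_eq_zero_left hq hq0 ha (y₁ := y₃) (y₂ := y₄) (y₃ := 0) (y₄ := 0)
    (by simp)
  have h4 := tsum_wellPoisedSix_eq_zero_left hq hq0 ha (y₁ := y₄) (y₂ := 0) (y₃ := 0) (y₄ := 0)
    (by simp)
  simp only [mul_zero, qPochInf_zero, one_mul, mul_one] at h2 h3 h4
  simp only [← hrot 0] at h2 h3 h4
  rw [h1, h2, h3, h4]
  ring

/-- **Bailey's `₆ψ₆` sum**, in a form free of denominators. -/
theorem tsum_wellPoisedSix (hq : ‖q‖ < 1) (hq0 : q ≠ 0) {a y₁ y₂ y₃ y₄ : ℂ} (ha : a ≠ 0)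
    (hz : ‖q * a ^ 2 * (y₁ * y₂ * y₃ * y₄)‖ < 1) :
    qPochInf q (q * a ^ 2 * (y₁ * y₂ * y₃ * y₄)) * ∑' k, wellPoisedSix q a y₁ y₂ y₃ y₄ k =
      qPochInf q (q * a * y₁ * y₂) * qPochInf q (q * a * y₁ * y₃) *
        qPochInf q (q * a * y₁ * y₄) * (qPochInf q (q * a * y₂ * y₃) *
        qPochInf q (q * a * y₂ * y₄) * qPochInf q (q * a * y₃ * y₄)) *
        (qPochInf q q * qPochInf q a * qPochInf q (q / a)) := by
  rw [tsum_wellPoisedSix_zero hq hq0 ha hz]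
  congr 1
  -- For these parameters only k = 0 survives: the factor at 1/a vanishes for k < 0 and the factor
  -- at 1 for k > 0.
  have h := tsum_wellPoisedSix_zero hq hq0 ha (y₁ := 1) (y₂ := a⁻¹) (y₃ := 0) (y₄ := 0) (by simp)
  simp only [mul_zero, qPochInf_zero, one_mul, mul_one, mul_inv_cancel_right₀ ha] at h
  refine mul_left_cancel₀ (qPochInf_ne_zero hq (qNonzero_q hq)) (h.symm.trans ?_)
  have hP : ∀ n : ℤ, n ≤ 0 → qPochInf q (q ^ n) = 0 := fun n hn => by
    obtain ⟨m, rfl⟩ := Int.exists_eq_neg_ofNat hn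
    rw [qPochInf_eq_nat hq _ (m + 1), qPochNat_succ]
    have : q ^ (-(m : ℤ)) * q ^ m = 1 := by
      rw [zpow_neg, zpow_natCast, inv_mul_cancel₀ (pow_ne_zero _ hq0)]
    rw [this]; simp
  rw [tsum_eq_single 0]
  · simp only [wellPoisedSix, biTheta, mul_inv_cancel₀ ha]
    rw [qPochInf_eq hq a]
    simp
    rw [div_eq_inv_mul]
    ring
  · intro k hk
    rcases lt_or_gt_of_ne hk with h | h
    · have : biTheta q a a⁻¹ k = 0 := by
        simp [biTheta, mul_inv_cancel₀ ha, hP (k + 1) (by omega)]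
      simp [wellPoisedSix, this]
    · have : biTheta q a 1 k = 0 := by
        simp [biTheta, hP (1 - k) (by omega)]
      simp [wellPoisedSix, this]

end BilateralSix

/-! ### The nonterminating Jackson ₈φ₇ sum. -/

section Jackson

variable {q : ℂ}

/-- The identity needed is symmetric in B₂, B₃, B₄. In terms of their elementary symmetric
functions, the constraint only says that e₃ r = q v, so e₃ drops out and the identity holds
unconditionally. -/
lemma jackson_poly_symm (q v r B Y e₁ e₂ : ℂ) :
    Y * (1 - B * v * Y ^ 2) * (1 - B * v * r) * (1 - B) * (1 - B * r) *
        (1 - B * r * Y * e₂ + B ^ 2 * r * Y ^ 2 * e₁ * (q * v) - B ^ 3 * r * Y ^ 3 * (q * v) ^ 2) -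
      (1 - B * r * e₁ + B ^ 2 * r ^ 2 * e₂ - B ^ 3 * r ^ 2 * (q * v)) *
        (Y * (1 - B * v * q * Y ^ 2) * (1 - B * v * r * Y) * (1 - B * Y) * (1 - B * v * Y)) =
    (1 - B * v * Y) * (-B * (1 - B ^ 2 * v * r * Y * q) * (1 - B * v * r * Y) * (1 - B * Y) *
        (r - e₁ * r * Y + e₂ * r * Y ^ 2 - q * v * Y ^ 3)) -
      -B * (1 - B ^ 2 * v * r * Y) * (1 - Y) * (r - Y) * (1 - v * Y) *
        (1 - B * r * Y * e₂ + B ^ 2 * r * Y ^ 2 * e₁ * (q * v) - B ^ 3 * r * Y ^ 3 * (q * v) ^ 2) := by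
  ring

/-- This is what remains of the telescoping step when the common products are removed: Y stands for
q^(j+1) and B v for the leading parameter of the series. -/
lemma jackson_poly {q v r B B₂ B₃ B₄ : ℂ} (hv : q * v = B₂ * B₃ * B₄ * r) (Y : ℂ) :
    Y * (1 - B * v * Y ^ 2) * (1 - B * v * r) * (1 - B) * (1 - B * r) *
        ((1 - B * B₃ * B₄ * r * Y) * (1 - B * B₂ * B₄ * r * Y) * (1 - B * B₂ * B₃ * r * Y)) -
      (1 - B * B₂ * r) * (1 - B * B₃ * r) * (1 - B * B₄ * r) *
        (Y * (1 - B * v * q * Y ^ 2) * (1 - B * v * r * Y) * (1 - B * Y) * (1 - B * v * Y)) =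
    (1 - B * v * Y) * (-(B * r) * (1 - B ^ 2 * v * r * Y * q) * (1 - B * v * r * Y) * (1 - B * Y) *
        ((1 - B₂ * Y) * (1 - B₃ * Y) * (1 - B₄ * Y))) -
      -B * (1 - B ^ 2 * v * r * Y) * (1 - Y) * (r - Y) * (1 - v * Y) *
        ((1 - B * B₃ * B₄ * r * Y) * (1 - B * B₂ * B₄ * r * Y) * (1 - B * B₂ * B₃ * r * Y)) := by
  have h := jackson_poly_symm q v r B Y (B₂ + B₃ + B₄) (B₂ * B₃ + B₂ * B₄ + B₃ * B₄)
  have h1 : (1 - B * B₃ * B₄ * r * Y) * (1 - B * B₂ * B₄ * r * Y) * (1 - B * B₂ * B₃ * r * Y) =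
      1 - B * r * Y * (B₂ * B₃ + B₂ * B₄ + B₃ * B₄) +
        B ^ 2 * r * Y ^ 2 * (B₂ + B₃ + B₄) * (q * v) - B ^ 3 * r * Y ^ 3 * (q * v) ^ 2 := by
    rw [hv]; ring
  have h2 : (1 - B * B₂ * r) * (1 - B * B₃ * r) * (1 - B * B₄ * r) =
      1 - B * r * (B₂ + B₃ + B₄) + B ^ 2 * r ^ 2 * (B₂ * B₃ + B₂ * B₄ + B₃ * B₄) -
        B ^ 3 * r ^ 2 * (q * v) := by
    rw [hv]; ring
  have h3 : r * ((1 - B₂ * Y) * (1 - B₃ * Y) * (1 - B₄ * Y)) = r - (B₂ + B₃ + B₄) * r * Y +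
      (B₂ * B₃ + B₂ * B₄ + B₃ * B₄) * r * Y ^ 2 - q * v * Y ^ 3 := by
    rw [hv]; ring
  rw [← h1, ← h2, ← h3] at h
  linear_combination h

/-- The general term of a very-well-poised `₈φ₇` with argument `q` and upper parameters
`l = B₁ B₂ B₃ B₄ r / q`, `l r`, `B₁, …, B₄`, normalised by infinite products. -/
noncomputable def jacksonTerm (q r B₁ B₂ B₃ B₄ : ℂ) (n : ℕ) : ℂ :=
  q ^ n * (1 - B₁ * B₂ * B₃ * B₄ * r / q * q ^ (2 * n)) *
    qPochNat q (B₁ * B₂ * B₃ * B₄ * r ^ 2 / q) n *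
    (qPochNat q B₁ n * qPochNat q B₂ n * qPochNat q B₃ n * qPochNat q B₄ n) *
    (qPochInf q (B₁ * r) * qPochInf q (B₂ * r) * qPochInf q (B₃ * r) * qPochInf q (B₄ * r)) *
    (qPochInf q (q ^ (n + 1)) * qPochInf q (q ^ (n + 1) / r)) *
    (qPochInf q (B₂ * B₃ * B₄ * r * q ^ n) * qPochInf q (B₁ * B₃ * B₄ * r * q ^ n) *
      qPochInf q (B₁ * B₂ * B₄ * r * q ^ n) * qPochInf q (B₁ * B₂ * B₃ * r * q ^ n)) *
    (qPochInf q (B₁ * B₂ * B₃ * B₄ * r / q * q ^ n))⁻¹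

/-- The partial sums of the difference of two contiguous `jacksonTerm` series. -/
noncomputable def jacksonPartial (q r B₁ B₂ B₃ B₄ : ℂ) (n : ℕ) : ℂ :=
  -(B₁ * r) * (1 - B₁ ^ 2 * B₂ * B₃ * B₄ * r ^ 2 * q ^ n) *
    qPochNat q (B₁ * B₂ * B₃ * B₄ * r ^ 2) n * qPochNat q (B₁ * q) n *
    (qPochNat q B₂ (n + 1) * qPochNat q B₃ (n + 1) * qPochNat q B₄ (n + 1)) *
    (qPochInf q (B₁ * q * r) * qPochInf q (B₂ * r) * qPochInf q (B₃ * r) * qPochInf q (B₄ * r)) *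
    (qPochInf q (q ^ (n + 1)) * qPochInf q (q ^ (n + 1) / r)) *
    (qPochInf q (B₂ * B₃ * B₄ * r * q ^ n) * qPochInf q (B₁ * B₃ * B₄ * r * q ^ (n + 1)) *
      qPochInf q (B₁ * B₂ * B₄ * r * q ^ (n + 1)) * qPochInf q (B₁ * B₂ * B₃ * r * q ^ (n + 1))) *
    (qPochInf q (B₁ * B₂ * B₃ * B₄ * r / q * q ^ (n + 1)))⁻¹

lemma jacksonTerm_sub_succ (hq : ‖q‖ < 1) (hq0 : q ≠ 0) {r B₁ B₂ B₃ B₄ : ℂ} (hr : r ≠ 0)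
    (hl : QNonzero q (B₁ * B₂ * B₃ * B₄ * r / q)) (j : ℕ) :
    jacksonTerm q r B₁ B₂ B₃ B₄ (j + 1) -
      (1 - B₁ * B₂ * r) * (1 - B₁ * B₃ * r) * (1 - B₁ * B₄ * r) *
        jacksonTerm q r (B₁ * q) B₂ B₃ B₄ (j + 1) =
      jacksonPartial q r B₁ B₂ B₃ B₄ (j + 1) - jacksonPartial q r B₁ B₂ B₃ B₄ j := by
  obtain ⟨v, hv⟩ : ∃ v, v = B₂ * B₃ * B₄ * r / q := ⟨_, rfl⟩
  have hv' : q * v = B₂ * B₃ * B₄ * r := by rw [hv]; field_simp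
  have hl' : B₁ * B₂ * B₃ * B₄ * r / q = B₁ * v := by rw [hv]; field_simp
  rw [hl'] at hl
  have hlY := hl (j + 1)
  have hP := qPochInf_ne_zero hq ((hl.mul_pow (j + 1)).mul_q)
  have poly := jackson_poly (B := B₁) hv' (q ^ (j + 1))
  simp only [jacksonTerm, jacksonPartial, hl']
  rw [show B₁ * B₂ * B₃ * B₄ * r ^ 2 / q = B₁ * v * r by rw [hv]; field_simp,
    show B₁ * q * B₂ * B₃ * B₄ * r ^ 2 / q = B₁ * v * r * q by rw [hv]; field_simp,
    show B₁ * q * B₂ * B₃ * B₄ * r / q * q ^ (j + 1) = B₁ * v * q ^ (j + 1) * q by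
      rw [hv]; field_simp,
    show B₁ * v * q ^ (j + 1 + 1) = B₁ * v * q ^ (j + 1) * q by ring,
    show B₁ * q * B₂ * B₃ * B₄ * r / q * q ^ (2 * (j + 1)) = B₁ * v * q * (q ^ (j + 1)) ^ 2 by
      rw [hv, ← pow_mul, mul_comm (j + 1)]; field_simp,
    show B₁ * v * q ^ (2 * (j + 1)) = B₁ * v * (q ^ (j + 1)) ^ 2 by ring,
    show B₁ * B₂ * B₃ * B₄ * r ^ 2 = B₁ * v * r * q by rw [hv]; field_simp,
    qPochNat_succ' (B₁ * v * r), qPochNat_succ' B₁, qPochNat_succ (B₁ * v * r * q),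
    qPochNat_succ (B₁ * q), qPochNat_succ B₂ (j + 1), qPochNat_succ B₃ (j + 1),
    qPochNat_succ B₄ (j + 1), qPochInf_eq hq (B₁ * r), qPochInf_eq hq (q ^ (j + 1)),
    qPochInf_eq hq (q ^ (j + 1) / r), qPochInf_eq hq (B₂ * B₃ * B₄ * r * q ^ j),
    qPochInf_eq hq (B₁ * B₃ * B₄ * r * q ^ (j + 1)),
    qPochInf_eq hq (B₁ * B₂ * B₄ * r * q ^ (j + 1)),
    qPochInf_eq hq (B₁ * B₂ * B₃ * r * q ^ (j + 1)),
    qPochInf_eq hq (B₁ * v * q ^ (j + 1)),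
    show B₁ * q * B₃ * B₄ * r * q ^ (j + 1) = B₁ * B₃ * B₄ * r * q ^ (j + 1) * q by ring,
    show B₁ * q * B₂ * B₄ * r * q ^ (j + 1) = B₁ * B₂ * B₄ * r * q ^ (j + 1) * q by ring,
    show B₁ * q * B₂ * B₃ * r * q ^ (j + 1) = B₁ * B₂ * B₃ * r * q ^ (j + 1) * q by ring,
    show B₁ * B₃ * B₄ * r * q ^ (j + 1 + 1) = B₁ * B₃ * B₄ * r * q ^ (j + 1) * q by ring,
    show B₁ * B₂ * B₄ * r * q ^ (j + 1 + 1) = B₁ * B₂ * B₄ * r * q ^ (j + 1) * q by ring,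
    show B₁ * B₂ * B₃ * r * q ^ (j + 1 + 1) = B₁ * B₂ * B₃ * r * q ^ (j + 1) * q by ring,
    show B₁ * r * q = B₁ * q * r by ring,
    show B₂ * B₃ * B₄ * r * q ^ j * q = B₂ * B₃ * B₄ * r * q ^ (j + 1) by ring,
    show B₂ * B₃ * B₄ * r * q ^ j = v * q ^ (j + 1) by rw [← hv']; ring,
    show q ^ (j + 1) * q = q ^ (j + 1 + 1) by ring,
    show q ^ (j + 1) / r * q = q ^ (j + 1 + 1) / r by ring,
    show B₁ * v * r * q * q ^ j = B₁ * v * r * q ^ (j + 1) by ring,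
    show B₁ * q * q ^ j = B₁ * q ^ (j + 1) by ring,
    show B₁ ^ 2 * B₂ * B₃ * B₄ * r ^ 2 * q ^ (j + 1) = B₁ ^ 2 * v * r * q ^ (j + 1) * q by
      linear_combination (-B₁ ^ 2 * r * q ^ (j + 1)) * hv',
    show B₁ ^ 2 * B₂ * B₃ * B₄ * r ^ 2 * q ^ j = B₁ ^ 2 * v * r * q ^ (j + 1) by
      linear_combination (-B₁ ^ 2 * r * q ^ j) * hv',
    mul_inv]
  generalize q ^ (j + 1) = Y at *
  generalize qPochInf q (B₁ * v * Y * q) = p₀ at *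
  generalize qPochInf q (q ^ (j + 1 + 1)) = p₁ at *
  generalize qPochInf q (q ^ (j + 1 + 1) / r) = p₂ at *
  generalize qPochInf q (B₂ * B₃ * B₄ * r * Y) = p₃ at *
  generalize qPochInf q (B₁ * B₃ * B₄ * r * Y * q) = p₄ at *
  generalize qPochInf q (B₁ * B₂ * B₄ * r * Y * q) = p₅ at *
  generalize qPochInf q (B₁ * B₂ * B₃ * r * Y * q) = p₆ at *
  generalize qPochInf q (B₁ * q * r) = p₇ at *
  generalize qPochInf q (B₂ * r) = p₈ at *
  generalize qPochInf q (B₃ * r) = p₉ at *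
  generalize qPochInf q (B₄ * r) = p₁₀ at *
  generalize qPochNat q (B₁ * v * r * q) j = n₁ at *
  generalize qPochNat q (B₁ * q) j = n₂ at *
  generalize qPochNat q B₂ (j + 1) = n₃ at *
  generalize qPochNat q B₃ (j + 1) = n₄ at *
  generalize qPochNat q B₄ (j + 1) = n₅ at *
  rw [show (1 - Y / r) = (r - Y) * r⁻¹ by field_simp]
  have hk : (1 - B₁ * v * Y) * (1 - B₁ * v * Y)⁻¹ = 1 := mul_inv_cancel₀ hlY
  have hrr : r * r⁻¹ = 1 := mul_inv_cancel₀ hr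
  generalize (1 - B₁ * v * Y)⁻¹ = w at *
  generalize r⁻¹ = ri at *
  generalize 1 - B₁ * v * Y ^ 2 = c0 at *
  generalize 1 - B₁ * v * q * Y ^ 2 = c1 at *
  generalize 1 - B₁ * v * r * Y = c2 at *
  generalize 1 - B₁ * v * r = c3 at *
  generalize 1 - B₁ * r = c4 at *
  generalize 1 - B₁ * B₃ * B₄ * r * Y = c5 at *
  generalize 1 - B₁ * B₂ * B₄ * r * Y = c6 at *
  generalize 1 - B₁ * B₂ * B₃ * r * Y = c7 at *
  generalize 1 - B₁ * B₂ * r = c8 at *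
  generalize 1 - B₁ * B₃ * r = c9 at *
  generalize 1 - B₁ * B₄ * r = c10 at *
  generalize 1 - B₁ * Y = c11 at *
  generalize 1 - B₁ * v * Y = c12 at *
  generalize 1 - B₁ ^ 2 * v * r * Y * q = c13 at *
  generalize 1 - B₁ ^ 2 * v * r * Y = c14 at *
  generalize 1 - B₂ * Y = c15 at *
  generalize 1 - B₃ * Y = c16 at *
  generalize 1 - B₄ * Y = c17 at *
  generalize 1 - Y = c18 at *
  generalize r - Y = c19 at *
  generalize 1 - v * Y = c20 at *
  generalize 1 - B₁ = c21 at *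
  -- The coefficient is the factor common to all four terms. The polynomial identity is multiplied
  -- by w, the inverse of the leading factor; `hk` and `hrr` cancel w and r⁻¹ where they meet their
  -- inverses.
  linear_combination (n₁ * n₂ * n₃ * n₄ * n₅ * p₇ * p₈ * p₉ * p₁₀ * p₁ * p₂ * p₃ * p₄ * p₅ * p₆ * p₀⁻¹) *
    (w * poly + (c8 * c9 * c10 * (Y * c1 * c2 * c11) +
      -(B₁ * r) * c13 * c2 * c11 * (c15 * c16 * c17)) * hk +
      (-B₁ * c14 * c18 * c19 * c20 * (c5 * c6 * c7)) * w * hrr)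

lemma jacksonTerm_sub_zero (hq : ‖q‖ < 1) (hq0 : q ≠ 0) {r B₁ B₂ B₃ B₄ : ℂ}
    (hl : QNonzero q (B₁ * B₂ * B₃ * B₄ * r / q)) :
    jacksonTerm q r B₁ B₂ B₃ B₄ 0 -
      (1 - B₁ * B₂ * r) * (1 - B₁ * B₃ * r) * (1 - B₁ * B₄ * r) *
        jacksonTerm q r (B₁ * q) B₂ B₃ B₄ 0 = jacksonPartial q r B₁ B₂ B₃ B₄ 0 := by
  have hl0 := hl 0
  have hP := qPochInf_ne_zero hq hl.mul_q
  simp only [jacksonTerm, jacksonPartial, mul_zero, zero_add, pow_one, pow_zero, mul_one,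
    qPochNat_zero, qPochNat_succ, one_mul] at hl0 ⊢
  rw [qPochInf_eq hq (B₁ * r), qPochInf_eq hq (B₁ * B₃ * B₄ * r),
    qPochInf_eq hq (B₁ * B₂ * B₄ * r), qPochInf_eq hq (B₁ * B₂ * B₃ * r),
    qPochInf_eq hq (B₁ * B₂ * B₃ * B₄ * r / q),
    show B₁ * q * B₂ * B₃ * B₄ * r / q = B₁ * B₂ * B₃ * B₄ * r / q * q by ring,
    show B₁ * q * B₃ * B₄ * r = B₁ * B₃ * B₄ * r * q by ring,
    show B₁ * q * B₂ * B₄ * r = B₁ * B₂ * B₄ * r * q by ring,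
    show B₁ * q * B₂ * B₃ * r = B₁ * B₂ * B₃ * r * q by ring,
    show B₁ * r * q = B₁ * q * r by ring, mul_inv]
  have hk : (1 - B₁ * B₂ * B₃ * B₄ * r / q) * (1 - B₁ * B₂ * B₃ * B₄ * r / q)⁻¹ = 1 :=
    mul_inv_cancel₀ hl0
  rw [div_mul_cancel₀ _ hq0]
  have poly : (1 - B₁ * r) *
      ((1 - B₁ * B₃ * B₄ * r) * (1 - B₁ * B₂ * B₄ * r) * (1 - B₁ * B₂ * B₃ * r)) -
      (1 - B₁ * B₂ * r) * (1 - B₁ * B₃ * r) * (1 - B₁ * B₄ * r) *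
        (1 - B₁ * B₂ * B₃ * B₄ * r) =
      -(B₁ * r) * (1 - B₁ ^ 2 * B₂ * B₃ * B₄ * r ^ 2) *
        ((1 - B₂) * (1 - B₃) * (1 - B₄)) := by ring
  generalize 1 - B₁ * B₂ * B₃ * B₄ * r / q = k at *
  generalize qPochInf q (B₁ * B₂ * B₃ * B₄ * r) = p₀ at *
  generalize qPochInf q q = p₁ at *
  generalize qPochInf q (q / r) = p₂ at *
  generalize qPochInf q (B₂ * B₃ * B₄ * r) = p₃ at *
  generalize qPochInf q (B₁ * B₃ * B₄ * r * q) = p₄ at *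
  generalize qPochInf q (B₁ * B₂ * B₄ * r * q) = p₅ at *
  generalize qPochInf q (B₁ * B₂ * B₃ * r * q) = p₆ at *
  generalize qPochInf q (B₁ * q * r) = p₇ at *
  generalize qPochInf q (B₂ * r) = p₈ at *
  generalize qPochInf q (B₃ * r) = p₉ at *
  generalize qPochInf q (B₄ * r) = p₁₀ at *
  generalize 1 - B₁ * r = c0 at *
  generalize 1 - B₁ * B₃ * B₄ * r = c1 at *
  generalize 1 - B₁ * B₂ * B₄ * r = c2 at *
  generalize 1 - B₁ * B₂ * B₃ * r = c3 at *
  generalize 1 - B₁ * B₂ * r = c4 at *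
  generalize 1 - B₁ * B₃ * r = c5 at *
  generalize 1 - B₁ * B₄ * r = c6 at *
  generalize 1 - B₁ * B₂ * B₃ * B₄ * r = c7 at *
  generalize 1 - B₁ ^ 2 * B₂ * B₃ * B₄ * r ^ 2 = c8 at *
  generalize 1 - B₂ = c9 at *
  generalize 1 - B₃ = c10 at *
  generalize 1 - B₄ = c11 at *
  linear_combination (p₁ * p₂ * p₃ * p₄ * p₅ * p₆ * p₇ * p₈ * p₉ * p₁₀ * p₀⁻¹) *
    (poly + c0 * (c1 * c2 * c3) * hk)

lemma sum_jacksonTerm_sub (hq : ‖q‖ < 1) (hq0 : q ≠ 0) {r B₁ B₂ B₃ B₄ : ℂ} (hr : r ≠ 0)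
    (hl : QNonzero q (B₁ * B₂ * B₃ * B₄ * r / q)) (n : ℕ) :
    ∑ i ∈ range (n + 1), (jacksonTerm q r B₁ B₂ B₃ B₄ i -
      (1 - B₁ * B₂ * r) * (1 - B₁ * B₃ * r) * (1 - B₁ * B₄ * r) *
        jacksonTerm q r (B₁ * q) B₂ B₃ B₄ i) = jacksonPartial q r B₁ B₂ B₃ B₄ n := by
  induction n with
  | zero => rw [zero_add, sum_range_one, jacksonTerm_sub_zero hq hq0 hl]
  | succ n ih => rw [sum_range_succ, ih, jacksonTerm_sub_succ hq hq0 hr hl]; ring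

lemma norm_qPochInf_mul_pow_le (hq : ‖q‖ < 1) (x : ℂ) (n : ℕ) :
    ‖qPochInf q (x * q ^ n)‖ ≤ qBound q ‖x‖ :=
  norm_qPochInf_le hq (norm_mul_pow_le hq x n)

lemma norm_qPochNat_mul_pow_le (hq : ‖q‖ < 1) (x : ℂ) (n m : ℕ) :
    ‖qPochNat q (x * q ^ n) m‖ ≤ qBound q ‖x‖ :=
  norm_qPochNat_le hq (norm_mul_pow_le hq x n) m

lemma norm_one_sub_mul_pow_le (hq : ‖q‖ < 1) (x : ℂ) (n : ℕ) : ‖1 - x * q ^ n‖ ≤ 1 + ‖x‖ := by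
  refine (norm_sub_le _ _).trans ?_
  rw [norm_one]
  gcongr
  exact norm_mul_pow_le hq x n

/-- All decay comes from the explicit q^n; every other factor is bounded uniformly in n and in the
shift N, as needed for letting B₁ q^N tend to 0. -/
lemma norm_jacksonTerm_le (hq : ‖q‖ < 1) (r B₁ B₂ B₃ B₄ : ℂ) :
    ∃ C, ∀ N n : ℕ, ‖jacksonTerm q r (B₁ * q ^ N) B₂ B₃ B₄ n‖ ≤ C * ‖q‖ ^ n := by
  obtain ⟨C, hC, hinv⟩ := exists_norm_inv_qPochInf_le hq (x := B₁ * B₂ * B₃ * B₄ * r / q)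
  have hpos := fun x : ℂ => (@qBound_pos q ‖x‖).le
  refine ⟨(1 + ‖B₁ * B₂ * B₃ * B₄ * r / q‖) *
    qBound q ‖B₁ * B₂ * B₃ * B₄ * r ^ 2 / q‖ *
    (qBound q ‖B₁‖ * qBound q ‖B₂‖ * qBound q ‖B₃‖ * qBound q ‖B₄‖) *
    (qBound q ‖B₁ * r‖ * qBound q ‖B₂ * r‖ * qBound q ‖B₃ * r‖ * qBound q ‖B₄ * r‖) *
    (qBound q ‖q‖ * qBound q ‖q / r‖) *
    (qBound q ‖B₂ * B₃ * B₄ * r‖ * qBound q ‖B₁ * B₃ * B₄ * r‖ *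
      qBound q ‖B₁ * B₂ * B₄ * r‖ * qBound q ‖B₁ * B₂ * B₃ * r‖) * C, fun N n => ?_⟩
  rw [jacksonTerm,
    show B₁ * q ^ N * B₂ * B₃ * B₄ * r / q * q ^ (2 * n) =
      B₁ * B₂ * B₃ * B₄ * r / q * q ^ (N + 2 * n) by ring,
    show B₁ * q ^ N * B₂ * B₃ * B₄ * r / q * q ^ n =
      B₁ * B₂ * B₃ * B₄ * r / q * q ^ (N + n) by ring,
    show B₁ * q ^ N * B₂ * B₃ * B₄ * r ^ 2 / q = B₁ * B₂ * B₃ * B₄ * r ^ 2 / q * q ^ N by ring,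
    show B₁ * q ^ N * r = B₁ * r * q ^ N by ring,
    show q ^ (n + 1) / r = q / r * q ^ n by ring, pow_succ' q n,
    show B₁ * q ^ N * B₃ * B₄ * r * q ^ n = B₁ * B₃ * B₄ * r * q ^ (N + n) by ring,
    show B₁ * q ^ N * B₂ * B₄ * r * q ^ n = B₁ * B₂ * B₄ * r * q ^ (N + n) by ring,
    show B₁ * q ^ N * B₂ * B₃ * r * q ^ n = B₁ * B₂ * B₃ * r * q ^ (N + n) by ring]
  refine (?_ : _ ≤ ‖q‖ ^ n * (1 + ‖B₁ * B₂ * B₃ * B₄ * r / q‖) *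
    qBound q ‖B₁ * B₂ * B₃ * B₄ * r ^ 2 / q‖ *
    (qBound q ‖B₁‖ * qBound q ‖B₂‖ * qBound q ‖B₃‖ * qBound q ‖B₄‖) *
    (qBound q ‖B₁ * r‖ * qBound q ‖B₂ * r‖ * qBound q ‖B₃ * r‖ * qBound q ‖B₄ * r‖) *
    (qBound q ‖q‖ * qBound q ‖q / r‖) *
    (qBound q ‖B₂ * B₃ * B₄ * r‖ * qBound q ‖B₁ * B₃ * B₄ * r‖ *
      qBound q ‖B₁ * B₂ * B₄ * r‖ * qBound q ‖B₁ * B₂ * B₃ * r‖) * C).trans_eq (by ring)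
  have hI : ∀ x n, ‖qPochInf q (x * q ^ n)‖ ≤ qBound q ‖x‖ := norm_qPochInf_mul_pow_le hq
  have hI' : ∀ x, ‖qPochInf q x‖ ≤ qBound q ‖x‖ := fun x => norm_qPochInf_le hq le_rfl
  have hN' : ∀ x n, ‖qPochNat q x n‖ ≤ qBound q ‖x‖ := fun x n => norm_qPochNat_le hq le_rfl n
  have M : ∀ {x y : ℂ} {b c : ℝ}, ‖x‖ ≤ b → ‖y‖ ≤ c → ‖x * y‖ ≤ b * c :=
    fun h h' => norm_mul_le_of_le h h'
  exact M (M (M (M (M (M (M (norm_pow q n).le (norm_one_sub_mul_pow_le hq _ _))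
    (norm_qPochNat_mul_pow_le hq _ _ _))
    (M (M (M (norm_qPochNat_mul_pow_le hq _ _ _) (hN' _ _)) (hN' _ _)) (hN' _ _)))
    (M (M (M (hI _ _) (hI' _)) (hI' _)) (hI' _))) (M (hI _ _) (hI _ _)))
    (M (M (M (hI _ _) (hI _ _)) (hI _ _)) (hI _ _))) (hinv _)

lemma summable_jacksonTerm (hq : ‖q‖ < 1) (r B₁ B₂ B₃ B₄ : ℂ) :
    Summable (jacksonTerm q r B₁ B₂ B₃ B₄) := by
  obtain ⟨C, hC⟩ := norm_jacksonTerm_le hq r B₁ B₂ B₃ B₄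
  exact ((summable_geometric_of_lt_one (norm_nonneg q) hq).mul_left C).of_norm_bounded
    fun n => by simpa using hC 0 n

/-- The right side is the limit of the telescoped partial sums. Replacing r by 1/r and each B by B r
divides it by r, so it cancels in `jacksonSum`. -/
lemma tsum_jacksonTerm_sub (hq : ‖q‖ < 1) (hq0 : q ≠ 0) {r B₁ B₂ B₃ B₄ : ℂ} (hr : r ≠ 0)
    (hl : QNonzero q (B₁ * B₂ * B₃ * B₄ * r / q)) :
    ∑' n, jacksonTerm q r B₁ B₂ B₃ B₄ n -
      (1 - B₁ * B₂ * r) * (1 - B₁ * B₃ * r) * (1 - B₁ * B₄ * r) *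
        ∑' n, jacksonTerm q r (B₁ * q) B₂ B₃ B₄ n =
      -(B₁ * r) * qPochInf q (B₁ * B₂ * B₃ * B₄ * r ^ 2) * qPochInf q (B₁ * q) *
        (qPochInf q B₂ * qPochInf q B₃ * qPochInf q B₄) *
        (qPochInf q (B₁ * q * r) * qPochInf q (B₂ * r) * qPochInf q (B₃ * r) *
          qPochInf q (B₄ * r)) := by
  have h1 := summable_jacksonTerm hq r B₁ B₂ B₃ B₄
  have h2 := (summable_jacksonTerm hq r (B₁ * q) B₂ B₃ B₄).mul_left
    ((1 - B₁ * B₂ * r) * (1 - B₁ * B₃ * r) * (1 - B₁ * B₄ * r))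
  rw [← tsum_mul_left, ← h1.tsum_sub h2]
  have h3 := (h1.sub h2).hasSum.tendsto_sum_nat.comp (tendsto_add_atTop_nat 1)
  simp only [Function.comp_def, sum_jacksonTerm_sub hq hq0 hr hl] at h3
  refine tendsto_nhds_unique h3 ?_
  have hP : ∀ x, Tendsto (fun n : ℕ => qPochInf q (x * q ^ (n + 1))) atTop (𝓝 1) := fun x =>
    (tendsto_qPochInf_mul_pow hq x).comp (tendsto_add_atTop_nat 1)
  have hN : ∀ x, Tendsto (fun n : ℕ => qPochNat q x (n + 1)) atTop (𝓝 (qPochInf q x)) := fun x =>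
    (tendsto_qPochNat hq x).comp (tendsto_add_atTop_nat 1)
  have hP1 := hP 1
  have hPr := hP (1 / r)
  simp only [one_mul, one_div_mul_eq_div] at hP1 hPr
  have h1 := (tendsto_mul_pow_zero hq (B₁ ^ 2 * B₂ * B₃ * B₄ * r ^ 2)).const_sub 1
  have h := ((((((((h1.const_mul (-(B₁ * r))).mul
    (tendsto_qPochNat hq (B₁ * B₂ * B₃ * B₄ * r ^ 2))).mul (tendsto_qPochNat hq (B₁ * q))).mul
    (((hN B₂).mul (hN B₃)).mul (hN B₄))).mul_const
    (qPochInf q (B₁ * q * r) * qPochInf q (B₂ * r) * qPochInf q (B₃ * r) *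
          qPochInf q (B₄ * r)))).mul (hP1.mul hPr)).mul
    ((((tendsto_qPochInf_mul_pow hq (B₂ * B₃ * B₄ * r)).mul (hP (B₁ * B₃ * B₄ * r))).mul
      (hP (B₁ * B₂ * B₄ * r))).mul (hP (B₁ * B₂ * B₃ * r)))).mul
    ((hP (B₁ * B₂ * B₃ * B₄ * r / q)).inv₀ one_ne_zero)
  simp only [sub_zero, mul_one, inv_one] at h
  exact h

/-- The difference of the two complementary `jacksonTerm` series. -/
noncomputable def jacksonSum (q r B₁ B₂ B₃ B₄ : ℂ) : ℂ :=
  r * ∑' n, jacksonTerm q r⁻¹ (B₁ * r) (B₂ * r) (B₃ * r) (B₄ * r) n -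
    ∑' n, jacksonTerm q r B₁ B₂ B₃ B₄ n

/-- The products B₁ B₂ r, B₁ B₃ r, B₁ B₄ r are the same for both complementary series, and the
boundary terms cancel. The condition with r³ concerns the leading parameter of the complementary
series. -/
lemma jacksonSum_succ (hq : ‖q‖ < 1) (hq0 : q ≠ 0) {r B₁ B₂ B₃ B₄ : ℂ} (hr : r ≠ 0)
    (hl : QNonzero q (B₁ * B₂ * B₃ * B₄ * r / q))
    (hl' : QNonzero q (B₁ * B₂ * B₃ * B₄ * r ^ 3 / q)) :
    jacksonSum q r B₁ B₂ B₃ B₄ = (1 - B₁ * B₂ * r) * (1 - B₁ * B₃ * r) * (1 - B₁ * B₄ * r) *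
      jacksonSum q r (B₁ * q) B₂ B₃ B₄ := by
  have h1 := tsum_jacksonTerm_sub hq hq0 hr hl
  have h2 := tsum_jacksonTerm_sub hq hq0 (inv_ne_zero hr) (B₁ := B₁ * r) (B₂ := B₂ * r)
    (B₃ := B₃ * r) (B₄ := B₄ * r) (by
      convert hl' using 1
      field_simp)
  simp only [jacksonSum]
  rw [show B₁ * r * (B₂ * r) * (B₃ * r) * (B₄ * r) * r⁻¹ ^ 2 = B₁ * B₂ * B₃ * B₄ * r ^ 2 by
      field_simp,
    show B₁ * r * (B₂ * r) * r⁻¹ = B₁ * B₂ * r by field_simp,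
    show B₁ * r * (B₃ * r) * r⁻¹ = B₁ * B₃ * r by field_simp,
    show B₁ * r * (B₄ * r) * r⁻¹ = B₁ * B₄ * r by field_simp,
    mul_inv_cancel_right₀ hr, mul_inv_cancel_right₀ hr, mul_inv_cancel_right₀ hr,
    mul_inv_cancel_right₀ hr, mul_right_comm B₁ r q, mul_inv_cancel_right₀ hr] at h2
  linear_combination r * h2 - h1

lemma jacksonSum_iterate (hq : ‖q‖ < 1) (hq0 : q ≠ 0) {r B₁ B₂ B₃ B₄ : ℂ} (hr : r ≠ 0)
    (hl : QNonzero q (B₁ * B₂ * B₃ * B₄ * r / q))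
    (hl' : QNonzero q (B₁ * B₂ * B₃ * B₄ * r ^ 3 / q)) (n : ℕ) :
    jacksonSum q r B₁ B₂ B₃ B₄ = qPochNat q (B₁ * B₂ * r) n * qPochNat q (B₁ * B₃ * r) n *
      qPochNat q (B₁ * B₄ * r) n * jacksonSum q r (B₁ * q ^ n) B₂ B₃ B₄ := by
  induction n with
  | zero => simp
  | succ n ih =>
    rw [ih, jacksonSum_succ hq hq0 hr (B₁ := B₁ * q ^ n), mul_assoc B₁ (q ^ n) q, ← pow_succ]
    · simp only [qPochNat_succ]; ring
    · convert hl.mul_pow n using 1; ring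
    · convert hl'.mul_pow n using 1; ring

lemma tendsto_tsum_jacksonTerm (hq : ‖q‖ < 1) (r B₁ B₂ B₃ B₄ : ℂ) :
    Tendsto (fun N : ℕ => ∑' n, jacksonTerm q r (B₁ * q ^ N) B₂ B₃ B₄ n) atTop
      (𝓝 (∑' n, jacksonTerm q r 0 B₂ B₃ B₄ n)) := by
  obtain ⟨C, hC⟩ := norm_jacksonTerm_le hq r B₁ B₂ B₃ B₄
  refine tendsto_tsum_of_dominated_convergence
    ((summable_geometric_of_lt_one (norm_nonneg q) hq).mul_left C) (fun n => ?_)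
    (Eventually.of_forall fun N n => hC N n)
  have hc := continuous_qPochInf hq
  have hcn : ∀ n, Continuous fun x => qPochNat q x n := continuous_qPochNat
  refine Tendsto.comp (g := fun x => jacksonTerm q r x B₂ B₃ B₄ n) ?_ (tendsto_mul_pow_zero hq B₁)
  unfold jacksonTerm
  refine Tendsto.mul ?_ (Tendsto.inv₀ ?_ ?_)
  · have h : Continuous fun x : ℂ => q ^ n * (1 - x * B₂ * B₃ * B₄ * r / q * q ^ (2 * n)) *
      qPochNat q (x * B₂ * B₃ * B₄ * r ^ 2 / q) n *
      (qPochNat q x n * qPochNat q B₂ n * qPochNat q B₃ n * qPochNat q B₄ n) *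
      (qPochInf q (x * r) * qPochInf q (B₂ * r) * qPochInf q (B₃ * r) * qPochInf q (B₄ * r)) *
      (qPochInf q (q ^ (n + 1)) * qPochInf q (q ^ (n + 1) / r)) *
      (qPochInf q (B₂ * B₃ * B₄ * r * q ^ n) * qPochInf q (x * B₃ * B₄ * r * q ^ n) *
        qPochInf q (x * B₂ * B₄ * r * q ^ n) * qPochInf q (x * B₂ * B₃ * r * q ^ n)) := by
      have := (hcn n).comp (show Continuous fun x : ℂ => x * B₂ * B₃ * B₄ * r ^ 2 / q by fun_prop)
      have := hcn n
      simp only [Function.comp_def] at *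
      fun_prop
    exact h.tendsto 0
  · have h : Continuous fun x : ℂ => qPochInf q (x * B₂ * B₃ * B₄ * r / q * q ^ n) := by fun_prop
    exact h.tendsto 0
  · simp

lemma jacksonSum_eq_zero_left (hq : ‖q‖ < 1) (hq0 : q ≠ 0) {r B₁ B₂ B₃ B₄ : ℂ} (hr : r ≠ 0)
    (hl : QNonzero q (B₁ * B₂ * B₃ * B₄ * r / q))
    (hl' : QNonzero q (B₁ * B₂ * B₃ * B₄ * r ^ 3 / q)) :
    jacksonSum q r B₁ B₂ B₃ B₄ = qPochInf q (B₁ * B₂ * r) * qPochInf q (B₁ * B₃ * r) *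
      qPochInf q (B₁ * B₄ * r) * jacksonSum q r 0 B₂ B₃ B₄ := by
  have hlim : Tendsto (fun N : ℕ => jacksonSum q r (B₁ * q ^ N) B₂ B₃ B₄) atTop
      (𝓝 (jacksonSum q r 0 B₂ B₃ B₄)) := by
    unfold jacksonSum
    refine Tendsto.sub (Tendsto.const_mul _ ?_) (tendsto_tsum_jacksonTerm hq _ _ _ _ _)
    simpa only [mul_right_comm B₁, zero_mul] using
      tendsto_tsum_jacksonTerm hq r⁻¹ (B₁ * r) (B₂ * r) (B₃ * r) (B₄ * r)
  have h := (((tendsto_qPochNat hq (B₁ * B₂ * r)).mul (tendsto_qPochNat hq (B₁ * B₃ * r))).mul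
    (tendsto_qPochNat hq (B₁ * B₄ * r))).mul hlim
  refine tendsto_nhds_unique (tendsto_const_nhds.congr fun n => ?_) h
  exact jacksonSum_iterate hq hq0 hr hl hl' n

lemma jacksonSum_eq_zero (hq : ‖q‖ < 1) (hq0 : q ≠ 0) {r B₁ B₂ B₃ B₄ : ℂ} (hr : r ≠ 0)
    (hl : QNonzero q (B₁ * B₂ * B₃ * B₄ * r / q))
    (hl' : QNonzero q (B₁ * B₂ * B₃ * B₄ * r ^ 3 / q)) :
    jacksonSum q r B₁ B₂ B₃ B₄ = qPochInf q (B₁ * B₂ * r) * qPochInf q (B₁ * B₃ * r) *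
      qPochInf q (B₁ * B₄ * r) * (qPochInf q (B₂ * B₃ * r) * qPochInf q (B₂ * B₄ * r) *
      qPochInf q (B₃ * B₄ * r)) * jacksonSum q r 0 0 0 0 := by
  have hrot : ∀ s x₁ x₂ x₃ x₄ n, jacksonTerm q s x₁ x₂ x₃ x₄ n = jacksonTerm q s x₂ x₃ x₄ x₁ n :=
    fun s x₁ x₂ x₃ x₄ n => by
      unfold jacksonTerm
      rw [show x₁ * x₂ * x₃ * x₄ = x₂ * x₃ * x₄ * x₁ by ring,
        show x₃ * x₄ * x₁ = x₁ * x₃ * x₄ by ring, show x₂ * x₄ * x₁ = x₁ * x₂ * x₄ by ring,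
        show x₂ * x₃ * x₁ = x₁ * x₂ * x₃ by ring]
      ring
  have hrot' : ∀ x₁ x₂ x₃ x₄, jacksonSum q r x₁ x₂ x₃ x₄ = jacksonSum q r x₂ x₃ x₄ x₁ :=
    fun x₁ x₂ x₃ x₄ => by
      simp only [jacksonSum]
      rw [tsum_congr (hrot r x₁ x₂ x₃ x₄), tsum_congr (hrot r⁻¹ (x₁ * r) (x₂ * r) (x₃ * r) (x₄ * r))]
  have h0 : ∀ x₁ x₂ x₃ : ℂ, jacksonSum q r x₁ x₂ x₃ 0 = qPochInf q (x₁ * x₂ * r) *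
      qPochInf q (x₁ * x₃ * r) * jacksonSum q r x₂ x₃ 0 0 := fun x₁ x₂ x₃ => by
    rw [jacksonSum_eq_zero_left hq hq0 hr (by simpa using qNonzero_zero)
      (by simpa using qNonzero_zero), hrot' 0]
    simp
  rw [jacksonSum_eq_zero_left hq hq0 hr hl hl', hrot' 0, h0, h0, h0]
  simp
  ring

/-- **Bailey's nonterminating extension of Jackson's `₈φ₇` sum**, normalised by infinite
products. -/
theorem jacksonSum_eq (hq : ‖q‖ < 1) (hq0 : q ≠ 0) {r B₁ B₂ B₃ B₄ : ℂ} (hr : r ≠ 0)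
    (hl : QNonzero q (B₁ * B₂ * B₃ * B₄ * r / q))
    (hl' : QNonzero q (B₁ * B₂ * B₃ * B₄ * r ^ 3 / q)) :
    jacksonSum q r B₁ B₂ B₃ B₄ = qPochInf q (B₁ * B₂ * r) * qPochInf q (B₁ * B₃ * r) *
      qPochInf q (B₁ * B₄ * r) * (qPochInf q (B₂ * B₃ * r) * qPochInf q (B₂ * B₄ * r) *
      qPochInf q (B₃ * B₄ * r)) * -(qPochInf q q * qPochInf q r * qPochInf q (q / r)) := by
  rw [jacksonSum_eq_zero hq hq0 hr hl hl']
  congr 1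
  -- Here the complementary series contains the factor (1;q)_∞ = 0, and the other one stops after n
  -- = 0.
  have h := jacksonSum_eq_zero hq hq0 hr (B₁ := 1) (B₂ := 0) (B₃ := 0) (B₄ := 0)
    (by simpa using qNonzero_zero) (by simpa using qNonzero_zero)
  simp only [mul_zero, zero_mul, qPochInf_zero, one_mul] at h
  rw [← h, jacksonSum]
  have h1 : ∀ n, jacksonTerm q r⁻¹ (1 * r) (0 * r) (0 * r) (0 * r) n = 0 := fun n => by
    simp [jacksonTerm, mul_inv_cancel₀ hr, qPochInf_one hq]
  have h2 : ∀ n, n ≠ 0 → jacksonTerm q r 1 0 0 0 n = 0 := fun n hn => by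
    obtain ⟨m, rfl⟩ := Nat.exists_eq_succ_of_ne_zero hn
    simp [jacksonTerm, qPochNat_succ']
  rw [tsum_eq_single 0 h2, tsum_congr h1]
  simp [jacksonTerm]
  ring

end Jackson

/-! ### Rewriting the Jackson expansion of an ₈ψ₈ term in terms of ₆ψ₆ terms. -/

section Expansion

variable {q : ℂ}

/-- Reverse each factor: 1 - X q^i = -X q^i (1 - q^(-i)/X), and the factors 1 - q^(-i)/X extend
(q/X;q)_∞ downwards. -/
lemma qPochInf_mul_zpow_neg (hq : ‖q‖ < 1) (hq0 : q ≠ 0) {X : ℂ} (hX : X ≠ 0) (n : ℕ) :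
    qPochInf q (q / X) * qPochNat q X n =
      (-1) ^ n * q ^ tri n * X ^ n * qPochInf q (q / X * q ^ (-(n : ℤ))) := by
  induction n with
  | zero => simp
  | succ n ih =>
    rw [qPochNat_succ, ← mul_assoc, ih, Nat.cast_succ, tri_succ,
      qPochInf_eq hq (q / X * q ^ (-((n : ℤ) + 1))), mul_assoc (q / X), ← zpow_add_one₀ hq0,
      show -((n : ℤ) + 1) + 1 = -n by ring, neg_add, zpow_add₀ hq0, zpow_add₀ hq0, zpow_neg,
      zpow_natCast, zpow_neg, zpow_one]
    have := pow_ne_zero n hq0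
    field_simp
    ring

/-- The finite products that depend on k are absorbed by shifting the parameter f to f q^n. -/
lemma biTheta_mul_qPochNat (hq : ‖q‖ < 1) (hq0 : q ≠ 0) {a f : ℂ} (ha : a ≠ 0) (hf : f ≠ 0)
    (k : ℤ) (n : ℕ) :
    biTheta q a f⁻¹ k * (qPochNat q (f * q ^ k) n * qPochNat q (f / a * q ^ (-k)) n) =
      (f ^ 2 / a) ^ n * (q ^ tri n) ^ 2 * biTheta q a (f⁻¹ * q ^ (-(n : ℤ))) k := by
  have hk := zpow_ne_zero k hq0
  have h1 := qPochInf_mul_zpow_neg hq hq0 (mul_ne_zero hf hk) n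
  have h2 := qPochInf_mul_zpow_neg hq hq0
    (mul_ne_zero (div_ne_zero hf ha) (zpow_ne_zero (-k) hq0)) n
  rw [show q / (f * q ^ k) = f⁻¹ * q ^ (1 - k) by rw [zpow_sub₀ hq0]; field_simp] at h1
  rw [show q / (f / a * q ^ (-k)) = a * f⁻¹ * q ^ (k + 1) by
    rw [zpow_neg, zpow_add_one₀ hq0]; field_simp] at h2
  unfold biTheta
  rw [show a * (f⁻¹ * q ^ (-(n : ℤ))) * q ^ (k + 1) = a * f⁻¹ * q ^ (k + 1) * q ^ (-(n : ℤ)) by ring,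
    show f⁻¹ * q ^ (-(n : ℤ)) * q ^ (1 - k) = f⁻¹ * q ^ (1 - k) * q ^ (-(n : ℤ)) by ring]
  have h3 : (f * q ^ k) ^ n * (f / a * q ^ (-k)) ^ n = (f ^ 2 / a) ^ n := by
    rw [← mul_pow, zpow_neg]; congr 1; field_simp
  have h4 : (-1 : ℂ) ^ n * (-1) ^ n = 1 := by rw [← mul_pow]; simp
  calc _ = (-1) ^ k * q ^ tri k * ((qPochInf q (f⁻¹ * q ^ (1 - k)) * qPochNat q (f * q ^ k) n) *
        (qPochInf q (a * f⁻¹ * q ^ (k + 1)) * qPochNat q (f / a * q ^ (-k)) n)) := by ring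
    _ = _ := by
      rw [h1, h2, ← h3]
      linear_combination ((-1) ^ k * q ^ tri k * (q ^ tri n) ^ 2 * (f * q ^ k) ^ n *
        (f / a * q ^ (-k)) ^ n * qPochInf q (f⁻¹ * q ^ (1 - k) * q ^ (-(n : ℤ))) *
        qPochInf q (a * f⁻¹ * q ^ (k + 1) * q ^ (-(n : ℤ)))) * h4

/-- The factor of g completes these products to theta functions at g q^k and g q^(-k)/a, and
quasi-periodicity extracts k. The resulting (qa)^(-k) lowers the power (q²a³)^k of the ₈ψ₈ to the
(qa²)^k of a ₆ψ₆. -/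
lemma biTheta_mul_qPochInf (hq : ‖q‖ < 1) (hq0 : q ≠ 0) {a g : ℂ} (ha : a ≠ 0) (hg : g ≠ 0)
    (k : ℤ) :
    biTheta q a g⁻¹ k * (qPochInf q (g * q ^ k) * qPochInf q (g / a * q ^ (-k))) =
      (-1) ^ k * (q ^ tri k)⁻¹ * ((q * a) ^ k)⁻¹ * (jtheta q g * jtheta q (g / a)) := by
  have hk := zpow_ne_zero k hq0
  have h1 := jtheta_mul_zpow hq hq0 hg k
  have h2 := jtheta_mul_zpow hq hq0 (div_ne_zero hg ha) (-k)
  rw [jtheta, show q / (g * q ^ k) = g⁻¹ * q ^ (1 - k) by rw [zpow_sub₀ hq0]; field_simp] at h1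
  rw [jtheta, show q / (g / a * q ^ (-k)) = a * g⁻¹ * q ^ (k + 1) by
    rw [zpow_neg, zpow_add_one₀ hq0]; field_simp] at h2
  have h4 : ((-1 : ℂ) ^ k) * (-1) ^ (-k) = 1 := by rw [← zpow_add₀ (by simp)]; simp
  calc _ = (-1) ^ k * q ^ tri k * ((qPochInf q (g * q ^ k) * qPochInf q (g⁻¹ * q ^ (1 - k))) *
        (qPochInf q (g / a * q ^ (-k)) * qPochInf q (a * g⁻¹ * q ^ (k + 1)))) := by
          unfold biTheta; ring
    _ = _ := by
      rw [h1, h2, tri_neg, neg_neg, zpow_neg, zpow_neg q (_ + _), zpow_add₀ hq0, zpow_neg g,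
        div_zpow, mul_zpow]
      have := zpow_ne_zero k hg
      have := zpow_ne_zero k ha
      have := zpow_ne_zero (tri k) hq0
      field_simp
      linear_combination (jtheta q g * jtheta q (g / a)) * h4

/-- The factor of the summand that does not depend on the outer index. -/
noncomputable def expansionCoeff (q a d e f g : ℂ) (n : ℕ) : ℂ :=
  jtheta q g * jtheta q (g / a) * qPochInf q (q * a / (d * f)) * qPochInf q (q * a / (e * f)) *
    q ^ n * ((1 - q * a * f / (d * e * g) * q ^ (2 * n)) * qPochNat q (q * a / (d * e)) n *
      qPochNat q (q * a / (d * g)) n * qPochNat q (q * a / (e * g)) n *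
      qPochInf q (q ^ (n + 1)) * qPochInf q (q ^ (n + 1) / (g / f)) *
      qPochInf q (q * f / e * q ^ n) * qPochInf q (q * f / d * q ^ n) *
      (qPochInf q (q * a * f / (d * e * g) * q ^ n))⁻¹)

/-- The factor of the summand that depends on both indices. -/
noncomputable def expansionCore (q a x y f h : ℂ) (k : ℤ) (n : ℕ) : ℂ :=
  (1 - a * q ^ (2 * k)) * (q * a ^ 2) ^ k * (biTheta q a x k * biTheta q a y k *
    (biTheta q a f⁻¹ k * (qPochNat q (f * q ^ k) n * qPochNat q (f / a * q ^ (-k)) n)) *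
    biTheta q a (h * q ^ n) k)

lemma expansionCore_eq (hq : ‖q‖ < 1) (hq0 : q ≠ 0) {a f : ℂ} (ha : a ≠ 0) (hf : f ≠ 0)
    (x y h : ℂ) (k : ℤ) (n : ℕ) :
    expansionCore q a x y f h k n = (f ^ 2 / a) ^ n * (q ^ tri n) ^ 2 *
      wellPoisedSix q a x y (f⁻¹ * q ^ (-(n : ℤ))) (h * q ^ n) k := by
  rw [expansionCore, biTheta_mul_qPochNat hq hq0 ha hf, wellPoisedSix]
  ring

/-- The factor of the general term of the `₈ψ₈` that multiplies the nonterminating Jackson sum. -/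
noncomputable def outerFactor (q a x y f g : ℂ) (k : ℤ) : ℂ :=
  (1 - a * q ^ (2 * k)) * (q ^ 2 * a ^ 3) ^ k * (q ^ tri k) ^ 2 *
    (biTheta q a x k * biTheta q a y k * biTheta q a f⁻¹ k * biTheta q a g⁻¹ k)

/-- The Jackson parameters are chosen so that the leading parameter qaf/deg is free of k. The two
lower products that do depend on k form the fourth ₆ψ₆ factor, with reciprocal parameter qa/(deg)
q^n. -/
lemma outerFactor_mul_jacksonTerm (hq : ‖q‖ < 1) (hq0 : q ≠ 0) {a d e f g : ℂ} (ha : a ≠ 0)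
    (hd : d ≠ 0) (he : e ≠ 0) (hf : f ≠ 0) (hg : g ≠ 0) (x y : ℂ) (k : ℤ) (n : ℕ) :
    outerFactor q a x y f g k * jacksonTerm q (g / f) (q * a / (d * g)) (q * a / (e * g))
      (f * q ^ k) (f / a * q ^ (-k)) n =
    expansionCoeff q a d e f g n * expansionCore q a x y f (q * a / (d * e * g)) k n := by
  have hk := zpow_ne_zero k hq0
  have htk := zpow_ne_zero (tri k) hq0
  have hqa := zpow_ne_zero k (mul_ne_zero hq0 ha)
  have hT := biTheta_mul_qPochInf hq hq0 ha hg k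
  have h1 : ((-1 : ℂ) ^ k) * (-1) ^ k = 1 := by rw [← mul_zpow]; simp
  have h2 : (q ^ 2 * a ^ 3) ^ k = (q * a ^ 2) ^ k * (q * a) ^ k := by
    rw [← mul_zpow]; congr 1; ring
  have hkk : q ^ k * q ^ (-k) = 1 := by rw [zpow_neg]; field_simp
  have hl : q * a / (d * g) * (q * a / (e * g)) * (f * q ^ k) * (f / a * q ^ (-k)) * (g / f) / q =
      q * a * f / (d * e * g) := by
    rw [zpow_neg]; field_simp
  have hm : q * a / (d * g) * (q * a / (e * g)) * (f * q ^ k) * (f / a * q ^ (-k)) * (g / f) ^ 2 / q =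
      q * a / (d * e) := by
    rw [zpow_neg]; field_simp
  unfold jacksonTerm outerFactor expansionCoeff expansionCore
  rw [hl, hm, show q * a / (d * g) * (g / f) = q * a / (d * f) by field_simp,
    show q * a / (e * g) * (g / f) = q * a / (e * f) by field_simp,
    show f * q ^ k * (g / f) = g * q ^ k by field_simp,
    show f / a * q ^ (-k) * (g / f) = g / a * q ^ (-k) by field_simp,
    show q * a / (e * g) * (f * q ^ k) * (f / a * q ^ (-k)) * (g / f) = q * f / e by
      rw [zpow_neg]; field_simp,
    show q * a / (d * g) * (f * q ^ k) * (f / a * q ^ (-k)) * (g / f) = q * f / d by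
      rw [zpow_neg]; field_simp]
  have h3 : biTheta q a (q * a / (d * e * g) * q ^ n) k = (-1) ^ k * q ^ tri k *
      (qPochInf q (q * a / (d * g) * (q * a / (e * g)) * (f * q ^ k) * (g / f) * q ^ n) *
      qPochInf q (q * a / (d * g) * (q * a / (e * g)) * (f / a * q ^ (-k)) * (g / f) * q ^ n)) := by
    unfold biTheta
    congr 3
    · rw [zpow_add_one₀ hq0]; field_simp
    · rw [zpow_sub₀ hq0, zpow_neg, zpow_one]; field_simp
  rw [h3, h2]
  generalize qPochInf q (q * a / (d * g) * (q * a / (e * g)) * (f * q ^ k) * (g / f) * q ^ n) = u₁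
  generalize qPochInf q (q * a / (d * g) * (q * a / (e * g)) * (f / a * q ^ (-k)) * (g / f) * q ^ n)
    = u₂
  generalize jtheta q g * jtheta q (g / a) = T at *
  generalize qPochInf q (g * q ^ k) = u₃ at *
  generalize qPochInf q (g / a * q ^ (-k)) = u₄ at *
  generalize (qPochInf q (q * a * f / (d * e * g) * q ^ n))⁻¹ = u₅
  generalize qPochInf q (q ^ (n + 1)) = u₆
  generalize qPochInf q (q ^ (n + 1) / (g / f)) = u₇
  generalize qPochInf q (q * f / e * q ^ n) = u₈
  generalize qPochInf q (q * f / d * q ^ n) = u₉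
  generalize qPochInf q (q * a / (d * f)) = u₁₀
  generalize qPochInf q (q * a / (e * f)) = u₁₁
  generalize (1 - q * a * f / (d * e * g) * q ^ (2 * n)) = u₁₂
  generalize 1 - a * q ^ (2 * k) = u₁₃
  generalize qPochNat q (q * a / (d * e)) n = u₁₄
  generalize qPochNat q (q * a / (d * g)) n = u₁₅
  generalize qPochNat q (q * a / (e * g)) n = u₁₆
  have hT' : biTheta q a g⁻¹ k * (u₃ * u₄) * ((q * a) ^ k * q ^ tri k) = (-1) ^ k * T := by
    rw [hT]; field_simp
  linear_combination (q ^ n * u₁ * u₂ * u₅ * u₆ * u₇ * u₈ * u₉ * u₁₀ * u₁₁ * u₁₂ * u₁₃ * u₁₄ * u₁₅ *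
    u₁₆ * (q * a ^ 2) ^ k * q ^ tri k * biTheta q a x k * biTheta q a y k * biTheta q a f⁻¹ k *
    qPochNat q (f * q ^ k) n * qPochNat q (f / a * q ^ (-k)) n) * hT'

end Expansion

/-! ### Absolute convergence of the double series. -/

section Interchange

variable {q : ℂ}

/-- The part of `expansionCore` whose size depends on both indices jointly. -/
noncomputable def crossProd (q v h : ℂ) (n k : ℕ) : ℂ :=
  qPochNat q (v * q ^ (-(k : ℤ))) n * ∏ i ∈ range k, (h * q ^ n - q ^ i)

/-- The first factor can grow with k at fixed n, and only joint estimates are sharp enough. Along a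
diagonal step the negative powers of q cancel and the ratio is bounded, with limiting size ‖v‖/‖q‖.
-/
lemma crossProd_succ (hq0 : q ≠ 0) (v h : ℂ) (n k : ℕ) :
    crossProd q v h (n + 1) (k + 1) =
      crossProd q v h n k * ((q ^ k - v / q) * (h * q ^ (n + 1) - 1)) := by
  have hk := pow_ne_zero k hq0
  have h1 : ∏ i ∈ range k, (h * q ^ (n + 1) - q ^ (i + 1)) =
      q ^ k * ∏ i ∈ range k, (h * q ^ n - q ^ i) := by
    rw [show q ^ k = ∏ _i ∈ range k, q by simp, ← prod_mul_distrib]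
    exact prod_congr rfl fun i _ => by ring
  unfold crossProd
  rw [qPochNat_succ', prod_range_succ', h1, Nat.cast_succ, mul_assoc v, ← zpow_add_one₀ hq0,
    show -((k : ℤ) + 1) + 1 = -k by ring, neg_add, zpow_add₀ hq0, zpow_neg, zpow_natCast, zpow_neg,
    zpow_one, pow_zero]
  field_simp

lemma norm_crossProd_add_le (hq : ‖q‖ < 1) (hq0 : q ≠ 0) {v : ℂ} (hv : v ≠ 0) (h : ℂ)
    (n k m : ℕ) :
    ‖crossProd q v h (n + m) (k + m)‖ ≤
      ‖crossProd q v h n k‖ * (‖v‖ / ‖q‖) ^ m * (qBound q ‖v‖⁻¹ * qBound q ‖h‖) := by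
  have hq' : 0 < ‖q‖ := norm_pos_iff.2 hq0
  have hv' : 0 < ‖v‖ := norm_pos_iff.2 hv
  have key : ‖crossProd q v h (n + m) (k + m)‖ ≤ ‖crossProd q v h n k‖ * (‖v‖ / ‖q‖) ^ m *
      ((∏ j ∈ range m, (1 + ‖v‖⁻¹ * ‖q‖ ^ j)) * ∏ j ∈ range m, (1 + ‖h‖ * ‖q‖ ^ j)) := by
    induction m with
    | zero => simp
    | succ m ih =>
      rw [← add_assoc, ← add_assoc, crossProd_succ hq0, norm_mul, norm_mul, prod_range_succ,
        prod_range_succ]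
      have h1 : ‖q ^ (k + m) - v / q‖ ≤ ‖v‖ / ‖q‖ * (1 + ‖v‖⁻¹ * ‖q‖ ^ m) := by
        refine (norm_sub_le _ _).trans ?_
        rw [norm_pow, norm_div, mul_add, mul_one, add_comm]
        rw [show ‖v‖ / ‖q‖ * (‖v‖⁻¹ * ‖q‖ ^ m) = ‖q‖ ^ m / ‖q‖ by field_simp]
        have : ‖q‖ ^ (k + m) ≤ ‖q‖ ^ m / ‖q‖ := by
          rw [le_div_iff₀ hq', ← pow_succ]
          exact pow_le_pow_of_le_one hq'.le hq.le (by omega)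
        gcongr
      have h2 : ‖h * q ^ (n + m + 1) - 1‖ ≤ 1 + ‖h‖ * ‖q‖ ^ m := by
        refine (norm_sub_le _ _).trans ?_
        rw [norm_mul, norm_pow, norm_one, add_comm]
        have : ‖q‖ ^ (n + m + 1) ≤ ‖q‖ ^ m := pow_le_pow_of_le_one hq'.le hq.le (by omega)
        gcongr
      calc _ ≤ (‖crossProd q v h n k‖ * (‖v‖ / ‖q‖) ^ m *
            ((∏ j ∈ range m, (1 + ‖v‖⁻¹ * ‖q‖ ^ j)) * ∏ j ∈ range m, (1 + ‖h‖ * ‖q‖ ^ j))) *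
            ((‖v‖ / ‖q‖ * (1 + ‖v‖⁻¹ * ‖q‖ ^ m)) * (1 + ‖h‖ * ‖q‖ ^ m)) := by gcongr
        _ = _ := by ring
  refine key.trans ?_
  gcongr
  · exact (qBound_pos _).le
  · exact prod_one_add_le_qBound hq (by positivity) m
  · exact prod_one_add_le_qBound hq (by positivity) m

lemma norm_crossProd_zero_left_le (hq : ‖q‖ < 1) (v : ℂ) {h : ℂ} (hh : h ≠ 0) (k : ℕ) :
    ‖crossProd q v h 0 k‖ ≤ ‖h‖ ^ k * qBound q ‖h‖⁻¹ := by
  have hh' : 0 < ‖h‖ := norm_pos_iff.2 hh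
  rw [crossProd, qPochNat_zero, one_mul, norm_prod]
  calc _ ≤ ∏ i ∈ range k, (‖h‖ * (1 + ‖h‖⁻¹ * ‖q‖ ^ i)) := by
        refine prod_le_prod (fun i _ => norm_nonneg _) fun i _ => (norm_sub_le _ _).trans_eq ?_
        rw [norm_pow, pow_zero, mul_one]
        field_simp
    _ = ‖h‖ ^ k * ∏ i ∈ range k, (1 + ‖h‖⁻¹ * ‖q‖ ^ i) := by rw [prod_mul_distrib]; simp
    _ ≤ _ := by
        gcongr
        exact prod_one_add_le_qBound hq (by positivity) k

lemma norm_crossProd_zero_right_le (hq : ‖q‖ < 1) (v h : ℂ) (n : ℕ) :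
    ‖crossProd q v h n 0‖ ≤ qBound q ‖v‖ := by
  simpa [crossProd] using norm_qPochNat_le hq le_rfl n

/-- Go from (k, n) down the diagonal to an axis, then along it to the origin: max k n steps in all.
A diagonal step costs ‖q a x y‖, a step in k costs ‖q a² x y h / f‖, a step in n costs ‖q‖, up to
convergent products; all three are at most ρ. -/
lemma norm_expansionCore_natCast_le (hq : ‖q‖ < 1) (hq0 : q ≠ 0) {a x y f h : ℂ} (ha : a ≠ 0)
    (hx : x ≠ 0) (hy : y ≠ 0) (hf : f ≠ 0) (hh : h ≠ 0) {ρ : ℝ} (h1 : ‖q * a * x * y‖ ≤ ρ)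
    (h2 : ‖q * a ^ 2 * x * y * h / f‖ ≤ ρ) (h3 : ‖q‖ ≤ ρ) :
    ∃ C > 0, ∀ k n : ℕ, ‖q‖ ^ n * ‖expansionCore q a x y f h k n‖ ≤ C * ρ ^ max k n := by
  have hq' : 0 < ‖q‖ := norm_pos_iff.2 hq0
  have ha' : 0 < ‖a‖ := norm_pos_iff.2 ha
  have hf' : 0 < ‖f‖ := norm_pos_iff.2 hf
  have hx' : 0 < ‖x‖ := norm_pos_iff.2 hx
  have hy' : 0 < ‖y‖ := norm_pos_iff.2 hy
  have hh' : 0 < ‖h‖ := norm_pos_iff.2 hh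
  have hρ : 0 < ρ := hq'.trans_le h3
  obtain ⟨Cx, hCx, hbx⟩ := norm_biTheta_natCast_le hq hq0 a hx'
  obtain ⟨Cy, hCy, hby⟩ := norm_biTheta_natCast_le hq hq0 a hy'
  obtain ⟨Cf, hCf, hbf⟩ := norm_biTheta_natCast_le hq hq0 a (norm_pos_iff.2 (inv_ne_zero hf))
  have hpos := @qBound_pos q
  set E := qBound q ‖f / a‖⁻¹ * qBound q ‖h‖ with hE
  have hE0 : 0 < E := mul_pos (hpos _) (hpos _)
  have hb1 := hpos ‖f‖
  have hb2 := hpos ‖a * h * q‖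
  have hb3 := hpos ‖h * q‖
  obtain ⟨K, hK⟩ : ∃ K, K = (1 + ‖a‖) * Cx * Cy * Cf * qBound q ‖f‖ * qBound q ‖a * h * q‖ *
    qBound q ‖h * q‖ := ⟨_, rfl⟩
  have hK0 : 0 < K := by rw [hK]; positivity
  obtain ⟨s, hs⟩ : ∃ s, s = ‖q‖ * ‖a‖ ^ 2 * ‖x‖ * ‖y‖ * ‖f‖⁻¹ := ⟨_, rfl⟩
  have hs0 : 0 < s := by rw [hs]; positivity
  have hcore : ∀ k n : ℕ, ‖expansionCore q a x y f h k n‖ ≤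
      K * s ^ k * ‖crossProd q (f / a) h n k‖ := fun k n => by
    rw [expansionCore, biTheta_natCast hq hq0 a (h * q ^ n)]
    have e1 : ‖1 - a * q ^ (2 * (k : ℤ))‖ ≤ 1 + ‖a‖ := by
      exact_mod_cast norm_one_sub_mul_pow_le hq a (2 * k)
    have e2 : ‖qPochNat q (f * q ^ (k : ℤ)) n‖ ≤ qBound q ‖f‖ := by
      exact_mod_cast norm_qPochNat_mul_pow_le hq f k n
    have e3 : ‖qPochInf q (a * (h * q ^ n) * q ^ (k + 1))‖ ≤ qBound q ‖a * h * q‖ := by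
      rw [show a * (h * q ^ n) * q ^ (k + 1) = a * h * q * q ^ (n + k) by ring]
      exact norm_qPochInf_mul_pow_le hq _ _
    have e4 : ‖qPochInf q (h * q ^ n * q)‖ ≤ qBound q ‖h * q‖ := by
      rw [mul_right_comm]
      exact norm_qPochInf_mul_pow_le hq _ _
    have e5 := hbx x le_rfl k
    have e6 := hby y le_rfl k
    have e7 := hbf f⁻¹ le_rfl k
    calc _ = ‖1 - a * q ^ (2 * (k : ℤ))‖ * (‖q‖ * ‖a‖ ^ 2) ^ k * (‖biTheta q a x k‖ *
          ‖biTheta q a y k‖ * ‖biTheta q a f⁻¹ k‖ * ‖qPochNat q (f * q ^ (k : ℤ)) n‖ *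
          ‖qPochInf q (a * (h * q ^ n) * q ^ (k + 1))‖ * ‖qPochInf q (h * q ^ n * q)‖) *
          ‖crossProd q (f / a) h n k‖ := by
            simp only [crossProd, norm_mul, norm_pow, zpow_natCast]; ring
      _ ≤ (1 + ‖a‖) * (‖q‖ * ‖a‖ ^ 2) ^ k * ((Cx * ‖x‖ ^ k) * (Cy * ‖y‖ ^ k) * (Cf * ‖f⁻¹‖ ^ k) *
          qBound q ‖f‖ * qBound q ‖a * h * q‖ * qBound q ‖h * q‖) *
          ‖crossProd q (f / a) h n k‖ := by gcongr
      _ = _ := by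
        rw [hK, hs, norm_inv, mul_pow _ ‖f‖⁻¹, mul_pow _ ‖y‖, mul_pow _ ‖x‖]; ring
  have r1 : s * (‖f / a‖ / ‖q‖) * ‖q‖ = ‖q * a * x * y‖ := by
    rw [hs]; simp only [norm_mul, norm_div]; field_simp
  have r2 : s * ‖h‖ = ‖q * a ^ 2 * x * y * h / f‖ := by
    rw [hs]; simp only [norm_mul, norm_div, norm_pow]; field_simp
  refine ⟨K * E * (qBound q ‖f / a‖ + qBound q ‖h‖⁻¹), by
    have := hpos ‖f / a‖; have := hpos ‖h‖⁻¹; positivity, fun k n => ?_⟩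
  have hc1 := hpos ‖f / a‖
  have hc2 := hpos ‖h‖⁻¹
  rcases le_total k n with hkn | hkn
  · obtain ⟨m, rfl⟩ := Nat.exists_eq_add_of_le' hkn
    have h4 := norm_crossProd_add_le hq hq0 (div_ne_zero hf ha) h m 0 k
    rw [zero_add] at h4
    have h5 := norm_crossProd_zero_right_le hq (f / a) h m
    rw [max_eq_right hkn]
    calc _ ≤ ‖q‖ ^ (m + k) * (K * s ^ k * (qBound q ‖f / a‖ * (‖f / a‖ / ‖q‖) ^ k * E)) := by
          have := hcore k (m + k)
          gcongr
          refine this.trans ?_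
          gcongr
          refine h4.trans ?_
          gcongr
      _ = K * E * qBound q ‖f / a‖ * (‖q‖ ^ m * (s * (‖f / a‖ / ‖q‖) * ‖q‖) ^ k) := by
          rw [mul_pow, mul_pow]; ring
      _ ≤ K * E * (qBound q ‖f / a‖ + qBound q ‖h‖⁻¹) * (ρ ^ m * ρ ^ k) := by
          rw [r1]
          gcongr
          linarith
      _ = _ := by rw [pow_add]
  · obtain ⟨m, rfl⟩ := Nat.exists_eq_add_of_le' hkn
    have h4 := norm_crossProd_add_le hq hq0 (div_ne_zero hf ha) h 0 m n
    rw [zero_add] at h4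
    have h5 := norm_crossProd_zero_left_le hq (f / a) hh m
    rw [max_eq_left hkn]
    calc _ ≤ ‖q‖ ^ n * (K * s ^ (m + n) * (‖h‖ ^ m * qBound q ‖h‖⁻¹ * (‖f / a‖ / ‖q‖) ^ n * E)) := by
          have := hcore (m + n) n
          gcongr
          refine this.trans ?_
          gcongr
          refine h4.trans ?_
          gcongr
      _ = K * E * qBound q ‖h‖⁻¹ * ((s * ‖h‖) ^ m * (s * (‖f / a‖ / ‖q‖) * ‖q‖) ^ n) := by
          rw [mul_pow s, mul_pow, mul_pow s, pow_add]; ring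
      _ ≤ K * E * (qBound q ‖f / a‖ + qBound q ‖h‖⁻¹) * (ρ ^ m * ρ ^ n) := by
          rw [r1, r2]
          gcongr
          linarith
      _ = _ := by rw [pow_add]

/-- The substitution on the right leaves both q a x y and q a² x y h / f unchanged, so the estimate
for k ≥ 0 carries over with the same ρ. -/
lemma expansionCore_neg (hq0 : q ≠ 0) {a : ℂ} (ha : a ≠ 0) (x y f h : ℂ) (k : ℤ) (n : ℕ) :
    expansionCore q a x y f h (-k) n =
      -a * expansionCore q a⁻¹ (a * x) (a * y) (f / a) (a * h) k n := by
  have hk := zpow_ne_zero k hq0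
  have hk2 := zpow_ne_zero (2 * k) hq0
  have hak := zpow_ne_zero k ha
  unfold expansionCore
  rw [biTheta_neg hq0 ha, biTheta_neg hq0 ha, biTheta_neg hq0 ha, biTheta_neg hq0 ha, neg_neg,
    show a * f⁻¹ = (f / a)⁻¹ by rw [inv_div]; ring, show f / a / a⁻¹ = f by field_simp,
    show a * (h * q ^ n) = a * h * q ^ n by ring, mul_neg, zpow_neg, zpow_neg, inv_pow,
    mul_zpow, mul_zpow, inv_zpow, ← zpow_natCast a, ← zpow_mul, mul_comm (2 : ℤ) k, zpow_mul q,
    show ((2 : ℕ) : ℤ) * k = k * 2 by push_cast; ring, zpow_mul a, zpow_ofNat, zpow_ofNat]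
  field_simp
  ring

/-- Since 2 max k n ≥ k + n, the bound separates into a product of two summable families. -/
lemma pow_max_le {ρ : ℝ} (h0 : 0 ≤ ρ) (h1 : ρ ≤ 1) (k n : ℕ) :
    ρ ^ max k n ≤ √ρ ^ k * √ρ ^ n := by
  rw [← pow_add]
  nth_rewrite 1 [← Real.sq_sqrt h0]
  rw [← pow_mul]
  exact pow_le_pow_of_le_one (Real.sqrt_nonneg _) (Real.sqrt_le_one.2 h1) (by omega)

lemma norm_expansionCoeff_le (hq : ‖q‖ < 1) (a d e f g : ℂ) :
    ∃ C > 0, ∀ n, ‖expansionCoeff q a d e f g n‖ ≤ C * ‖q‖ ^ n := by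
  obtain ⟨C, hC, hinv⟩ := exists_norm_inv_qPochInf_le hq (x := q * a * f / (d * e * g))
  have hpos := @qBound_pos q
  obtain ⟨K, hK⟩ : ∃ K, K = ‖jtheta q g * jtheta q (g / a) * qPochInf q (q * a / (d * f)) *
    qPochInf q (q * a / (e * f))‖ := ⟨_, rfl⟩
  obtain ⟨D, hD⟩ : ∃ D, D = (1 + ‖q * a * f / (d * e * g)‖) * qBound q ‖q * a / (d * e)‖ *
      qBound q ‖q * a / (d * g)‖ * qBound q ‖q * a / (e * g)‖ *
      qBound q ‖q‖ * qBound q ‖q / (g / f)‖ *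
      qBound q ‖q * f / e‖ * qBound q ‖q * f / d‖ * C := ⟨_, rfl⟩
  have hD0 : 0 < D := by
    have h1 := hpos ‖q * a / (d * e)‖
    have h2 := hpos ‖q * a / (d * g)‖
    have h3 := hpos ‖q * a / (e * g)‖
    have h4 := hpos ‖q‖
    have h5 := hpos ‖q / (g / f)‖
    have h6 := hpos ‖q * f / e‖
    have h7 := hpos ‖q * f / d‖
    rw [hD]; positivity
  refine ⟨(K + 1) * D, by rw [hK]; positivity, fun n => ?_⟩
  have hI : ∀ x n, ‖qPochInf q (x * q ^ n)‖ ≤ qBound q ‖x‖ := norm_qPochInf_mul_pow_le hq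
  have hN : ∀ x n, ‖qPochNat q x n‖ ≤ qBound q ‖x‖ := fun x n => norm_qPochNat_le hq le_rfl n
  have M : ∀ {x y : ℂ} {b c : ℝ}, ‖x‖ ≤ b → ‖y‖ ≤ c → ‖x * y‖ ≤ b * c :=
    fun h h' => norm_mul_le_of_le h h'
  rw [expansionCoeff, show q ^ (n + 1) / (g / f) = q / (g / f) * q ^ n by ring, pow_succ' q n]
  calc _ ≤ K * ‖q‖ ^ n * D := by
        rw [hD]
        exact M (M hK.ge (norm_pow q n).le) (M (M (M (M (M (M (M (M
          (norm_one_sub_mul_pow_le hq _ _) (hN _ _)) (hN _ _)) (hN _ _)) (hI _ _)) (hI _ _))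
          (hI _ _)) (hI _ _)) (hinv _))
    _ ≤ (K + 1) * ‖q‖ ^ n * D := by gcongr; linarith
    _ = _ := by ring

lemma summable_expansion (hq : ‖q‖ < 1) (hq0 : q ≠ 0) {a x y d e f g : ℂ} (ha : a ≠ 0)
    (hx : x ≠ 0) (hy : y ≠ 0) (hd : d ≠ 0) (he : e ≠ 0) (hf : f ≠ 0) (hg : g ≠ 0)
    (h1 : ‖q * a * x * y‖ < 1) (h2 : ‖q ^ 2 * a ^ 3 * x * y / (d * e * f * g)‖ < 1) :
    Summable fun p : ℤ × ℕ => expansionCoeff q a d e f g p.2 *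
      expansionCore q a x y f (q * a / (d * e * g)) p.1 p.2 := by
  set h := q * a / (d * e * g) with hh
  have hh0 : h ≠ 0 := by rw [hh]; positivity
  obtain ⟨ρ, hρ⟩ : ∃ ρ, ρ = max ‖q‖ (max ‖q * a * x * y‖ ‖q * a ^ 2 * x * y * h / f‖) := ⟨_, rfl⟩
  have e0 : ‖q‖ ≤ ρ := hρ ▸ le_max_left _ _
  have e1 : ‖q * a * x * y‖ ≤ ρ := hρ ▸ (le_max_left _ _).trans (le_max_right _ _)
  have e2 : ‖q * a ^ 2 * x * y * h / f‖ ≤ ρ := hρ ▸ (le_max_right _ _).trans (le_max_right _ _)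
  have hρ1 : ρ < 1 := by
    rw [hρ]
    refine max_lt hq (max_lt h1 (lt_of_eq_of_lt ?_ h2))
    rw [hh]; congr 1; field_simp
  have hρ0 : 0 ≤ ρ := (norm_nonneg _).trans e0
  obtain ⟨C₁, hC₁, H₁⟩ := norm_expansionCore_natCast_le hq hq0 ha hx hy hf hh0 e1 e2 e0
  obtain ⟨C₂, hC₂, H₂⟩ := norm_expansionCore_natCast_le hq hq0 (inv_ne_zero ha)
    (mul_ne_zero ha hx) (mul_ne_zero ha hy) (div_ne_zero hf ha) (mul_ne_zero ha hh0) (ρ := ρ)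
    (by convert e1 using 2; field_simp) (by convert e2 using 2; field_simp) e0
  obtain ⟨C₃, hC₃, H₃⟩ := norm_expansionCoeff_le hq a d e f g
  have hσ1 : √ρ < 1 := (Real.sqrt_lt' one_pos).2 (by simpa using hρ1)
  have hs : Summable fun p : ℤ × ℕ => √ρ ^ p.1.natAbs * √ρ ^ p.2 :=
    (summable_pow_natAbs (Real.sqrt_nonneg ρ) hσ1).mul_of_nonneg
      (summable_geometric_of_lt_one (Real.sqrt_nonneg ρ) hσ1) (fun _ => by positivity)
      (fun _ => by positivity)
  refine (hs.mul_left (C₃ * (C₁ + ‖a‖ * C₂))).of_norm_bounded fun p => ?_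
  obtain ⟨k, n⟩ := p
  have hk : ‖q‖ ^ n * ‖expansionCore q a x y f h k n‖ ≤
      (C₁ + ‖a‖ * C₂) * ρ ^ max k.natAbs n := by
    obtain ⟨m, rfl | rfl⟩ := k.eq_nat_or_neg
    · refine (H₁ m n).trans ?_
      rw [Int.natAbs_natCast]
      gcongr
      have := norm_nonneg a
      nlinarith
    · rw [expansionCore_neg hq0 ha, Int.natAbs_neg, Int.natAbs_natCast, norm_mul, norm_neg]
      calc _ = ‖a‖ * (‖q‖ ^ n * ‖expansionCore q a⁻¹ (a * x) (a * y) (f / a) (a * h) m n‖) := by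
            ring
        _ ≤ ‖a‖ * (C₂ * ρ ^ max m n) :=
            mul_le_mul_of_nonneg_left (H₂ m n) (norm_nonneg a)
        _ ≤ (C₁ + ‖a‖ * C₂) * ρ ^ max m n := by
            rw [← mul_assoc]; gcongr; linarith
  rw [norm_mul]
  calc _ ≤ C₃ * ‖q‖ ^ n * ‖expansionCore q a x y f h k n‖ := by gcongr; exact H₃ n
    _ = C₃ * (‖q‖ ^ n * ‖expansionCore q a x y f h k n‖) := by ring
    _ ≤ C₃ * ((C₁ + ‖a‖ * C₂) * (√ρ ^ k.natAbs * √ρ ^ n)) := by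
        refine mul_le_mul_of_nonneg_left (hk.trans ?_) hC₃.le
        gcongr
        exact pow_max_le hρ0 hρ1.le _ _
    _ = _ := by ring

end Interchange

/-! ### The ₈ψ₈ identity up to a factor that may vanish. -/

section EightPsiEight

variable {q : ℂ}

/-- The general term of the bilateral series `₈ψ₈`, normalised to be entire in the reciprocals
of the upper parameters. -/
noncomputable def wellPoisedEight (q a y₁ y₂ y₃ y₄ y₅ y₆ : ℂ) (k : ℤ) : ℂ :=
  (1 - a * q ^ (2 * k)) * (q ^ 2 * a ^ 3) ^ k *
    (biTheta q a y₁ k * biTheta q a y₂ k * biTheta q a y₃ k * biTheta q a y₄ k *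
      biTheta q a y₅ k * biTheta q a y₆ k)

/-- The general term of the `₈φ₇`, normalised by infinite products. -/
noncomputable def normalizedPhiTerm (q a b c d e f g : ℂ) (n : ℕ) : ℂ :=
  (1 - q * a * f / (d * e * g) * q ^ (2 * n)) * qPochNat q (q * a / (d * e)) n *
    qPochNat q (q * a / (d * g)) n * qPochNat q (q * a / (e * g)) n *
    qPochNat q (b * f / a) n * qPochNat q (c * f / a) n *
    qPochInf q (q ^ (n + 1)) * qPochInf q (q ^ (n + 1) / (g / f)) *
    qPochInf q (q * f / e * q ^ n) * qPochInf q (q * f / d * q ^ n) *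
    qPochInf q (q ^ 2 * a ^ 2 / (b * d * e * g) * q ^ n) *
    qPochInf q (q ^ 2 * a ^ 2 / (c * d * e * g) * q ^ n) *
    (qPochInf q (q * a * f / (d * e * g) * q ^ n))⁻¹ * (q * a / (b * c)) ^ n

/-- The infinite products multiplying the normalised `₈φ₇`. -/
noncomputable def normalizedPrefactor (q a b c d e f g : ℂ) : ℂ :=
  jtheta q g * jtheta q (g / a) * qPochInf q (q * a / (d * f)) * qPochInf q (q * a / (e * f)) *
    (qPochInf q q * qPochInf q a * qPochInf q (q / a)) *
    qPochInf q (q * a / (b * c)) * qPochInf q (q * a / (b * f)) * qPochInf q (q * a / (c * f))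

/-- The sum over k is a ₆ψ₆ whose products at q^(-n) turn back into (bf/a;q)_n and (cf/a;q)_n, the
last two upper parameters of the ₈φ₇. -/
lemma expansionCoeff_mul_tsum (hq : ‖q‖ < 1) (hq0 : q ≠ 0) {a b c d e f g : ℂ} (ha : a ≠ 0)
    (hb : b ≠ 0) (hc : c ≠ 0) (hd : d ≠ 0) (he : e ≠ 0) (hf : f ≠ 0) (hg : g ≠ 0)
    (hz : ‖q ^ 2 * a ^ 3 / (b * c * d * e * f * g)‖ < 1) (n : ℕ) :
    qPochInf q (q ^ 2 * a ^ 3 / (b * c * d * e * f * g)) * (expansionCoeff q a d e f g n *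
      ∑' k, expansionCore q a b⁻¹ c⁻¹ f (q * a / (d * e * g)) k n) =
    qPochInf q (q ^ 2 * a ^ 2 / (d * e * f * g)) * (normalizedPrefactor q a b c d e f g *
      normalizedPhiTerm q a b c d e f g n) := by
  have hqn := pow_ne_zero n hq0
  -- The opposite shifts cancel, so the argument of the ₆ψ₆, and with it the convergence condition,
  -- does not depend on n.
  have hzz : q * a ^ 2 * (b⁻¹ * c⁻¹ * (f⁻¹ * q ^ (-(n : ℤ))) * (q * a / (d * e * g) * q ^ n)) =
      q ^ 2 * a ^ 3 / (b * c * d * e * f * g) := by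
    rw [zpow_neg, zpow_natCast]; field_simp
  have h6 := tsum_wellPoisedSix hq hq0 ha (y₁ := b⁻¹) (y₂ := c⁻¹) (y₃ := f⁻¹ * q ^ (-(n : ℤ)))
    (y₄ := q * a / (d * e * g) * q ^ n) (by rwa [hzz])
  have hB := qPochInf_mul_zpow_neg hq hq0 (div_ne_zero (mul_ne_zero hb hf) ha) n
  have hC := qPochInf_mul_zpow_neg hq hq0 (div_ne_zero (mul_ne_zero hc hf) ha) n
  rw [hzz, show q * a * b⁻¹ * c⁻¹ = q * a / (b * c) by field_simp,
    show q * a * b⁻¹ * (f⁻¹ * q ^ (-(n : ℤ))) = q / (b * f / a) * q ^ (-(n : ℤ)) by field_simp,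
    show q * a * c⁻¹ * (f⁻¹ * q ^ (-(n : ℤ))) = q / (c * f / a) * q ^ (-(n : ℤ)) by field_simp,
    show q * a * b⁻¹ * (q * a / (d * e * g) * q ^ n) = q ^ 2 * a ^ 2 / (b * d * e * g) * q ^ n by
      field_simp,
    show q * a * c⁻¹ * (q * a / (d * e * g) * q ^ n) = q ^ 2 * a ^ 2 / (c * d * e * g) * q ^ n by
      field_simp,
    show q * a * (f⁻¹ * q ^ (-(n : ℤ))) * (q * a / (d * e * g) * q ^ n) =
      q ^ 2 * a ^ 2 / (d * e * f * g) by rw [zpow_neg, zpow_natCast]; field_simp] at h6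
  rw [show q / (b * f / a) = q * a / (b * f) by field_simp] at hB h6
  rw [show q / (c * f / a) = q * a / (c * f) by field_simp] at hC h6
  simp only [expansionCore_eq hq hq0 ha hf, tsum_mul_left]
  have hpow : (f ^ 2 / a) ^ n = (b * f / a) ^ n * (c * f / a) ^ n * (a / (b * c)) ^ n := by
    rw [← mul_pow, ← mul_pow]; congr 1; field_simp
  have hpow2 : (q * a / (b * c)) ^ n = q ^ n * (a / (b * c)) ^ n := by
    rw [← mul_pow]; congr 1; ring
  have h1 : ((-1 : ℂ) ^ n) * (-1) ^ n = 1 := by rw [← mul_pow]; simp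
  unfold normalizedPhiTerm normalizedPrefactor expansionCoeff
  rw [hpow, hpow2]
  generalize qPochInf q (q * a / (b * f) * q ^ (-(n : ℤ))) = v₁ at *
  generalize qPochInf q (q * a / (c * f) * q ^ (-(n : ℤ))) = v₂ at *
  generalize qPochInf q (q * a / (b * f)) = w₁ at *
  generalize qPochInf q (q * a / (c * f)) = w₂ at *
  generalize qPochNat q (b * f / a) n = m₁ at *
  generalize qPochNat q (c * f / a) n = m₂ at *
  generalize (b * f / a) ^ n = z₁ at *
  generalize (c * f / a) ^ n = z₂ at *
  generalize (a / (b * c)) ^ n = z₃ at *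
  generalize q ^ tri n = t at *
  generalize q ^ n = Y at *
  generalize (-1 : ℂ) ^ n = s at *
  have hBC : (w₁ * m₁) * (w₂ * m₂) = t ^ 2 * z₁ * z₂ * v₁ * v₂ := by
    rw [hB, hC]; linear_combination t ^ 2 * z₁ * z₂ * v₁ * v₂ * h1
  generalize ∑' k, wellPoisedSix q a b⁻¹ c⁻¹ _ _ k = U at *
  generalize qPochInf q (q ^ 2 * a ^ 3 / (b * c * d * e * f * g)) = p₁ at *
  generalize qPochInf q (q ^ 2 * a ^ 2 / (d * e * f * g)) = p₂ at *
  generalize qPochInf q (q ^ 2 * a ^ 2 / (b * d * e * g) * Y) = p₃ at *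
  generalize qPochInf q (q ^ 2 * a ^ 2 / (c * d * e * g) * Y) = p₄ at *
  generalize jtheta q g = p₅ at *
  generalize jtheta q (g / a) = p₆ at *
  generalize qPochInf q (q * a / (d * f)) = p₇ at *
  generalize qPochInf q (q * a / (e * f)) = p₈ at *
  generalize qPochInf q (q * a / (b * c)) = p₉ at *
  generalize (qPochInf q (q * a * f / (d * e * g) * Y))⁻¹ = u₅
  generalize qPochInf q (q ^ (n + 1)) = u₆
  generalize qPochInf q (q ^ (n + 1) / (g / f)) = u₇
  generalize qPochInf q (q * f / e * Y) = u₈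
  generalize qPochInf q (q * f / d * Y) = u₉
  generalize (1 - q * a * f / (d * e * g) * q ^ (2 * n)) = u₁₂
  generalize qPochNat q (q * a / (d * e)) n = u₁₄
  generalize qPochNat q (q * a / (d * g)) n = u₁₅
  generalize qPochNat q (q * a / (e * g)) n = u₁₆
  generalize qPochInf q q * qPochInf q a * qPochInf q (q / a) = u₁₇ at *
  linear_combination (p₅ * p₆ * p₇ * p₈ * Y * u₅ * u₆ * u₇ * u₈ * u₉ * u₁₂ * u₁₄ * u₁₅ * u₁₆ *
    z₃) * (t ^ 2 * z₁ * z₂ * h6 - p₂ * p₃ * p₄ * p₉ * u₁₇ * hBC)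

lemma outerFactor_symm (a x y f g : ℂ) (k : ℤ) :
    outerFactor q a x y f g k = outerFactor q a x y g f k := by
  unfold outerFactor; ring

/-- Evaluate Jackson's sum: of the six pairwise products, four restore the factors of d and e, and
the other two are constants in k. -/
lemma outerFactor_mul_jacksonSum (hq : ‖q‖ < 1) (hq0 : q ≠ 0) {a b c d e f g : ℂ} (ha : a ≠ 0)
    (hd : d ≠ 0) (he : e ≠ 0) (hf : f ≠ 0) (hg : g ≠ 0)
    (hl : QNonzero q (q * a * f / (d * e * g))) (hl' : QNonzero q (q * a * g / (d * e * f)))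
    (k : ℤ) :
    outerFactor q a b⁻¹ c⁻¹ f g k * jacksonSum q (g / f) (q * a / (d * g)) (q * a / (e * g))
      (f * q ^ k) (f / a * q ^ (-k)) =
    qPochInf q (q ^ 2 * a ^ 2 / (d * e * f * g)) * (qPochInf q (f * g / a) *
      -(qPochInf q q * qPochInf q (g / f) * qPochInf q (q / (g / f)))) *
      wellPoisedEight q a b⁻¹ c⁻¹ d⁻¹ e⁻¹ f⁻¹ g⁻¹ k := by
  have hk := zpow_ne_zero k hq0
  have h1 : ((-1 : ℂ) ^ k) * (-1) ^ k = 1 := by rw [← mul_zpow]; simp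
  rw [jacksonSum_eq hq hq0 (div_ne_zero hg hf)
    (by convert hl using 1; rw [zpow_neg]; field_simp)
    (by convert hl' using 1; rw [zpow_neg]; field_simp),
    show q * a / (d * g) * (q * a / (e * g)) * (g / f) = q ^ 2 * a ^ 2 / (d * e * f * g) by
      field_simp,
    show q * a / (d * g) * (f * q ^ k) * (g / f) = a * d⁻¹ * q ^ (k + 1) by
      rw [zpow_add_one₀ hq0]; field_simp,
    show q * a / (e * g) * (f * q ^ k) * (g / f) = a * e⁻¹ * q ^ (k + 1) by
      rw [zpow_add_one₀ hq0]; field_simp,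
    show q * a / (d * g) * (f / a * q ^ (-k)) * (g / f) = d⁻¹ * q ^ (1 - k) by
      rw [zpow_sub₀ hq0, zpow_neg]; field_simp,
    show q * a / (e * g) * (f / a * q ^ (-k)) * (g / f) = e⁻¹ * q ^ (1 - k) by
      rw [zpow_sub₀ hq0, zpow_neg]; field_simp,
    show f * q ^ k * (f / a * q ^ (-k)) * (g / f) = f * g / a by
      rw [zpow_neg]; field_simp]
  unfold outerFactor wellPoisedEight
  have hd' : biTheta q a d⁻¹ k = (-1) ^ k * q ^ tri k *
    (qPochInf q (a * d⁻¹ * q ^ (k + 1)) * qPochInf q (d⁻¹ * q ^ (1 - k))) := rfl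
  have he' : biTheta q a e⁻¹ k = (-1) ^ k * q ^ tri k *
    (qPochInf q (a * e⁻¹ * q ^ (k + 1)) * qPochInf q (e⁻¹ * q ^ (1 - k))) := rfl
  rw [hd', he']
  generalize qPochInf q (a * d⁻¹ * q ^ (k + 1)) = p₁
  generalize qPochInf q (a * e⁻¹ * q ^ (k + 1)) = p₂
  generalize qPochInf q (d⁻¹ * q ^ (1 - k)) = p₃
  generalize qPochInf q (e⁻¹ * q ^ (1 - k)) = p₄
  generalize qPochInf q (q ^ 2 * a ^ 2 / (d * e * f * g)) = p₅
  generalize qPochInf q (f * g / a) = p₆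
  generalize qPochInf q q * qPochInf q (g / f) * qPochInf q (q / (g / f)) = p₇
  generalize 1 - a * q ^ (2 * k) = p₈
  generalize (-1 : ℂ) ^ k = s at *
  linear_combination (p₁ * p₂ * p₃ * p₄ * p₅ * p₆ * p₇ * p₈ * (q ^ 2 * a ^ 3) ^ k *
    (q ^ tri k) ^ 2 * biTheta q a b⁻¹ k * biTheta q a c⁻¹ k * biTheta q a f⁻¹ k *
    biTheta q a g⁻¹ k) * h1

lemma outerFactor_mul_tsum (hq : ‖q‖ < 1) (hq0 : q ≠ 0) {a b c d e f g : ℂ} (ha : a ≠ 0)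
    (hd : d ≠ 0) (he : e ≠ 0) (hf : f ≠ 0) (hg : g ≠ 0) (k : ℤ) :
    outerFactor q a b⁻¹ c⁻¹ f g k * jacksonSum q (g / f) (q * a / (d * g)) (q * a / (e * g))
      (f * q ^ k) (f / a * q ^ (-k)) =
    g / f * ∑' n, expansionCoeff q a d e g f n *
        expansionCore q a b⁻¹ c⁻¹ g (q * a / (d * e * f)) k n -
      ∑' n, expansionCoeff q a d e f g n *
        expansionCore q a b⁻¹ c⁻¹ f (q * a / (d * e * g)) k n := by
  simp only [jacksonSum]
  rw [show q * a / (d * g) * (g / f) = q * a / (d * f) by field_simp,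
    show q * a / (e * g) * (g / f) = q * a / (e * f) by field_simp,
    show f * q ^ k * (g / f) = g * q ^ k by field_simp,
    show f / a * q ^ (-k) * (g / f) = g / a * q ^ (-k) by field_simp, inv_div]
  have h1 : outerFactor q a b⁻¹ c⁻¹ f g k * ∑' n, jacksonTerm q (g / f) (q * a / (d * g))
      (q * a / (e * g)) (f * q ^ k) (f / a * q ^ (-k)) n =
      ∑' n, expansionCoeff q a d e f g n *
        expansionCore q a b⁻¹ c⁻¹ f (q * a / (d * e * g)) k n := by
    rw [← tsum_mul_left]
    exact tsum_congr fun n => outerFactor_mul_jacksonTerm hq hq0 ha hd he hf hg _ _ k n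
  have h2 : outerFactor q a b⁻¹ c⁻¹ f g k * ∑' n, jacksonTerm q (f / g) (q * a / (d * f))
      (q * a / (e * f)) (g * q ^ k) (g / a * q ^ (-k)) n =
      ∑' n, expansionCoeff q a d e g f n *
        expansionCore q a b⁻¹ c⁻¹ g (q * a / (d * e * f)) k n := by
    rw [← tsum_mul_left, outerFactor_symm]
    exact tsum_congr fun n => outerFactor_mul_jacksonTerm hq hq0 ha hd he hg hf _ _ k n
  rw [← h1, ← h2]
  ring

/-- The identity between the bilateral series and two unilateral ones, multiplied by a factor
which vanishes for exceptional parameters. -/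
lemma wellPoisedEight_identity_mul (hq : ‖q‖ < 1) (hq0 : q ≠ 0) {a b c d e f g : ℂ} (ha : a ≠ 0)
    (hb : b ≠ 0) (hc : c ≠ 0) (hd : d ≠ 0) (he : e ≠ 0) (hf : f ≠ 0) (hg : g ≠ 0)
    (hl : QNonzero q (q * a * f / (d * e * g))) (hl' : QNonzero q (q * a * g / (d * e * f)))
    (hz : ‖q ^ 2 * a ^ 3 / (b * c * d * e * f * g)‖ < 1) (hbc : ‖q * a / (b * c)‖ < 1) :
    qPochInf q (q ^ 2 * a ^ 2 / (d * e * f * g)) *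
      (qPochInf q (q ^ 2 * a ^ 3 / (b * c * d * e * f * g)) * (qPochInf q (f * g / a) *
        -(qPochInf q q * qPochInf q (g / f) * qPochInf q (q / (g / f)))) *
        ∑' k, wellPoisedEight q a b⁻¹ c⁻¹ d⁻¹ e⁻¹ f⁻¹ g⁻¹ k) =
    qPochInf q (q ^ 2 * a ^ 2 / (d * e * f * g)) *
      (g / f * (normalizedPrefactor q a b c d e g f * ∑' n, normalizedPhiTerm q a b c d e g f n) -
        normalizedPrefactor q a b c d e f g * ∑' n, normalizedPhiTerm q a b c d e f g n) := by
  have hb' := inv_ne_zero hb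
  have hc' := inv_ne_zero hc
  have hxy : ‖q * a * b⁻¹ * c⁻¹‖ < 1 := by
    rwa [show q * a * b⁻¹ * c⁻¹ = q * a / (b * c) by field_simp]
  have hs := summable_expansion hq hq0 ha hb' hc' hd he hf hg hxy (by
    rwa [show q ^ 2 * a ^ 3 * b⁻¹ * c⁻¹ / (d * e * f * g) =
      q ^ 2 * a ^ 3 / (b * c * d * e * f * g) by field_simp])
  have hs' := summable_expansion hq hq0 ha hb' hc' hd he hg hf hxy (by
    rwa [show q ^ 2 * a ^ 3 * b⁻¹ * c⁻¹ / (d * e * g * f) =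
      q ^ 2 * a ^ 3 / (b * c * d * e * f * g) by field_simp])
  have hz' : ‖q ^ 2 * a ^ 3 / (b * c * d * e * g * f)‖ < 1 := by
    rwa [mul_right_comm (b * c * d * e)]
  have inner := fun n => expansionCoeff_mul_tsum hq hq0 ha hb hc hd he hf hg hz n
  have inner' := fun n => expansionCoeff_mul_tsum hq hq0 ha hb hc hd he hg hf hz' n
  rw [mul_right_comm (b * c * d * e), mul_right_comm (d * e)] at inner'
  have outer := fun k => (outerFactor_mul_jacksonSum hq hq0 (b := b) (c := c) ha hd he hf
    hg hl hl' k).symm.trans (outerFactor_mul_tsum hq hq0 ha hd he hf hg k)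
  have hsum := congrArg (fun F : ℤ → ℂ => ∑' k, F k) (funext outer)
  rw [tsum_mul_left, (hs'.prod.mul_left _).tsum_sub hs.prod, tsum_mul_left] at hsum
  simp only at hsum
  -- Interchange of the sums, so that the bilateral one becomes the inner sum.
  rw [← hs.tsum_comm (f := fun k n => expansionCoeff q a d e f g n *
        expansionCore q a b⁻¹ c⁻¹ f (q * a / (d * e * g)) k n),
    ← hs'.tsum_comm (f := fun k n => expansionCoeff q a d e g f n *
        expansionCore q a b⁻¹ c⁻¹ g (q * a / (d * e * f)) k n)] at hsum
  simp only [tsum_mul_left] at hsum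
  have s1 := congrArg (fun F : ℕ → ℂ => ∑' n, F n) (funext inner)
  have s2 := congrArg (fun F : ℕ → ℂ => ∑' n, F n) (funext inner')
  simp only [tsum_mul_left] at s1 s2
  linear_combination qPochInf q (q ^ 2 * a ^ 3 / (b * c * d * e * f * g)) * hsum + g / f * s2 - s1

end EightPsiEight

/-! ### Removal of the vanishing factor by scaling f and g. -/

section Continuity

variable {q : ℂ}

lemma norm_wellPoisedEight_le (hq : ‖q‖ < 1) (hq0 : q ≠ 0) {a : ℂ} (ha : a ≠ 0)
    {R : Fin 6 → ℝ} (hR : ∀ i, 0 < R i) (h : ‖q ^ 2 * a ^ 3‖ * ∏ i, R i < 1) :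
    ∃ bound : ℤ → ℝ, Summable bound ∧ ∀ y₁ y₂ y₃ y₄ y₅ y₆ : ℂ, ‖y₁‖ ≤ R 0 → ‖y₂‖ ≤ R 1 →
      ‖y₃‖ ≤ R 2 → ‖y₄‖ ≤ R 3 → ‖y₅‖ ≤ R 4 → ‖y₆‖ ≤ R 5 → ∀ k : ℤ,
      ‖wellPoisedEight q a y₁ y₂ y₃ y₄ y₅ y₆ k‖ ≤ bound k := by
  set ρ := ‖q ^ 2 * a ^ 3‖ * ∏ i, R i with hρ
  have hP : 0 < ∏ i, R i := prod_pos fun i _ => hR i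
  have hq' : 0 < ‖q‖ := norm_pos_iff.2 hq0
  have ha' : 0 < ‖a‖ := norm_pos_iff.2 ha
  have hsq : ‖q‖ ^ 2 ≤ 1 := pow_le_one₀ hq'.le hq.le
  obtain ⟨C₁, hC₁, H₁⟩ := norm_zpow_mul_prod_biTheta_le hq hq0 (w := q ^ 2 * a ^ 3) ha hR (ρ := ρ)
    le_rfl (by
      rw [hρ]; gcongr
      simp only [norm_mul, norm_pow]
      calc _ = ‖q‖ ^ 2 * (‖q‖ ^ 2 * ‖a‖ ^ 3) := by field_simp
        _ ≤ 1 * (‖q‖ ^ 2 * ‖a‖ ^ 3) := by gcongr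
        _ = _ := one_mul _)
  obtain ⟨C₂, hC₂, H₂⟩ := norm_zpow_mul_prod_biTheta_le hq hq0 (w := q ^ 2 * a ^ 3 * q ^ 2) ha hR
    (ρ := ρ) (by
      rw [hρ, norm_mul _ (q ^ 2), norm_pow]; gcongr
      calc _ ≤ ‖q ^ 2 * a ^ 3‖ * 1 := by gcongr
        _ = _ := mul_one _) (by
      rw [hρ]; gcongr
      simp only [norm_mul, norm_pow]
      exact le_of_eq (by field_simp))
  refine ⟨fun k => (C₁ + ‖a‖ * C₂) * ρ ^ k.natAbs,
    (summable_pow_natAbs (by positivity) h).mul_left _,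
    fun y₁ y₂ y₃ y₄ y₅ y₆ hy₁ hy₂ hy₃ hy₄ hy₅ hy₆ k => ?_⟩
  obtain ⟨y, rfl, rfl, rfl, rfl, rfl, rfl⟩ : ∃ y : Fin 6 → ℂ,
      y₁ = y 0 ∧ y₂ = y 1 ∧ y₃ = y 2 ∧ y₄ = y 3 ∧ y₅ = y 4 ∧ y₆ = y 5 :=
    ⟨![y₁, y₂, y₃, y₄, y₅, y₆], rfl, rfl, rfl, rfl, rfl, rfl⟩
  have hy : ∀ i, ‖y i‖ ≤ R i := by
    simp only [Fin.forall_fin_succ, IsEmpty.forall_iff, and_true]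
    exact ⟨hy₁, hy₂, hy₃, hy₄, hy₅, hy₆⟩
  have h1 := H₁ y hy k
  have h2 := H₂ y hy k
  have h3 : wellPoisedEight q a (y 0) (y 1) (y 2) (y 3) (y 4) (y 5) k =
      (q ^ 2 * a ^ 3) ^ k * ∏ i, biTheta q a (y i) k -
        a * ((q ^ 2 * a ^ 3 * q ^ 2) ^ k * ∏ i, biTheta q a (y i) k) := by
    rw [wellPoisedEight, Fin.prod_univ_six, mul_zpow (q ^ 2 * a ^ 3) (q ^ 2), zpow_mul q 2 k,
      zpow_ofNat]
    ring
  rw [h3]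
  refine (norm_sub_le _ _).trans ?_
  rw [norm_mul a]
  calc _ ≤ C₁ * ρ ^ k.natAbs + ‖a‖ * (C₂ * ρ ^ k.natAbs) := by gcongr
    _ = _ := by ring

/-- Scaling by t ≥ 1 only shrinks the reciprocals of f and g, so radii that work at t = 1 work for
all these t. -/
lemma exists_bound_wellPoisedEight (hq : ‖q‖ < 1) (hq0 : q ≠ 0) {a : ℂ} (ha : a ≠ 0)
    {b c d e f g : ℂ} (hz : ‖q ^ 2 * a ^ 3 / (b * c * d * e * f * g)‖ < 1) :
    ∃ bound : ℤ → ℝ, Summable bound ∧ ∀ t : ℝ, 1 ≤ t → ∀ k : ℤ,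
      ‖wellPoisedEight q a b⁻¹ c⁻¹ d⁻¹ e⁻¹ (f * t)⁻¹ (g * t)⁻¹ k‖ ≤ bound k := by
  obtain ⟨R, hR, hy, hR1⟩ := exists_radii ![b⁻¹, c⁻¹, d⁻¹, e⁻¹, f⁻¹, g⁻¹] (c := ‖q ^ 2 * a ^ 3‖) (by
    refine lt_of_eq_of_lt ?_ hz
    rw [Fin.prod_univ_six]
    simp only [← norm_mul, div_eq_mul_inv, mul_inv, Matrix.cons_val])
  obtain ⟨bound, hb, H⟩ := norm_wellPoisedEight_le hq hq0 ha hR hR1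
  refine ⟨bound, hb, fun t ht k => ?_⟩
  have hs : ∀ x : ℂ, ‖(x * t)⁻¹‖ ≤ ‖x⁻¹‖ := fun x => by
    rw [mul_inv, norm_mul, norm_inv (t : ℂ), Complex.norm_real, Real.norm_of_nonneg (by linarith)]
    exact mul_le_of_le_one_right (norm_nonneg _) (inv_le_one_of_one_le₀ ht)
  exact H _ _ _ _ _ _ (hy 0).le (hy 1).le (hy 2).le (hy 3).le ((hs f).trans (hy 4).le)
    ((hs g).trans (hy 5).le) k

lemma summable_wellPoisedEight (hq : ‖q‖ < 1) (hq0 : q ≠ 0) {a : ℂ} (ha : a ≠ 0)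
    {b c d e f g : ℂ} (hz : ‖q ^ 2 * a ^ 3 / (b * c * d * e * f * g)‖ < 1) :
    Summable (wellPoisedEight q a b⁻¹ c⁻¹ d⁻¹ e⁻¹ f⁻¹ g⁻¹) := by
  obtain ⟨bound, hb, H⟩ := exists_bound_wellPoisedEight hq hq0 ha hz
  exact hb.of_norm_bounded fun k => by simpa using H 1 le_rfl k

lemma tendsto_tsum_wellPoisedEight (hq : ‖q‖ < 1) (hq0 : q ≠ 0) {a : ℂ} (ha : a ≠ 0)
    {b c d e f g : ℂ} (hf : f ≠ 0) (hg : g ≠ 0)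
    (hz : ‖q ^ 2 * a ^ 3 / (b * c * d * e * f * g)‖ < 1) :
    Tendsto (fun t : ℝ => ∑' k, wellPoisedEight q a b⁻¹ c⁻¹ d⁻¹ e⁻¹ (f * t)⁻¹ (g * t)⁻¹ k) (𝓝[>] 1)
      (𝓝 (∑' k, wellPoisedEight q a b⁻¹ c⁻¹ d⁻¹ e⁻¹ f⁻¹ g⁻¹ k)) := by
  obtain ⟨bound, hb, H⟩ := exists_bound_wellPoisedEight hq hq0 ha hz
  refine tendsto_tsum_of_dominated_convergence hb (fun k => ?_) ?_
  · have hc := continuous_biTheta hq a k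
    have h : ContinuousAt (fun t : ℝ => wellPoisedEight q a b⁻¹ c⁻¹ d⁻¹ e⁻¹ (f * t)⁻¹ (g * t)⁻¹ k) 1 := by
      unfold wellPoisedEight
      fun_prop (disch := simp [hf, hg])
    simpa using h.tendsto.mono_left (nhdsWithin_le_nhds (s := Set.Ioi 1))
  · filter_upwards [self_mem_nhdsWithin] with t ht k
    exact H t (le_of_lt ht) k

/-- The inverted product involves f and g only through f/g, hence is independent of t; the other
products stay bounded for 1 ≤ t ≤ 2. -/
lemma exists_bound_normalizedPhiTerm (hq : ‖q‖ < 1) (a b c d e f g : ℂ) :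
    ∃ C, ∀ t : ℝ, 1 ≤ t → t ≤ 2 → ∀ n : ℕ,
      ‖normalizedPhiTerm q a b c d e (f * t) (g * t) n‖ ≤ C * ‖q * a / (b * c)‖ ^ n := by
  obtain ⟨C, hC, hinv⟩ := exists_norm_inv_qPochInf_le hq (x := q * a * f / (d * e * g))
  refine ⟨(1 + ‖q * a * f / (d * e * g)‖) * qBound q ‖q * a / (d * e)‖ *
    qBound q ‖q * a / (d * g)‖ * qBound q ‖q * a / (e * g)‖ *
    qBound q (2 * ‖b * f / a‖) * qBound q (2 * ‖c * f / a‖) *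
    qBound q ‖q‖ * qBound q ‖q / (g / f)‖ *
    qBound q (2 * ‖q * f / e‖) * qBound q (2 * ‖q * f / d‖) *
    qBound q ‖q ^ 2 * a ^ 2 / (b * d * e * g)‖ *
    qBound q ‖q ^ 2 * a ^ 2 / (c * d * e * g)‖ * C, fun t ht1 ht2 n => ?_⟩
  have ht0 : (t : ℂ) ≠ 0 := by exact_mod_cast (by linarith : t ≠ 0)
  have hnt : ‖(t : ℂ)‖ = t := by rw [Complex.norm_real, Real.norm_of_nonneg (by linarith)]
  have hup : ∀ x : ℂ, ‖x * t‖ ≤ 2 * ‖x‖ := fun x => by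
    rw [norm_mul, hnt, mul_comm]; gcongr
  have hdown : ∀ x : ℂ, ‖x / t‖ ≤ ‖x‖ := fun x => by
    rw [norm_div, hnt]; exact div_le_self (norm_nonneg _) ht1
  have hI : ∀ x n, ‖qPochInf q (x * q ^ n)‖ ≤ qBound q ‖x‖ := norm_qPochInf_mul_pow_le hq
  have hN : ∀ x n, ‖qPochNat q x n‖ ≤ qBound q ‖x‖ := fun x n => norm_qPochNat_le hq le_rfl n
  have hI2 : ∀ x n, ‖qPochInf q (x * t * q ^ n)‖ ≤ qBound q (2 * ‖x‖) := fun x n =>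
    norm_qPochInf_le hq ((norm_mul_pow_le hq _ n).trans (hup x))
  have hI3 : ∀ x n, ‖qPochInf q (x / t * q ^ n)‖ ≤ qBound q ‖x‖ := fun x n =>
    norm_qPochInf_le hq ((norm_mul_pow_le hq _ n).trans (hdown x))
  have hN2 : ∀ x n, ‖qPochNat q (x * t) n‖ ≤ qBound q (2 * ‖x‖) := fun x n =>
    norm_qPochNat_le hq (hup x) n
  have hN3 : ∀ x n, ‖qPochNat q (x / t) n‖ ≤ qBound q ‖x‖ := fun x n =>
    norm_qPochNat_le hq (hdown x) n
  have M : ∀ {x y : ℂ} {b c : ℝ}, ‖x‖ ≤ b → ‖y‖ ≤ c → ‖x * y‖ ≤ b * c :=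
    fun h h' => norm_mul_le_of_le h h'
  rw [normalizedPhiTerm,
    show q * a * (f * t) / (d * e * (g * t)) = q * a * f / (d * e * g) by
      rw [← mul_assoc, ← mul_assoc, mul_div_mul_right _ _ ht0],
    show q * a / (d * (g * t)) = q * a / (d * g) / t by rw [div_div, mul_assoc],
    show q * a / (e * (g * t)) = q * a / (e * g) / t by rw [div_div, mul_assoc],
    show b * (f * t) / a = b * f / a * t by ring, show c * (f * t) / a = c * f / a * t by ring,
    show q ^ (n + 1) / (g * t / (f * t)) = q / (g / f) * q ^ n by
      rw [mul_div_mul_right _ _ ht0]; ring,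
    show q * (f * t) / e = q * f / e * t by ring, show q * (f * t) / d = q * f / d * t by ring,
    show q ^ 2 * a ^ 2 / (b * d * e * (g * t)) = q ^ 2 * a ^ 2 / (b * d * e * g) / t by
      rw [div_div, ← mul_assoc (b * d * e)],
    show q ^ 2 * a ^ 2 / (c * d * e * (g * t)) = q ^ 2 * a ^ 2 / (c * d * e * g) / t by
      rw [div_div, ← mul_assoc (c * d * e)], pow_succ' q n]
  exact M (M (M (M (M (M (M (M (M (M (M (M (M (norm_one_sub_mul_pow_le hq _ _) (hN _ _))
    (hN3 _ _)) (hN3 _ _)) (hN2 _ _)) (hN2 _ _)) (hI _ _)) (hI _ _)) (hI2 _ _)) (hI2 _ _))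
    (hI3 _ _)) (hI3 _ _)) (hinv _)) (norm_pow _ n).le

lemma summable_normalizedPhiTerm (hq : ‖q‖ < 1) {a b c : ℂ} (d e f g : ℂ)
    (hbc : ‖q * a / (b * c)‖ < 1) : Summable (normalizedPhiTerm q a b c d e f g) := by
  obtain ⟨C, hC⟩ := exists_bound_normalizedPhiTerm hq a b c d e f g
  exact ((summable_geometric_of_lt_one (norm_nonneg _) hbc).mul_left C).of_norm_bounded
    fun n => by simpa using hC 1 le_rfl one_le_two n

lemma tendsto_tsum_normalizedPhiTerm (hq : ‖q‖ < 1) {a b c d e f g : ℂ} (hb : b ≠ 0) (hc : c ≠ 0)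
    (hd : d ≠ 0) (he : e ≠ 0) (hf : f ≠ 0) (hg : g ≠ 0)
    (hl : QNonzero q (q * a * f / (d * e * g))) (hbc : ‖q * a / (b * c)‖ < 1) :
    Tendsto (fun t : ℝ => ∑' n, normalizedPhiTerm q a b c d e (f * t) (g * t) n) (𝓝[>] 1)
      (𝓝 (∑' n, normalizedPhiTerm q a b c d e f g n)) := by
  obtain ⟨C, hC⟩ := exists_bound_normalizedPhiTerm hq a b c d e f g
  refine tendsto_tsum_of_dominated_convergence
    ((summable_geometric_of_lt_one (norm_nonneg _) hbc).mul_left C) (fun n => ?_) ?_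
  · have hcI := continuous_qPochInf hq
    have hcN := continuous_qPochNat (q := q) n
    have hP := qPochInf_ne_zero hq (hl.mul_pow n)
    have h : ContinuousAt (fun t : ℝ => normalizedPhiTerm q a b c d e (f * t) (g * t) n) 1 := by
      unfold normalizedPhiTerm
      fun_prop (disch := simp [hb, hc, hd, he, hf, hg, hP])
    simpa using h.tendsto.mono_left (nhdsWithin_le_nhds (s := Set.Ioi 1))
  · filter_upwards [Ioc_mem_nhdsGT one_lt_two] with t ht n
    exact hC t ht.1.le ht.2 n

lemma tendsto_normalizedPrefactor (hq : ‖q‖ < 1) {a b c d e f g : ℂ} (ha : a ≠ 0) (hb : b ≠ 0)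
    (hc : c ≠ 0) (hd : d ≠ 0) (he : e ≠ 0) (hf : f ≠ 0) (hg : g ≠ 0) :
    Tendsto (fun t : ℝ => normalizedPrefactor q a b c d e (f * t) (g * t)) (𝓝[>] 1)
      (𝓝 (normalizedPrefactor q a b c d e f g)) := by
  have hcI := continuous_qPochInf hq
  have h : ContinuousAt (fun t : ℝ => normalizedPrefactor q a b c d e (f * t) (g * t)) 1 := by
    unfold normalizedPrefactor jtheta
    fun_prop (disch := simp [ha, hb, hc, hd, he, hf, hg])
  simpa using h.tendsto.mono_left (nhdsWithin_le_nhds (s := Set.Ioi 1))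

/-- Zeros of (w;q)_∞ are powers of 1/q. If w and w/t² were both zeros, t² would be the modulus of a
power of q, which is impossible for 1 < t² < 1/‖q‖. -/
lemma eventually_qPochInf_div_sq_ne_zero (hq : ‖q‖ < 1) (hq0 : q ≠ 0) {w : ℂ}
    (hw : qPochInf q w = 0) : ∀ᶠ t : ℝ in 𝓝[>] 1, qPochInf q (w / t ^ 2) ≠ 0 := by
  have hq' : 0 < ‖q‖ := norm_pos_iff.2 hq0
  obtain ⟨j, hj⟩ : ∃ j : ℕ, 1 - w * q ^ j = 0 := by
    by_contra! h
    exact qPochInf_ne_zero hq h hw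
  have hev : ∀ᶠ t : ℝ in 𝓝[>] 1, t ^ 2 * ‖q‖ < 1 := by
    have hcont : Continuous fun t : ℝ => t ^ 2 * ‖q‖ := by fun_prop
    exact ((hcont.tendsto 1).eventually_lt_const (by simpa using hq)).filter_mono nhdsWithin_le_nhds
  filter_upwards [hev, self_mem_nhdsWithin] with t ht1 ht2
  have ht2 : 1 < t := ht2
  refine qPochInf_ne_zero hq fun n hn => ?_
  have ht0 : (t : ℂ) ≠ 0 := by exact_mod_cast (by linarith : t ≠ 0)
  have h1 : (t : ℂ) ^ 2 * q ^ j = q ^ n := by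
    field_simp at hn
    linear_combination q ^ j * hn - q ^ n * hj
  have h2 : t ^ 2 * ‖q‖ ^ j = ‖q‖ ^ n := by
    have := congrArg norm h1
    rwa [norm_mul, norm_pow, norm_pow, norm_pow, Complex.norm_real,
      Real.norm_of_nonneg (by linarith)] at this
  have h3 : ‖q‖ ^ j < ‖q‖ ^ n := by
    rw [← h2]
    exact lt_mul_of_one_lt_left (by positivity) (one_lt_pow₀ ht2 two_ne_zero)
  have h4 : ‖q‖ ^ (n + 1) < ‖q‖ ^ j := by
    rw [pow_succ, ← h2, mul_right_comm]
    exact mul_lt_of_lt_one_left (by positivity) ht1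
  have h5 := (pow_lt_pow_iff_right_of_lt_one₀ hq' hq).1 h3
  have h6 := (pow_lt_pow_iff_right_of_lt_one₀ hq' hq).1 h4
  omega

/-- The `₈ψ₈` series as a combination of two `₈φ₇` series, in a form free of denominators. -/
theorem wellPoisedEight_identity (hq : ‖q‖ < 1) (hq0 : q ≠ 0) {a b c d e f g : ℂ} (ha : a ≠ 0)
    (hb : b ≠ 0) (hc : c ≠ 0) (hd : d ≠ 0) (he : e ≠ 0) (hf : f ≠ 0) (hg : g ≠ 0)
    (hl : QNonzero q (q * a * f / (d * e * g))) (hl' : QNonzero q (q * a * g / (d * e * f)))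
    (hz : ‖q ^ 2 * a ^ 3 / (b * c * d * e * f * g)‖ < 1) (hbc : ‖q * a / (b * c)‖ < 1) :
    qPochInf q (q ^ 2 * a ^ 3 / (b * c * d * e * f * g)) * (qPochInf q (f * g / a) *
        -(qPochInf q q * qPochInf q (g / f) * qPochInf q (q / (g / f)))) *
        ∑' k, wellPoisedEight q a b⁻¹ c⁻¹ d⁻¹ e⁻¹ f⁻¹ g⁻¹ k =
    g / f * (normalizedPrefactor q a b c d e g f * ∑' n, normalizedPhiTerm q a b c d e g f n) -
        normalizedPrefactor q a b c d e f g * ∑' n, normalizedPhiTerm q a b c d e f g n := by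
  -- If the common factor vanishes, replacing f, g by ft, gt divides its argument by t² and makes it
  -- nonzero for t > 1 near 1, while g/f and the leading parameters of the two unilateral series
  -- stay fixed.
  by_cases hw : qPochInf q (q ^ 2 * a ^ 2 / (d * e * f * g)) = 0
  swap
  · exact mul_left_cancel₀ hw
      (wellPoisedEight_identity_mul hq hq0 ha hb hc hd he hf hg hl hl' hz hbc)
  have hcI := continuous_qPochInf hq
  have hL : Tendsto (fun t : ℝ => qPochInf q (q ^ 2 * a ^ 3 / (b * c * d * e * (f * t) * (g * t))) *
      (qPochInf q (f * t * (g * t) / a) *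
        -(qPochInf q q * qPochInf q (g * t / (f * t)) * qPochInf q (q / (g * t / (f * t))))) *
        ∑' k, wellPoisedEight q a b⁻¹ c⁻¹ d⁻¹ e⁻¹ (f * t)⁻¹ (g * t)⁻¹ k) (𝓝[>] 1)
      (𝓝 (qPochInf q (q ^ 2 * a ^ 3 / (b * c * d * e * f * g)) * (qPochInf q (f * g / a) *
        -(qPochInf q q * qPochInf q (g / f) * qPochInf q (q / (g / f)))) *
        ∑' k, wellPoisedEight q a b⁻¹ c⁻¹ d⁻¹ e⁻¹ f⁻¹ g⁻¹ k)) := by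
    refine Tendsto.mul ?_ (tendsto_tsum_wellPoisedEight hq hq0 ha hf hg hz)
    have h : ContinuousAt (fun t : ℝ => qPochInf q (q ^ 2 * a ^ 3 / (b * c * d * e * (f * t) *
        (g * t))) * (qPochInf q (f * t * (g * t) / a) *
        -(qPochInf q q * qPochInf q (g * t / (f * t)) * qPochInf q (q / (g * t / (f * t)))))) 1 := by
      fun_prop (disch := simp [hb, hc, hd, he, hf, hg])
    simpa using h.tendsto.mono_left (nhdsWithin_le_nhds (s := Set.Ioi 1))
  have hR := (((tendsto_normalizedPrefactor hq ha hb hc hd he hg hf).mul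
    (tendsto_tsum_normalizedPhiTerm hq hb hc hd he hg hf hl' hbc)).const_mul (g / f)).sub
    ((tendsto_normalizedPrefactor hq ha hb hc hd he hf hg).mul
      (tendsto_tsum_normalizedPhiTerm hq hb hc hd he hf hg hl hbc))
  refine tendsto_nhds_unique hL (hR.congr' ?_)
  filter_upwards [eventually_qPochInf_div_sq_ne_zero hq hq0 hw, self_mem_nhdsWithin] with t ht ht1
  have ht1 : 1 < t := ht1
  have ht0 : (t : ℂ) ≠ 0 := by exact_mod_cast (by linarith : t ≠ 0)
  have hne : q ^ 2 * a ^ 2 / (d * e * (f * t) * (g * t)) = q ^ 2 * a ^ 2 / (d * e * f * g) / t ^ 2 := by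
    field_simp
  have hzt : q ^ 2 * a ^ 3 / (b * c * d * e * (f * t) * (g * t)) =
      q ^ 2 * a ^ 3 / (b * c * d * e * f * g) / t ^ 2 := by field_simp
  have h := wellPoisedEight_identity_mul hq hq0 ha hb hc hd he (mul_ne_zero hf ht0)
    (mul_ne_zero hg ht0) (by convert hl using 1; field_simp) (by convert hl' using 1; field_simp)
    (by
      rw [hzt, norm_div, norm_pow, Complex.norm_real, Real.norm_of_nonneg (by linarith)]
      exact (div_le_self (norm_nonneg _) (one_le_pow₀ ht1.le)).trans_lt hz) hbc
  rw [hne] at h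
  rw [mul_left_cancel₀ ht h, mul_div_mul_right _ _ ht0]

end Continuity

/-! ### From q-shifted factorials with integer index to the entire factors. -/

lemma Int.eq_natCast_or_eq_neg_add_one (k : ℤ) :
    (∃ n : ℕ, k = n) ∨ ∃ n : ℕ, k = -((n : ℤ) + 1) := by
  rcases le_or_gt 0 k with h | h
  · exact Or.inl ⟨k.toNat, by omega⟩
  · exact Or.inr ⟨(-k - 1).toNat, by omega⟩

section Translation

variable {q : ℂ}

lemma qPoch_natCast (x : ℂ) (n : ℕ) : qPoch q x n = qPochNat q x n := rfl

@[simp] lemma qPoch_zero (x : ℂ) : qPoch q x 0 = 1 := by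
  simpa using qPoch_natCast (q := q) x 0

lemma qPoch_neg_natCast (x : ℂ) (n : ℕ) :
    qPoch q x (-n) = (∏ i ∈ range n, (1 - x * q ^ (-((i : ℤ) + 1))))⁻¹ := by
  cases n with
  | zero => simp
  | succ m => rfl

lemma QNonzero.one_sub_mul_zpow_ne_zero (hq0 : q ≠ 0) {x : ℂ} (hx0 : x ≠ 0)
    (hx : QNonzero q (q / x)) (n : ℕ) : 1 - x * q ^ (-((n : ℤ) + 1)) ≠ 0 := fun h => hx n (by
  have hqn := pow_ne_zero n hq0
  rw [zpow_neg, zpow_add_one₀ hq0, zpow_natCast] at h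
  field_simp at h ⊢
  linear_combination -h)

lemma qPoch_succ (hq0 : q ≠ 0) {x : ℂ} (hx0 : x ≠ 0) (hx : QNonzero q (q / x)) (k : ℤ) :
    qPoch q x (k + 1) = qPoch q x k * (1 - x * q ^ k) := by
  obtain ⟨n, rfl⟩ | ⟨n, rfl⟩ := Int.eq_natCast_or_eq_neg_add_one k
  · exact_mod_cast qPochNat_succ x n
  · have := hx.one_sub_mul_zpow_ne_zero hq0 hx0 n
    rw [show -((n : ℤ) + 1) + 1 = -n by ring, qPoch_neg_natCast,
      show -((n : ℤ) + 1) = -((n + 1 : ℕ) : ℤ) by push_cast; rfl, qPoch_neg_natCast,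
      prod_range_succ, mul_inv]
    push_cast
    rw [inv_mul_cancel_right₀ this]

/-- For k < 0 the inverse of (x;q)_k is the finite product itself, even when that vanishes, because
`0⁻¹ = 0`. Hence only the factors with nonnegative powers of q must be nonzero. -/
lemma inv_qPoch_eq {x : ℂ} (hx : QNonzero q x) (k : ℤ) :
    (qPoch q x k)⁻¹ = (1 - x * q ^ k) * (qPoch q x (k + 1))⁻¹ := by
  obtain ⟨n, rfl⟩ | ⟨n, rfl⟩ := Int.eq_natCast_or_eq_neg_add_one k
  · have h : qPoch q x ((n : ℤ) + 1) = qPochNat q x n * (1 - x * q ^ n) := by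
      exact_mod_cast qPochNat_succ x n
    rw [h, qPoch_natCast, zpow_natCast, mul_inv_rev, mul_inv_cancel_left₀ (hx n)]
  · rw [show -((n : ℤ) + 1) + 1 = -n by ring, qPoch_neg_natCast,
      show -((n : ℤ) + 1) = -((n + 1 : ℕ) : ℤ) by push_cast; rfl, qPoch_neg_natCast,
      prod_range_succ, inv_inv, inv_inv, mul_comm]
    push_cast
    rfl

lemma qPoch_ne_zero (hq0 : q ≠ 0) {x : ℂ} (hx0 : x ≠ 0) (hx : QNonzero q x)
    (hx' : QNonzero q (q / x)) (k : ℤ) : qPoch q x k ≠ 0 := by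
  obtain ⟨n, rfl | rfl⟩ := k.eq_nat_or_neg
  · exact qPochNat_ne_zero hx n
  · rw [qPoch_neg_natCast]
    exact inv_ne_zero (prod_ne_zero_iff.2 fun i _ => hx'.one_sub_mul_zpow_ne_zero hq0 hx0 i)

/-- A quotient `(x;q)_k / (y;q)_k` is determined by its recurrence. -/
lemma qPoch_div_qPoch_eq (hq0 : q ≠ 0) {x y : ℂ} (hx0 : x ≠ 0) (hx : QNonzero q (q / x))
    (hy : QNonzero q y) {G : ℤ → ℂ} (h0 : G 0 = 1)
    (hG : ∀ k, (1 - y * q ^ k) * G (k + 1) = (1 - x * q ^ k) * G k) (k : ℤ) :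
    qPoch q x k / qPoch q y k = G k := by
  have hF : ∀ k, (1 - y * q ^ k) * (qPoch q x (k + 1) / qPoch q y (k + 1)) =
      (1 - x * q ^ k) * (qPoch q x k / qPoch q y k) := fun k => by
    rw [qPoch_succ hq0 hx0 hx, div_eq_mul_inv _ (qPoch q y k), inv_qPoch_eq hy k]
    ring
  induction k using Int.induction_on with
  | zero => simp [h0]
  | succ n hn =>
    -- Going up cancels 1 - y q^k, going down cancels 1 - x q^k: these are the two nonvanishing
    -- conditions, and zeros of the other factors are allowed.
    refine mul_left_cancel₀ (by exact_mod_cast hy n : 1 - y * q ^ (n : ℤ) ≠ 0) ?_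
    rw [hF, hG, hn]
  | pred n hn =>
    have h : 1 - x * q ^ (-(n : ℤ) - 1) ≠ 0 := by
      rw [show -(n : ℤ) - 1 = -((n : ℤ) + 1) by ring]
      exact hx.one_sub_mul_zpow_ne_zero hq0 hx0 n
    refine mul_left_cancel₀ h ?_
    rw [← hF, ← hG, sub_add_cancel, hn]

lemma qPoch_div_qPoch_q_mul (hq0 : q ≠ 0) {s : ℂ} (hs0 : s ≠ 0) (hs : QNonzero q s)
    (hs' : QNonzero q (q / (q * s))) (k : ℤ) :
    qPoch q (q * s) k / qPoch q s k = (1 - s * q ^ k) / (1 - s) := by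
  have h1 : 1 - s ≠ 0 := by simpa using hs 0
  refine qPoch_div_qPoch_eq hq0 (mul_ne_zero hq0 hs0) hs' hs
    (G := fun k => (1 - s * q ^ k) / (1 - s)) (by simp [h1]) (fun k => ?_) k
  rw [zpow_add_one₀ hq0]
  ring

lemma qPoch_div_qPoch_neg (hq0 : q ≠ 0) {s a : ℂ} (hsa : s ^ 2 = a) (ha : a ≠ 0)
    (h₁ : QNonzero q s) (h₂ : QNonzero q (-s)) (h₃ : QNonzero q (q / (q * s)))
    (h₄ : QNonzero q (q / -(q * s))) (k : ℤ) :
    qPoch q (q * s) k / qPoch q s k * (qPoch q (-(q * s)) k / qPoch q (-s) k) =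
      (1 - a * q ^ (2 * k)) / (1 - a) := by
  have hs0 : s ≠ 0 := by rintro rfl; exact ha (by simpa using hsa.symm)
  rw [← mul_neg] at h₄ ⊢
  rw [qPoch_div_qPoch_q_mul hq0 hs0 h₁ h₃, qPoch_div_qPoch_q_mul hq0 (neg_ne_zero.2 hs0) h₂ h₄,
    div_mul_div_comm, ← hsa, mul_comm 2 k, zpow_mul, zpow_ofNat]
  congr 1 <;> ring

lemma qPoch_div_qPoch_eq_biTheta (hq : ‖q‖ < 1) (hq0 : q ≠ 0) {a b : ℂ} (hb : b ≠ 0)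
    (h₁ : QNonzero q (q / b)) (h₂ : QNonzero q (q * a / b)) (k : ℤ) :
    qPoch q b k / qPoch q (q * a / b) k =
      biTheta q a b⁻¹ k * b ^ k / (qPochInf q (q / b) * qPochInf q (q * a / b)) := by
  have h₁' := qPochInf_ne_zero hq h₁
  have h₂' := qPochInf_ne_zero hq h₂
  refine qPoch_div_qPoch_eq hq0 hb h₁ h₂ (G := fun k => biTheta q a b⁻¹ k * b ^ k /
    (qPochInf q (q / b) * qPochInf q (q * a / b))) ?_ (fun k => ?_) k
  · have h : biTheta q a b⁻¹ 0 = qPochInf q (q * a / b) * qPochInf q (q / b) := by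
      simp only [biTheta, tri]
      norm_num
      congr 2 <;> ring
    rw [h, zpow_zero, mul_one, mul_comm, div_self (mul_ne_zero h₁' h₂')]
  · have h := biTheta_succ hq hq0 a b⁻¹ k
    rw [zpow_add_one₀ hq0] at h
    rw [zpow_add_one₀ hb]
    rw [mul_div_assoc', mul_div_assoc']
    congr 1
    have h' : (b⁻¹ - q ^ k) * b = 1 - b * q ^ k := by field_simp
    rw [← h', mul_assoc, ← mul_assoc b]
    linear_combination (b ^ k * b) * h

end Translation

/-! ### Terms of the bilateral series. -/

section PsiSeries

variable {q a b c d e f g s : ℂ}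

lemma psiTerm_eight (hq : ‖q‖ < 1) (hq0 : q ≠ 0) (ha : a ≠ 0) (hb : b ≠ 0) (hc : c ≠ 0)
    (hd : d ≠ 0) (he : e ≠ 0) (hf : f ≠ 0) (hg : g ≠ 0) (hs : s ^ 2 = a)
    (hpsi : PsiDefined [q * s, -(q * s), b, c, d, e, f, g]
      [s, -s, q * a / b, q * a / c, q * a / d, q * a / e, q * a / f, q * a / g] q) (k : ℤ) :
    psiTerm [q * s, -(q * s), b, c, d, e, f, g]
      [s, -s, q * a / b, q * a / c, q * a / d, q * a / e, q * a / f, q * a / g]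
      q (q ^ 2 * a ^ 3 / (b * c * d * e * f * g)) k =
    ((1 - a) * ((qPochInf q (q / b) * qPochInf q (q * a / b)) *
      (qPochInf q (q / c) * qPochInf q (q * a / c)) *
      (qPochInf q (q / d) * qPochInf q (q * a / d)) *
      (qPochInf q (q / e) * qPochInf q (q * a / e)) *
      (qPochInf q (q / f) * qPochInf q (q * a / f)) *
      (qPochInf q (q / g) * qPochInf q (q * a / g))))⁻¹ *
      wellPoisedEight q a b⁻¹ c⁻¹ d⁻¹ e⁻¹ f⁻¹ g⁻¹ k := by
  simp only [PsiDefined, List.forall_mem_cons] at hpsi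
  obtain ⟨⟨u₁, u₂, ub, uc, ud, ue, uf, ug, -⟩, l₁, l₂, lb, lc, ld, le, lf, lg, -⟩ := hpsi
  have hz : (q ^ 2 * a ^ 3 / (b * c * d * e * f * g)) ^ k * (b ^ k * c ^ k * d ^ k * e ^ k *
      f ^ k * g ^ k) = (q ^ 2 * a ^ 3) ^ k := by
    simp only [← mul_zpow]
    rw [div_mul_cancel₀]
    simp [*]
  calc _ = qPoch q (q * s) k / qPoch q s k * (qPoch q (-(q * s)) k / qPoch q (-s) k) *
      ((qPoch q b k / qPoch q (q * a / b) k) * (qPoch q c k / qPoch q (q * a / c) k) *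
      (qPoch q d k / qPoch q (q * a / d) k) * (qPoch q e k / qPoch q (q * a / e) k) *
      (qPoch q f k / qPoch q (q * a / f) k) * (qPoch q g k / qPoch q (q * a / g) k)) *
      (q ^ 2 * a ^ 3 / (b * c * d * e * f * g)) ^ k := by
        simp only [psiTerm, qPochList, List.map_cons, List.map_nil, List.prod_cons, List.prod_nil,
          List.length_cons, List.length_nil, sub_self, zpow_zero, mul_one, div_eq_mul_inv, mul_inv]
        ring
    _ = _ := by
      rw [qPoch_div_qPoch_neg hq0 hs ha l₁ l₂ u₁ u₂ k, qPoch_div_qPoch_eq_biTheta hq hq0 hb ub lb,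
        qPoch_div_qPoch_eq_biTheta hq hq0 hc uc lc, qPoch_div_qPoch_eq_biTheta hq hq0 hd ud ld,
        qPoch_div_qPoch_eq_biTheta hq hq0 he ue le, qPoch_div_qPoch_eq_biTheta hq hq0 hf uf lf,
        qPoch_div_qPoch_eq_biTheta hq hq0 hg ug lg, wellPoisedEight, ← hz]
      simp only [div_eq_mul_inv _ (1 - a), div_eq_mul_inv _ (qPochInf _ _ * _), mul_inv]
      ring

lemma psiTerm_six (hq : ‖q‖ < 1) (hq0 : q ≠ 0) (ha : a ≠ 0) (hb : b ≠ 0) (hc : c ≠ 0)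
    (hd : d ≠ 0) (hf : f ≠ 0) (hs : s ^ 2 = a)
    (hpsi : PsiDefined [q * s, -(q * s), b, c, d, f]
      [s, -s, q * a / b, q * a / c, q * a / d, q * a / f] q) (k : ℤ) :
    psiTerm [q * s, -(q * s), b, c, d, f]
      [s, -s, q * a / b, q * a / c, q * a / d, q * a / f] q (q * a ^ 2 / (b * c * d * f)) k =
    ((1 - a) * ((qPochInf q (q / b) * qPochInf q (q * a / b)) *
      (qPochInf q (q / c) * qPochInf q (q * a / c)) *
      (qPochInf q (q / d) * qPochInf q (q * a / d)) *
      (qPochInf q (q / f) * qPochInf q (q * a / f))))⁻¹ *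
      wellPoisedSix q a b⁻¹ c⁻¹ d⁻¹ f⁻¹ k := by
  simp only [PsiDefined, List.forall_mem_cons] at hpsi
  obtain ⟨⟨u₁, u₂, ub, uc, ud, uf, -⟩, l₁, l₂, lb, lc, ld, lf, -⟩ := hpsi
  have hz : (q * a ^ 2 / (b * c * d * f)) ^ k * (b ^ k * c ^ k * d ^ k * f ^ k) =
      (q * a ^ 2) ^ k := by
    simp only [← mul_zpow]
    rw [div_mul_cancel₀]
    simp [*]
  calc _ = qPoch q (q * s) k / qPoch q s k * (qPoch q (-(q * s)) k / qPoch q (-s) k) *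
      ((qPoch q b k / qPoch q (q * a / b) k) * (qPoch q c k / qPoch q (q * a / c) k) *
      (qPoch q d k / qPoch q (q * a / d) k) * (qPoch q f k / qPoch q (q * a / f) k)) *
      (q * a ^ 2 / (b * c * d * f)) ^ k := by
        simp only [psiTerm, qPochList, List.map_cons, List.map_nil, List.prod_cons, List.prod_nil,
          List.length_cons, List.length_nil, sub_self, zpow_zero, mul_one, div_eq_mul_inv, mul_inv]
        ring
    _ = _ := by
      rw [qPoch_div_qPoch_neg hq0 hs ha l₁ l₂ u₁ u₂ k, qPoch_div_qPoch_eq_biTheta hq hq0 hb ub lb,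
        qPoch_div_qPoch_eq_biTheta hq hq0 hc uc lc, qPoch_div_qPoch_eq_biTheta hq hq0 hd ud ld,
        qPoch_div_qPoch_eq_biTheta hq hq0 hf uf lf, wellPoisedSix, ← hz]
      simp only [div_eq_mul_inv _ (1 - a), div_eq_mul_inv _ (qPochInf _ _ * _), mul_inv]
      ring

/-- Here qa = eg, so e and g occur both as upper and as lower parameters and cancel. Their shifted
factorials are nonzero for all k because the conditions on upper and on lower parameters both apply.
-/
lemma psiTerm_eight_eq_six (hq0 : q ≠ 0) (he : e ≠ 0) (hg : g ≠ 0)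
    (hge : g = a * q / e)
    (hpsi : PsiDefined [q * s, -(q * s), b, c, d, e, f, g]
      [s, -s, q * a / b, q * a / c, q * a / d, q * a / e, q * a / f, q * a / g] q) (k : ℤ) :
    psiTerm [q * s, -(q * s), b, c, d, e, f, g]
      [s, -s, q * a / b, q * a / c, q * a / d, q * a / e, q * a / f, q * a / g]
      q (q ^ 2 * a ^ 3 / (b * c * d * e * f * g)) k =
    psiTerm [q * s, -(q * s), b, c, d, f]
      [s, -s, q * a / b, q * a / c, q * a / d, q * a / f] q (q * a ^ 2 / (b * c * d * f)) k := by
  simp only [PsiDefined, List.forall_mem_cons] at hpsi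
  obtain ⟨⟨-, -, -, -, -, ue, -, ug, -⟩, -, -, -, -, -, le, -, lg, -⟩ := hpsi
  have hqa : q * a = e * g := by rw [hge]; field_simp
  have hz : q ^ 2 * a ^ 3 / (b * c * d * e * f * g) = q * a ^ 2 / (b * c * d * f) := by
    rw [show q ^ 2 * a ^ 3 = q * a ^ 2 * (q * a) by ring, hqa,
      show b * c * d * e * f * g = b * c * d * f * (e * g) by ring,
      mul_div_mul_right _ _ (mul_ne_zero he hg)]
  have h₁ : q * a / e = g := by rw [hqa]; field_simp
  have h₂ : q * a / g = e := by rw [hqa]; field_simp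
  rw [h₁] at le
  rw [h₂] at lg
  have hE := qPoch_ne_zero hq0 he lg ue k
  have hG := qPoch_ne_zero hq0 hg le ug k
  rw [hz, h₁, h₂]
  have hEG := mul_ne_zero hE hG
  simp only [psiTerm, qPochList, List.map_cons, List.map_nil, List.prod_cons, List.prod_nil,
    List.length_cons, List.length_nil, sub_self, zpow_zero, mul_one]
  congr 1
  symm
  rw [← mul_div_mul_right _ _ hEG]
  congr 1 <;> ring

end PsiSeries

/-! ### Terms of the unilateral series and their prefactors. -/

section PhiSeries

variable {q a b c d e f g t : ℂ}

lemma phiTerm_ext (hq : ‖q‖ < 1) (hq0 : q ≠ 0) (hf : f ≠ 0) (hg : g ≠ 0)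
    (ht : t ^ 2 = q * a * f / (d * e * g)) (hl : QNonzero q (q * a * f / (d * e * g)))
    (hphi : PhiDefined (extLower q a b c d e f g t) q) (n : ℕ) :
    phiTerm (extUpper q a b c d e f g t) (extLower q a b c d e f g t) q (q * a / (b * c)) n =
    qPochInf q (q * a * f / (d * e * g)) / ((1 - q * a * f / (d * e * g)) *
      (qPochInf q q * qPochInf q (q / (g / f)) * qPochInf q (q * f / e) * qPochInf q (q * f / d) *
        qPochInf q (q ^ 2 * a ^ 2 / (b * d * e * g)) *
        qPochInf q (q ^ 2 * a ^ 2 / (c * d * e * g)))) *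
      normalizedPhiTerm q a b c d e f g n := by
  simp only [PhiDefined, extLower, List.forall_mem_cons] at hphi
  obtain ⟨h₁, h₂, h₃, h₄, h₅, h₆, h₇, -⟩ := hphi
  have hgf : q * f / g = q / (g / f) := by field_simp
  rw [hgf] at h₃
  -- Each lower parameter moves into the numerator as an infinite product, the form that the double
  -- series produces.
  have key : ∀ {x : ℂ}, QNonzero q x →
      (qPochNat q x n)⁻¹ = qPochInf q (x * q ^ n) * (qPochInf q x)⁻¹ := fun {x} hx => by
    have h := qPochInf_ne_zero hq (hx.mul_pow n)
    rw [qPochInf_eq_nat hq x n, mul_inv, mul_comm (qPochNat q x n)⁻¹, mul_inv_cancel_left₀ h]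
  have hL : qPochNat q (q * a * f / (d * e * g)) n = qPochInf q (q * a * f / (d * e * g)) *
      (qPochInf q (q * a * f / (d * e * g) * q ^ n))⁻¹ := by
    have := qPochInf_ne_zero hq (hl.mul_pow n)
    rw [qPochInf_eq_nat hq _ n, mul_inv_cancel_right₀ this]
  have hT : ∀ {x : ℂ}, QNonzero q x →
      qPochNat q (q * x) n * (qPochNat q x n)⁻¹ = (1 - x * q ^ n) * (1 - x)⁻¹ := fun {x} hx => by
    have hx0 : 1 - x ≠ 0 := by simpa using hx 0
    have h := (qPochNat_succ' (q := q) x n).symm.trans (qPochNat_succ x n)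
    rw [mul_comm x q] at h
    rw [← div_eq_mul_inv, ← div_eq_mul_inv, div_eq_div_iff (qPochNat_ne_zero hx n) hx0]
    linear_combination h
  have hTT : qPochNat q (q * t) n * (qPochNat q t n)⁻¹ *
      (qPochNat q (-(q * t)) n * (qPochNat q (-t) n)⁻¹) =
      (1 - q * a * f / (d * e * g) * q ^ (2 * n)) * (1 - q * a * f / (d * e * g))⁻¹ := by
    rw [← mul_neg, hT h₁, hT h₂, ← ht, mul_comm 2 n, pow_mul,
      show 1 - t ^ 2 = (1 - t) * (1 - -t) by ring, mul_inv]
    ring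
  calc _ = qPochNat q (q * a * f / (d * e * g)) n *
      (qPochNat q (q * t) n * (qPochNat q t n)⁻¹ *
        (qPochNat q (-(q * t)) n * (qPochNat q (-t) n)⁻¹)) *
      (qPochNat q (q * a / (d * e)) n * qPochNat q (q * a / (d * g)) n *
        qPochNat q (q * a / (e * g)) n * qPochNat q (b * f / a) n * qPochNat q (c * f / a) n) *
      ((qPochNat q q n)⁻¹ * (qPochNat q (q / (g / f)) n)⁻¹ * (qPochNat q (q * f / e) n)⁻¹ *
        (qPochNat q (q * f / d) n)⁻¹ * (qPochNat q (q ^ 2 * a ^ 2 / (b * d * e * g)) n)⁻¹ *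
        (qPochNat q (q ^ 2 * a ^ 2 / (c * d * e * g)) n)⁻¹) * (q * a / (b * c)) ^ n := by
        simp only [phiTerm, extUpper, extLower, qPochList, List.map_cons, List.map_nil,
          List.prod_cons, List.prod_nil, List.length_cons, List.length_nil, mul_one, hgf,
          qPoch_natCast, div_eq_mul_inv (qPochNat _ _ _ * _), mul_inv]
        norm_num only [zpow_zero]
        ring
    _ = _ := by
      rw [hTT, hL, key (qNonzero_q hq), key h₃, key h₄, key h₅, key h₆, key h₇, normalizedPhiTerm,
        pow_succ' q n, mul_div_right_comm q (q ^ n) (g / f),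
        div_eq_mul_inv (qPochInf q (q * a * f / (d * e * g)))]
      simp only [mul_inv]
      ring

/-- The factor with n = 0 is (1 - t)(1 + t), nonzero by the conditions on the lower parameters t and
-t; the later factors are those of (q²af/deg;q)_∞ in the prefactor's denominator. -/
lemma qNonzero_extParameter (ht : t ^ 2 = q * a * f / (d * e * g))
    (hphi : PhiDefined (extLower q a b c d e f g t) q)
    (hden : ∀ x ∈ extDen q a b c d e f g, QNonzero q x) :
    QNonzero q (q * a * f / (d * e * g)) := by
  simp only [PhiDefined, extLower, List.forall_mem_cons] at hphi
  obtain ⟨h₁, h₂, -⟩ := hphi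
  simp only [extDen, List.forall_mem_cons] at hden
  have hq := hden.2.2.2.2.2.2.2.2.2.2.2.2.1
  intro n
  cases n with
  | zero =>
    have h := mul_ne_zero (h₁ 0) (h₂ 0)
    rw [← ht]
    convert h using 1
    ring
  | succ n =>
    convert hq n using 1
    ring

/-- Inserting (q/g, qa/g;q)_∞ above and below makes the denominator symmetric in f and g, except for
the theta product of g/f. -/
lemma extSummand_eq (hq : ‖q‖ < 1) (hq0 : q ≠ 0) (hf : f ≠ 0) (hg : g ≠ 0)
    (ht : t ^ 2 = q * a * f / (d * e * g))
    (h1a : 1 - a ≠ 0) (hqg : QNonzero q (q / g)) (hqag : QNonzero q (q * a / g))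
    (hphi : PhiDefined (extLower q a b c d e f g t) q)
    (hden : ∀ x ∈ extDen q a b c d e f g, QNonzero q x) :
    extSummand q a b c d e f g t =
    normalizedPrefactor q a b c d e f g * (∑' n, normalizedPhiTerm q a b c d e f g n) /
      (qPochInf q (q ^ 2 * a ^ 3 / (b * c * d * e * f * g)) * (qPochInf q (f * g / a) *
        (qPochInf q q * qPochInf q (g / f) * qPochInf q (q / (g / f)))) *
      ((1 - a) * ((qPochInf q (q / b) * qPochInf q (q * a / b)) *
      (qPochInf q (q / c) * qPochInf q (q * a / c)) *
      (qPochInf q (q / d) * qPochInf q (q * a / d)) *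
      (qPochInf q (q / e) * qPochInf q (q * a / e)) *
      (qPochInf q (q / f) * qPochInf q (q * a / f)) *
      (qPochInf q (q / g) * qPochInf q (q * a / g))))) := by
  have hl := qNonzero_extParameter ht hphi hden
  have hphi' : phi (extUpper q a b c d e f g t) (extLower q a b c d e f g t) q (q * a / (b * c)) =
      _ := (tsum_congr (phiTerm_ext hq hq0 hf hg ht hl hphi)).trans tsum_mul_left
  have hl0 : 1 - q * a * f / (d * e * g) ≠ 0 := by simpa using hl 0
  simp only [PhiDefined, extLower, List.forall_mem_cons] at hphi
  obtain ⟨-, -, h₃, h₄, h₅, h₆, h₇, -⟩ := hphi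
  simp only [extDen, List.forall_mem_cons] at hden
  obtain ⟨k₁, k₂, k₃, k₄, k₅, k₆, k₇, k₈, k₉, k₁₀, k₁₁, k₁₂, k₁₃, k₁₄, -⟩ := hden
  have hgf : q * f / g = q / (g / f) := by field_simp
  rw [hgf] at h₃
  have hgag : q / (g / a) = q * a / g := by field_simp
  have hll : q * a * f / (d * e * g) * q = q ^ 2 * a * f / (d * e * g) := by ring
  rw [extSummand, hphi', qPochInf_eq hq (q * a * f / (d * e * g)), hll, normalizedPrefactor, jtheta,
    jtheta, qPochInf_eq hq a, hgag, mul_comm a q]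
  simp only [extNum, extDen, qPochInfList, List.map_cons, List.map_nil, List.prod_cons,
    List.prod_nil, mul_one]
  have hqq := qPochInf_ne_zero hq (qNonzero_q hq)
  replace hqg := qPochInf_ne_zero hq hqg
  replace hqag := qPochInf_ne_zero hq hqag
  replace h₃ := qPochInf_ne_zero hq h₃
  replace h₄ := qPochInf_ne_zero hq h₄
  replace h₅ := qPochInf_ne_zero hq h₅
  replace h₆ := qPochInf_ne_zero hq h₆
  replace h₇ := qPochInf_ne_zero hq h₇
  replace k₁ := qPochInf_ne_zero hq k₁
  replace k₂ := qPochInf_ne_zero hq k₂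
  replace k₃ := qPochInf_ne_zero hq k₃
  replace k₄ := qPochInf_ne_zero hq k₄
  replace k₅ := qPochInf_ne_zero hq k₅
  replace k₆ := qPochInf_ne_zero hq k₆
  replace k₇ := qPochInf_ne_zero hq k₇
  replace k₈ := qPochInf_ne_zero hq k₈
  replace k₉ := qPochInf_ne_zero hq k₉
  replace k₁₀ := qPochInf_ne_zero hq k₁₀
  replace k₁₁ := qPochInf_ne_zero hq k₁₁
  replace k₁₂ := qPochInf_ne_zero hq k₁₂
  replace k₁₃ := qPochInf_ne_zero hq k₁₃
  replace k₁₄ := qPochInf_ne_zero hq k₁₄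
  rw [div_mul_eq_mul_div, div_mul_eq_mul_div, mul_div_assoc', div_div, div_eq_div_iff]
  · ring
  all_goals
    repeat' first
      | assumption
      | apply mul_ne_zero

end PhiSeries

end WellPoised

/-! ### Assembly of the theorem. -/

section Main

variable {q : ℂ}

lemma jtheta_inv (hq : ‖q‖ < 1) {x : ℂ} (hx : x ≠ 0) :
    jtheta q x⁻¹ = -x⁻¹ * jtheta q x := by
  unfold jtheta
  rw [qPochInf_eq hq x, qPochInf_eq hq x⁻¹, div_inv_eq_mul, mul_comm q x, inv_mul_eq_div x q]
  field_simp
  ring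

end Main

theorem lemma2p1 (q a b c d e f g s t u : ℂ)
    (hq0 : q ≠ 0) (hq1 : ‖q‖ < 1)
    (ha : a ≠ 0) (hb : b ≠ 0) (hc : c ≠ 0) (hd : d ≠ 0) (he : e ≠ 0) (hf : f ≠ 0) (hg : g ≠ 0)
    -- `s`, `t`, `u` are (any choices of) the square roots in the formula
    (hs : s ^ 2 = a) (ht : t ^ 2 = q * a * f / (d * e * g)) (hu : u ^ 2 = q * a * g / (d * e * f))
    (hconv : max ‖q ^ 2 * a ^ 3 / (b * c * d * e * f * g)‖ ‖q * a / (b * c)‖ < 1)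
    -- no denominator in the formula vanishes
    (hpsi : PsiDefined [q * s, -(q * s), b, c, d, e, f, g]
      [s, -s, q * a / b, q * a / c, q * a / d, q * a / e, q * a / f, q * a / g] q)
    (hphi_f : PhiDefined (extLower q a b c d e f g t) q)
    (hphi_g : PhiDefined (extLower q a b c d e g f u) q)
    (hden_f : ∀ x ∈ extDen q a b c d e f g, QNonzero q x)
    (hden_g : ∀ x ∈ extDen q a b c d e g f, QNonzero q x) :
    -- the three series converge
    Summable (psiTerm [q * s, -(q * s), b, c, d, e, f, g]
      [s, -s, q * a / b, q * a / c, q * a / d, q * a / e, q * a / f, q * a / g]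
      q (q ^ 2 * a ^ 3 / (b * c * d * e * f * g))) ∧
    Summable (phiTerm (extUpper q a b c d e f g t) (extLower q a b c d e f g t)
      q (q * a / (b * c))) ∧
    Summable (phiTerm (extUpper q a b c d e g f u) (extLower q a b c d e g f u)
      q (q * a / (b * c))) ∧
    -- the identity
    psi [q * s, -(q * s), b, c, d, e, f, g]
        [s, -s, q * a / b, q * a / c, q * a / d, q * a / e, q * a / f, q * a / g]
        q (q ^ 2 * a ^ 3 / (b * c * d * e * f * g)) =
      extSummand q a b c d e f g t + extSummand q a b c d e g f u ∧
    -- for `g = a q / e` its two sides are those of Bailey's `₆ψ₆` identity in `b, c, d, f`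
    (g = a * q / e →
      psi [q * s, -(q * s), b, c, d, e, f, g]
          [s, -s, q * a / b, q * a / c, q * a / d, q * a / e, q * a / f, q * a / g]
          q (q ^ 2 * a ^ 3 / (b * c * d * e * f * g)) =
        psi [q * s, -(q * s), b, c, d, f]
          [s, -s, q * a / b, q * a / c, q * a / d, q * a / f]
          q (q * a ^ 2 / (b * c * d * f)) ∧
      extSummand q a b c d e f g t + extSummand q a b c d e g f u =
        qPochInfList q [q, q * a, q / a, q * a / (b * c), q * a / (b * d), q * a / (b * f),
            q * a / (c * d), q * a / (c * f), q * a / (d * f)] /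
          qPochInfList q [q / b, q / c, q / d, q / f, q * a / b, q * a / c, q * a / d, q * a / f,
            q * a ^ 2 / (b * c * d * f)]) := by
  obtain ⟨hz, hbc⟩ := max_lt_iff.1 hconv
  have hl := qNonzero_extParameter ht hphi_f hden_f
  have hl' := qNonzero_extParameter hu hphi_g hden_g
  have h8 := psiTerm_eight hq1 hq0 ha hb hc hd he hf hg hs hpsi
  have hΦf := phiTerm_ext (b := b) (c := c) hq1 hq0 hf hg ht hl hphi_f
  have hΦg := phiTerm_ext (b := b) (c := c) hq1 hq0 hg hf hu hl' hphi_g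
  have hid := wellPoisedEight_identity hq1 hq0 ha hb hc hd he hf hg hl hl' hz hbc
  have hpsi' := hpsi
  simp only [PsiDefined, List.forall_mem_cons] at hpsi'
  obtain ⟨⟨-, -, ub, uc, ud, ue, uf, ug, -⟩, l₁, l₂, lb, lc, ld, le, lf, lg, -⟩ := hpsi'
  have h1a : 1 - a ≠ 0 := by
    have h := mul_ne_zero (l₁ 0) (l₂ 0)
    rw [← hs]
    convert h using 1
    ring
  have hSf := extSummand_eq hq1 hq0 hf hg ht h1a ug lg hphi_f hden_f
  have hSg := extSummand_eq hq1 hq0 hg hf hu h1a uf lf hphi_g hden_g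
  have hpsi8 : psi [q * s, -(q * s), b, c, d, e, f, g]
      [s, -s, q * a / b, q * a / c, q * a / d, q * a / e, q * a / f, q * a / g]
      q (q ^ 2 * a ^ 3 / (b * c * d * e * f * g)) = _ := (tsum_congr h8).trans tsum_mul_left
  simp only [PhiDefined, extLower, List.forall_mem_cons] at hphi_f
  simp only [extDen, List.forall_mem_cons] at hden_f
  have hqq := qPochInf_ne_zero hq1 (qNonzero_q hq1)
  have hgf := qPochInf_ne_zero hq1 hden_f.2.2.2.2.2.2.2.2.2.2.1
  have hfga := qPochInf_ne_zero hq1 hden_f.2.2.2.2.2.2.2.2.2.2.2.1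
  have hz0 := qPochInf_ne_zero hq1 hden_f.2.2.2.2.2.2.2.2.2.2.2.2.2.1
  have hqfg := qPochInf_ne_zero hq1 hphi_f.2.2.1
  replace ub := qPochInf_ne_zero hq1 ub
  replace uc := qPochInf_ne_zero hq1 uc
  replace ud := qPochInf_ne_zero hq1 ud
  replace ue := qPochInf_ne_zero hq1 ue
  replace uf := qPochInf_ne_zero hq1 uf
  replace ug := qPochInf_ne_zero hq1 ug
  replace lb := qPochInf_ne_zero hq1 lb
  replace lc := qPochInf_ne_zero hq1 lc
  replace ld := qPochInf_ne_zero hq1 ld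
  replace le := qPochInf_ne_zero hq1 le
  replace lf := qPochInf_ne_zero hq1 lf
  replace lg := qPochInf_ne_zero hq1 lg
  have hmain : psi [q * s, -(q * s), b, c, d, e, f, g]
      [s, -s, q * a / b, q * a / c, q * a / d, q * a / e, q * a / f, q * a / g]
      q (q ^ 2 * a ^ 3 / (b * c * d * e * f * g)) =
      extSummand q a b c d e f g t + extSummand q a b c d e g f u := by
    -- Theta inversion accounts for the factor g/f and the relative sign: it turns the difference in
    -- `wellPoisedEight_identity` into the sum of two summands exchanged by f ↔ g.
    have hth : qPochInf q (f / g) * qPochInf q (q / (f / g)) =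
        -(f / g) * (qPochInf q (g / f) * qPochInf q (q / (g / f))) := by
      simpa [jtheta] using jtheta_inv hq1 (div_ne_zero hg hf)
    rw [show q * f / g = q / (g / f) by field_simp] at hqfg
    have hden0 : qPochInf q (q ^ 2 * a ^ 3 / (b * c * d * e * f * g)) *
        (qPochInf q (f * g / a) *
          -(qPochInf q q * qPochInf q (g / f) * qPochInf q (q / (g / f)))) ≠ 0 := by
      simp only [ne_eq, mul_eq_zero, neg_eq_zero, not_or]
      exact ⟨hz0, hfga, ⟨hqq, hgf⟩, hqfg⟩
    rw [hpsi8, hSf, hSg, mul_assoc (qPochInf q q) (qPochInf q (f / g)),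
      hth, eq_div_of_mul_eq hden0 ((mul_comm _ _).trans hid), mul_comm g f,
      show b * c * d * e * g * f = b * c * d * e * f * g by ring]
    have key : ∀ A B X Y : ℂ, X⁻¹ * ((g / f * A - B) / -Y) =
        B / (Y * X) + A / (-(f / g) * Y * X) := fun A B X Y => by
      rw [neg_mul, neg_mul, div_neg, div_neg, mul_assoc, ← div_div A, div_div_eq_mul_div,
        ← div_div B, ← div_div (A * g / f)]
      ring
    convert key _ _ _ (qPochInf q (q ^ 2 * a ^ 3 / (b * c * d * e * f * g)) *
      (qPochInf q (f * g / a) *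
        (qPochInf q q * qPochInf q (g / f) * qPochInf q (q / (g / f))))) using 3
    · ring
    · ring
  refine ⟨?_, ?_, ?_, hmain, fun hge => ?_⟩
  · exact ((summable_wellPoisedEight hq1 hq0 ha hz).mul_left _).congr fun k => (h8 k).symm
  · exact ((summable_normalizedPhiTerm hq1 d e f g hbc).mul_left _).congr fun k => (hΦf k).symm
  · exact ((summable_normalizedPhiTerm hq1 d e g f hbc).mul_left _).congr fun k => (hΦg k).symm
  · have h86 : psi [q * s, -(q * s), b, c, d, e, f, g]
          [s, -s, q * a / b, q * a / c, q * a / d, q * a / e, q * a / f, q * a / g]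
          q (q ^ 2 * a ^ 3 / (b * c * d * e * f * g)) =
        psi [q * s, -(q * s), b, c, d, f]
          [s, -s, q * a / b, q * a / c, q * a / d, q * a / f]
          q (q * a ^ 2 / (b * c * d * f)) :=
      tsum_congr (psiTerm_eight_eq_six hq0 he hg hge hpsi)
    refine ⟨h86, ?_⟩
    have hz6 : q ^ 2 * a ^ 3 / (b * c * d * e * f * g) = q * a ^ 2 / (b * c * d * f) := by
      rw [hge]
      field_simp
    have hpsi6 : PsiDefined [q * s, -(q * s), b, c, d, f]
        [s, -s, q * a / b, q * a / c, q * a / d, q * a / f] q := by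
      simp only [PsiDefined, List.forall_mem_cons] at hpsi ⊢
      tauto
    have hW : psi [q * s, -(q * s), b, c, d, f]
        [s, -s, q * a / b, q * a / c, q * a / d, q * a / f] q (q * a ^ 2 / (b * c * d * f)) = _ :=
      (tsum_congr (psiTerm_six hq1 hq0 ha hb hc hd hf hs hpsi6)).trans tsum_mul_left
    have hzz : q * a ^ 2 * (b⁻¹ * c⁻¹ * d⁻¹ * f⁻¹) = q * a ^ 2 / (b * c * d * f) := by
      field_simp
    rw [hz6] at hz hz0
    have h6 := tsum_wellPoisedSix hq1 hq0 ha (hzz ▸ hz)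
    rw [hzz] at h6
    have hprod : ∀ x y : ℂ, q * a * x⁻¹ * y⁻¹ = q * a / (x * y) := fun x y => by
      rw [div_eq_mul_inv, mul_inv, mul_assoc (q * a)]
    simp only [hprod] at h6
    -- The right side is not summed directly: it equals the ₈ψ₈, which is now a ₆ψ₆ and is given by
    -- Bailey's sum.
    rw [← hmain, h86, hW, eq_div_of_mul_eq hz0 ((mul_comm _ _).trans h6),
      qPochInf_eq hq1 a, mul_comm a q]
    simp only [qPochInfList, List.map_cons, List.map_nil, List.prod_cons, List.prod_nil, mul_one]
    rw [inv_mul_eq_div, div_div, div_eq_div_iff]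
    · ring
    all_goals
      repeat' first
        | assumption
        | apply mul_ne_zero
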